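/- Let $d\ge 2$ be an even integer and $f(z)=z^{d+1}$, $z\in\mathbb C$. A deformation of $f$ is a germ of a holomorphic function $F:(\mathbb C\times\mathbb C^k,0)\to(\mathbb C,0)$ with $F(z,0)=f(z)$; write $f_\lambda=F(\cdot,\lambda)$. It is versal if every deformation $G$ of $f$ (with any number of parameters $\mu$) can be written near the origin as $G(z,\mu)=F(g(z,\mu),\theta(\mu))$ with holomorphic germs $g,\theta$ such that $g(z,0)=z$ and $\theta(0)=0$. The pure Stokes' set of $F$ is the germ at $0\in\mathbb C^k$ of the closure of the set of parameters $\lambda$ for which $f_\lambda$ has, at critical points close to $0$, four different critical values $\alpha,\alpha',\beta,\beta'$ with $\alpha+\alpha'=\beta+\beta'$. The local multiplicity at $0$ of a (possibly empty) hypersurface germ is the order of vanishing at $0$ of a reduced holomorphic equation of it, i.e. the order of the restriction of this equation to a generic line through $0$, the lines realizing this minimal order being called generic. Then for every versal deformation of $f$ the pure Stokes' set is a (possibly empty) hypersurface germ of local multiplicity $$m=\frac{(d-2)\bigl((d+1)(d-1)(d-3)+1\bigr)}{8}.$$ The same holds for the deformation $z^{d+1}+\sum_{j=0}^{d-1}\lambda_jz^j$.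 Moreover, if $d\ge 4$, consider in the parameter space of this deformation the lines $\varepsilon\mapsto z^{d+1}-\varepsilon\varphi(z)$, where $\varphi(z)=\sum_{j=0}^{d-1}q_jz^j$. If $\varphi$ is of degree at most $1$, then near the origin this line is contained in the pure Stokes' set, so it is not generic; more generally, if $q_2=0$, then the line is not generic: the restriction to it of a reduced equation of the pure Stokes' set has order greater than $m$ at $\varepsilon=0$. If $q_1\ne0$ and $q_2\ne0$, then the line is generic: this order is equal to $m$. -/

import Mathlib

open Filter Topology

/-- `F : (ℂ × ℂ^k, 0) → ℂ` is (a representative of) a deformation of the function germ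
`f : (ℂ, 0) → ℂ`: it is holomorphic near `(0, 0)` and `F (·, 0) = f` as germs at `0`. -/
def IsDeformation (f : ℂ → ℂ) {k : ℕ} (F : ℂ → (Fin k → ℂ) → ℂ) : Prop :=
  AnalyticAt ℂ (fun p : ℂ × (Fin k → ℂ) => F p.1 p.2) 0 ∧ ∀ᶠ z in 𝓝 (0 : ℂ), F z 0 = f z

/-- Versality (for right equivalence of function germs): every deformation `G` of `f`, with any
number of parameters, is equivalent to one induced from `F`, i.e. near `(0, 0)`
`G (z, μ) = F (g (z, μ), θ μ)` with `g`, `θ` holomorphic germs, `g (z, 0) = z`, `θ 0 = 0`. -/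
def IsVersalDeformation (f : ℂ → ℂ) {k : ℕ} (F : ℂ → (Fin k → ℂ) → ℂ) : Prop :=
  IsDeformation f F ∧
    ∀ (l : ℕ) (G : ℂ → (Fin l → ℂ) → ℂ), IsDeformation f G →
      ∃ (g : ℂ → (Fin l → ℂ) → ℂ) (θ : (Fin l → ℂ) → (Fin k → ℂ)),
        AnalyticAt ℂ (fun p : ℂ × (Fin l → ℂ) => g p.1 p.2) 0 ∧
        (∀ᶠ z in 𝓝 (0 : ℂ), g z 0 = z) ∧
        AnalyticAt ℂ θ 0 ∧ θ 0 = 0 ∧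
        ∀ᶠ p in 𝓝 (0 : ℂ × (Fin l → ℂ)), G p.1 p.2 = F (g p.1 p.2) (θ p.2)

/-- The pure Stokes' set of the family `F`, with critical points taken in the disc `‖z‖ < r`:
the closure of the set of parameters `lam` such that `F (·, lam)` has four different critical
values `α, α', β, β'` at critical points in that disc with `α + α' = β + β'`. For a deformation of
an isolated singularity its germ at `0` does not depend on the (small) radius `r`. -/
def pureStokesSet {k : ℕ} (F : ℂ → (Fin k → ℂ) → ℂ) (r : ℝ) : Set (Fin k → ℂ) :=
  closure {lam | ∃ z : Fin 4 → ℂ,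
    (∀ i, ‖z i‖ < r ∧ deriv (fun w => F w lam) (z i) = 0) ∧
    Function.Injective (fun i => F (z i) lam) ∧
    F (z 0) lam + F (z 1) lam = F (z 2) lam + F (z 3) lam}

/-- `g` is a reduced equation of the germ of `X` at `0`: it is holomorphic near `0`, it vanishes
there exactly on `X`, and it has multiplicity one (a nonzero differential) at generic points
of `X`. -/
def IsReducedEquation {k : ℕ} (X : Set (Fin k → ℂ)) (g : (Fin k → ℂ) → ℂ) : Prop :=
  AnalyticAt ℂ g 0 ∧
  (∀ᶠ x in 𝓝 (0 : Fin k → ℂ), x ∈ X ↔ g x = 0) ∧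
  ∀ᶠ x in 𝓝 (0 : Fin k → ℂ), x ∈ X → x ∈ closure {y | y ∈ X ∧ fderiv ℂ g y ≠ 0}

/-- The order of vanishing at `t = 0` of the restriction of `g` to the line `t ↦ t • v`. -/
noncomputable def lineOrder {k : ℕ} (g : (Fin k → ℂ) → ℂ) (v : Fin k → ℂ) : ℕ∞ :=
  analyticOrderAt (fun t : ℂ => g (t • v)) 0

/-- The order of vanishing of `g` at `0`: the order of its restriction to a generic (that is,
order-minimizing) line through `0`. -/
noncomputable def vanishingOrder {k : ℕ} (g : (Fin k → ℂ) → ℂ) : ℕ∞ :=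
  ⨅ v : Fin k → ℂ, lineOrder g v

/-- The germ of `X` at `0` is a hypersurface (possibly empty) of multiplicity `m`. -/
def HasLocalMultiplicity {k : ℕ} (X : Set (Fin k → ℂ)) (m : ℕ) : Prop :=
  ∃ g : (Fin k → ℂ) → ℂ, IsReducedEquation X g ∧ vanishingOrder g = m

/-- The monomial deformation `z^(d+1) + ∑ j < d, lam j * z^j`. -/
def monomialDeformation (d : ℕ) : ℂ → (Fin d → ℂ) → ℂ :=
  fun z lam => z ^ (d + 1) + ∑ j : Fin d, lam j * z ^ (j : ℕ)

/-- The direction, in the parameter space of `monomialDeformation d`, of the line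
`ε ↦ z^(d+1) - ε φ(z)`, for a polynomial `φ` of degree less than `d`. -/
def lineDirection (d : ℕ) (φ : Polynomial ℂ) : Fin d → ℂ :=
  fun j => - φ.coeff j

/-!
Write `M` for the monomial deformation, `α i` for the critical values of `M (·, lam)`, listed with
multiplicities, and `d = 2 n`.

*The equation.* The product over all `4`-subsets of the critical values of the three expressions
`α a + α b - α c - α e` is symmetric, hence a polynomial `p` in the parameters (`stokesForm`,
`exists_stokesPoly`). It vanishes on the pure Stokes' set, and it is a reduced equation of it
because near any of its zeros there are parameters where all critical values are different and only
one of the factors vanishes (`IsStokesPoly.mem_closure`): two different relations between critical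
values, as functions of the critical points, have no common component
(`exists_rename_mem_span_valueForm`). Indeed the polynomial ring in the critical points is integral
over the ring generated by the differences of the critical values and the sum of the critical
points, since a polynomial of degree `d + 1` all of whose critical values coincide has a single
critical point; so two independent relations cut out a set of codimension two. As the critical
values are local coordinates at parameters with simple critical points, `p` has a nonzero
differential at such parameters (`IsStokesPoly.fderiv_ne_zero`).

*The order along lines.* The substitution `z ↦ t z`, `ε = t ^ d` turns `z ^ (d + 1) - ε φ` into
`t ^ (d + 1)` times `z ^ (d + 1) - q₁ z - t q₂ z ^ 2 - ⋯`, up to a constant. So `p` acquires the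
factor `t ^ (3 (d + 1) (d choose 4))`. If `q₁ ≠ 0`, the critical values for `t = 0` are the vertices
of a regular `d`-gon, and since four points on a circle with `a + b = c + e` form two antipodal
pairs, exactly `n choose 2` factors vanish for `t = 0`. In each of these the term `t q₂ z ^ 2`
produces a simple zero if `q₂ ≠ 0`, and a zero of higher order if `q₂ = 0`. If `q₁ = 0`, all
critical values tend to zero and the order is larger, too. Altogether, for `d ≥ 4`, the order in `ε`
is `m = (3 (d + 1) (d choose 4) + (n choose 2)) / d` if `q₁ q₂ ≠ 0` and larger otherwise
(`IsStokesPoly.exists_tendsto_smul`, `exists_multiplicity`). For `d = 2` the product is empty and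
`m = 0`.

*Versal deformations.* In the Banach space of holomorphic functions on a small disc, the inverse
function theorem for `(g, lam) ↦ M (g, lam)` at `(id, 0)`, whose differential is invertible by
division with remainder by `z ^ d`, shows that every deformation `F` is induced from `M` by a map
`θ` of parameters (`exists_eq_monomialDeformation`). If `F` is versal, `M` is also induced from `F`,
whence `θ` is a submersion (`surjective_fderiv_of_isVersalDeformation`). The pure Stokes' set of
`F` is then the inverse image under `θ` of that of `M`, and `p ∘ θ` is a reduced equation of it with
the same order (`IsStokesPoly.isReducedEquation`, `IsStokesPoly.lineOrder_comp`).
-/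

namespace PureStokes

/-! ### The symmetric product of all relations between four values -/

section QuartetForm

variable {ι κ R R' : Type*} [CommRing R] [CommRing R']

/-- Three times the product of the three expressions `a + b - c - e`, `a + c - b - e`,
`a + e - b - c`, where `a, b, c, e` are the values of `α` on the four-element set `S`. Writing it
through power sums makes the independence of the order of `S` evident. -/
def quartetForm (S : Finset ι) (α : ι → R) : R :=
  (∑ i ∈ S, α i) ^ 3 - 6 * (∑ i ∈ S, α i) * (∑ i ∈ S, α i ^ 2) + 8 * ∑ i ∈ S, α i ^ 3

/-- The product over all ways to choose two disjoint unordered pairs `{a, b}`, `{c, e}` of indices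
of the expressions `α a + α b - α c - α e`, up to a constant factor. -/
def stokesForm [Fintype ι] (α : ι → R) : R :=
  ∏ S ∈ (Finset.univ : Finset ι).powersetCard 4, quartetForm S α

lemma quartetForm_insert [DecidableEq ι] (α : ι → R) {a b c e : ι} (hab : a ≠ b) (hac : a ≠ c)
    (hae : a ≠ e) (hbc : b ≠ c) (hbe : b ≠ e) (hce : c ≠ e) :
    quartetForm {a, b, c, e} α = 3 * ((α a + α b - α c - α e) *
      ((α a + α c - α b - α e) * (α a + α e - α b - α c))) := by
  have h1 : a ∉ ({b, c, e} : Finset ι) := by simp [hab, hac, hae]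
  have h2 : b ∉ ({c, e} : Finset ι) := by simp [hbc, hbe]
  have h3 : c ∉ ({e} : Finset ι) := by simp [hce]
  simp only [quartetForm, Finset.sum_insert h1, Finset.sum_insert h2, Finset.sum_insert h3,
    Finset.sum_singleton]
  ring

lemma exists_eq_insert_of_card_four [DecidableEq ι] {S : Finset ι} (hS : S.card = 4) :
    ∃ a b c e : ι, a ≠ b ∧ a ≠ c ∧ a ≠ e ∧ b ≠ c ∧ b ≠ e ∧ c ≠ e ∧ S = {a, b, c, e} := by
  obtain ⟨a, T, ha, rfl, hT⟩ := Finset.card_eq_succ.1 hS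
  obtain ⟨b, c, e, hbc, hbe, hce, rfl⟩ := Finset.card_eq_three.1 hT
  simp only [Finset.mem_insert, Finset.mem_singleton, not_or] at ha
  exact ⟨a, b, c, e, ha.1, ha.2.1, ha.2.2, hbc, hbe, hce, rfl⟩

lemma map_quartetForm (f : R →+* R') (S : Finset ι) (α : ι → R) :
    f (quartetForm S α) = quartetForm S (fun i => f (α i)) := by
  have h6 : f 6 = 6 := map_ofNat f 6
  have h8 : f 8 = 8 := map_ofNat f 8
  simp [quartetForm, map_sum, h6, h8]

lemma map_stokesForm [Fintype ι] (f : R →+* R') (α : ι → R) :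
    f (stokesForm α) = stokesForm (fun i => f (α i)) := by
  simp [stokesForm, map_prod, map_quartetForm]

lemma quartetForm_map (e : ι ↪ κ) (S : Finset ι) (α : κ → R) :
    quartetForm (S.map e) α = quartetForm S (fun i => α (e i)) := by
  simp [quartetForm, Finset.sum_map]

lemma stokesForm_equiv [Fintype ι] [Fintype κ] (e : ι ≃ κ) (α : κ → R) :
    stokesForm (fun i => α (e i)) = stokesForm α := by
  classical
  simp only [stokesForm]
  refine Finset.prod_bij (fun S _ => S.map e.toEmbedding) ?_ ?_ ?_ ?_
  · intro S hS
    simpa [Finset.mem_powersetCard] using hS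
  · intro S _ T _ h
    exact Finset.map_injective _ h
  · intro T hT
    refine ⟨T.map e.symm.toEmbedding, ?_, ?_⟩
    · simpa [Finset.mem_powersetCard] using hT
    · ext; simp
  · intro S _
    exact (quartetForm_map e.toEmbedding S α).symm

lemma stokesForm_mul_add [Fintype ι] (t c : R) (α : ι → R) :
    stokesForm (fun i => t * α i + c) =
      t ^ (3 * (Fintype.card ι).choose 4) * stokesForm α := by
  classical
  have key : ∀ S ∈ (Finset.univ : Finset ι).powersetCard 4,
      quartetForm S (fun i => t * α i + c) = t ^ 3 * quartetForm S α := by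
    intro S hS
    obtain ⟨a, b, c', e, h1, h2, h3, h4, h5, h6, rfl⟩ :=
      exists_eq_insert_of_card_four (Finset.mem_powersetCard.1 hS).2
    rw [quartetForm_insert _ h1 h2 h3 h4 h5 h6, quartetForm_insert _ h1 h2 h3 h4 h5 h6]
    ring
  rw [stokesForm, Finset.prod_congr rfl key, Finset.prod_mul_distrib, Finset.prod_const,
    Finset.card_powersetCard, Finset.card_univ, ← pow_mul, stokesForm]

lemma quartetForm_eq_zero_of_relation [DecidableEq ι] {α : ι → R} {a b c e : ι} (hab : a ≠ b)
    (hac : a ≠ c) (hae : a ≠ e) (hbc : b ≠ c) (hbe : b ≠ e) (hce : c ≠ e)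
    (h : α a + α b = α c + α e) : quartetForm {a, b, c, e} α = 0 := by
  rw [quartetForm_insert α hab hac hae hbc hbe hce,
    show α a + α b - α c - α e = 0 by rw [h]; ring]
  ring

lemma stokesForm_eq_zero_of_relation [Fintype ι] {α : ι → R} {a b c e : ι} (hab : a ≠ b)
    (hac : a ≠ c) (hae : a ≠ e) (hbc : b ≠ c) (hbe : b ≠ e) (hce : c ≠ e)
    (h : α a + α b = α c + α e) : stokesForm α = 0 := by
  classical
  refine Finset.prod_eq_zero (i := {a, b, c, e}) ?_
    (quartetForm_eq_zero_of_relation hab hac hae hbc hbe hce h)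
  rw [Finset.mem_powersetCard]
  refine ⟨Finset.subset_univ _, ?_⟩
  rw [Finset.card_eq_succ]
  exact ⟨a, {b, c, e}, by simp [hab, hac, hae], rfl, Finset.card_eq_three.2
    ⟨b, c, e, hbc, hbe, hce, rfl⟩⟩

lemma exists_relation_of_quartetForm_eq_zero [IsDomain R] [CharZero R] [DecidableEq ι]
    {α : ι → R} {S : Finset ι} (hS : S.card = 4) (h : quartetForm S α = 0) :
    ∃ a b c e : ι, a ≠ b ∧ a ≠ c ∧ a ≠ e ∧ b ≠ c ∧ b ≠ e ∧ c ≠ e ∧ S = {a, b, c, e} ∧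
      α a + α b = α c + α e := by
  obtain ⟨a, b, c, e, h1, h2, h3, h4, h5, h6, rfl⟩ := exists_eq_insert_of_card_four hS
  rw [quartetForm_insert α h1 h2 h3 h4 h5 h6] at h
  rcases mul_eq_zero.1 h with h | h
  · exact absurd h (by exact_mod_cast (three_ne_zero : (3 : ℕ) ≠ 0))
  rcases mul_eq_zero.1 h with h | h
  · exact ⟨a, b, c, e, h1, h2, h3, h4, h5, h6, rfl, by linear_combination h⟩
  rcases mul_eq_zero.1 h with h | h
  · refine ⟨a, c, b, e, h2, h1, h3, h4.symm, h6, h5, ?_, by linear_combination h⟩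
    ext; simp; tauto
  · refine ⟨a, e, b, c, h3, h1, h2, h5.symm, h6.symm, h4, ?_, by linear_combination h⟩
    ext; simp; tauto

lemma exists_relation_of_stokesForm_eq_zero [Fintype ι] [IsDomain R] [CharZero R]
    {α : ι → R} (h : stokesForm α = 0) :
    ∃ a b c e : ι, a ≠ b ∧ a ≠ c ∧ a ≠ e ∧ b ≠ c ∧ b ≠ e ∧ c ≠ e ∧
      α a + α b = α c + α e := by
  classical
  obtain ⟨S, hS, hS0⟩ := Finset.prod_eq_zero_iff.1 h
  obtain ⟨a, b, c, e, h1, h2, h3, h4, h5, h6, -, h7⟩ :=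
    exists_relation_of_quartetForm_eq_zero (Finset.mem_powersetCard.1 hS).2 hS0
  exact ⟨a, b, c, e, h1, h2, h3, h4, h5, h6, h7⟩

end QuartetForm

/-! ### Critical points of the monomial deformation -/

section CriticalPoints

open Polynomial

/-- The member of the monomial deformation with parameter `lam`, as a polynomial. -/
noncomputable def defPoly {d : ℕ} (lam : Fin d → ℂ) : ℂ[X] :=
  X ^ (d + 1) + ∑ j : Fin d, C (lam j) * X ^ (j : ℕ)

/-- `x` lists the critical points of `defPoly lam`, with multiplicities. -/
def IsCriticalVector {d : ℕ} (lam x : Fin d → ℂ) : Prop :=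
  derivative (defPoly lam) = C ((d : ℂ) + 1) * ∏ i, (X - C (x i))

lemma eval_defPoly {d : ℕ} (lam : Fin d → ℂ) (z : ℂ) :
    (defPoly lam).eval z = monomialDeformation d z lam := by
  simp [defPoly, monomialDeformation, eval_finsetSum]

lemma natCast_add_one_ne_zero' (d : ℕ) : (d : ℂ) + 1 ≠ 0 := Nat.cast_add_one_ne_zero d

lemma monomialDeformation_lam_eq {d : ℕ} (lam : Fin d → ℂ) :
    (fun z => monomialDeformation d z lam) = fun z => (defPoly lam).eval z := by
  funext z; rw [eval_defPoly]

lemma deriv_monomialDeformation {d : ℕ} (lam : Fin d → ℂ) (z : ℂ) :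
    deriv (fun w => monomialDeformation d w lam) z = (derivative (defPoly lam)).eval z := by
  rw [monomialDeformation_lam_eq, Polynomial.deriv]

lemma coeff_sum_lt {d : ℕ} (lam : Fin d → ℂ) (k : ℕ) :
    (∑ j : Fin d, C (lam j) * X ^ (j : ℕ)).coeff k = if h : k < d then lam ⟨k, h⟩ else 0 := by
  simp only [finsetSum_coeff, coeff_C_mul, coeff_X_pow, mul_ite, mul_one, mul_zero]
  split_ifs with h
  · rw [Finset.sum_eq_single ⟨k, h⟩]
    · simp
    · intro b _ hb
      rw [if_neg]
      rintro rfl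
      exact hb rfl
    · simp
  · refine Finset.sum_eq_zero fun j _ => if_neg ?_
    have := j.2
    omega

lemma degree_sum_lt {d : ℕ} (lam : Fin d → ℂ) :
    (∑ j : Fin d, C (lam j) * X ^ (j : ℕ)).degree < (d : WithBot ℕ) := by
  rw [degree_lt_iff_coeff_zero]
  intro m hm
  rw [coeff_sum_lt, dif_neg (by omega)]

lemma coeff_defPoly_of_lt {d : ℕ} (lam : Fin d → ℂ) {k : ℕ} (h : k < d) :
    (defPoly lam).coeff k = lam ⟨k, h⟩ := by
  rw [defPoly, coeff_add, coeff_sum_lt, dif_pos h, coeff_X_pow, if_neg (by omega), zero_add]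

lemma coeff_defPoly_self {d : ℕ} (lam : Fin d → ℂ) : (defPoly lam).coeff d = 0 := by
  rw [defPoly, coeff_add, coeff_sum_lt, dif_neg (by omega), coeff_X_pow, if_neg (by omega),
    zero_add]

lemma coeff_defPoly_succ {d : ℕ} (lam : Fin d → ℂ) : (defPoly lam).coeff (d + 1) = 1 := by
  rw [defPoly, coeff_add, coeff_sum_lt, dif_neg (by omega), coeff_X_pow, if_pos rfl, add_zero]

lemma degree_defPoly {d : ℕ} (lam : Fin d → ℂ) : (defPoly lam).degree = (d + 1 : ℕ) := by
  rw [defPoly, degree_add_eq_left_of_degree_lt, degree_X_pow]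
  rw [degree_X_pow]
  exact (degree_sum_lt lam).trans (by exact_mod_cast Nat.lt_succ_self d)

lemma natDegree_defPoly {d : ℕ} (lam : Fin d → ℂ) : (defPoly lam).natDegree = d + 1 :=
  natDegree_eq_of_degree_eq_some (degree_defPoly lam)

lemma natDegree_derivative_defPoly {d : ℕ} (lam : Fin d → ℂ) :
    (derivative (defPoly lam)).natDegree = d := by
  rw [natDegree_derivative, natDegree_defPoly, Nat.add_sub_cancel]

lemma leadingCoeff_derivative_defPoly {d : ℕ} (lam : Fin d → ℂ) :
    (derivative (defPoly lam)).leadingCoeff = (d : ℂ) + 1 := by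
  rw [leadingCoeff, natDegree_derivative_defPoly, coeff_derivative, coeff_defPoly_succ, one_mul]

lemma exists_fin_map_eq {β : Type*} {d : ℕ} {s : Multiset β} (hs : s.card = d) :
    ∃ x : Fin d → β, s = Finset.univ.val.map x := by
  subst hs
  refine ⟨fun i => s.toList.get (i.cast (Multiset.length_toList s).symm), ?_⟩
  rw [Fin.univ_val_map]
  conv_lhs => rw [← Multiset.coe_toList s]
  congr 1
  apply List.ext_getElem <;> simp

lemma exists_isCriticalVector {d : ℕ} (lam : Fin d → ℂ) : ∃ x, IsCriticalVector lam x := by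
  set q := derivative (defPoly lam) with hq
  have hs : q.Splits := IsAlgClosed.splits q
  have hcard : q.roots.card = d := by
    rw [← natDegree_derivative_defPoly lam]
    exact splits_iff_card_roots.1 hs
  obtain ⟨x, hx⟩ := exists_fin_map_eq hcard
  refine ⟨x, ?_⟩
  have h := C_leadingCoeff_mul_prod_multiset_X_sub_C
    (hcard.trans (natDegree_derivative_defPoly lam).symm)
  rw [leadingCoeff_derivative_defPoly, hx, Multiset.map_map] at h
  exact h.symm

lemma IsCriticalVector.deriv_eq {d : ℕ} {lam x : Fin d → ℂ} (h : IsCriticalVector lam x) (z : ℂ) :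
    deriv (fun w => monomialDeformation d w lam) z = ((d : ℂ) + 1) * ∏ i, (z - x i) := by
  rw [deriv_monomialDeformation, h]
  simp [eval_prod]

lemma IsCriticalVector.deriv_eq_zero_iff {d : ℕ} {lam x : Fin d → ℂ} (h : IsCriticalVector lam x)
    (z : ℂ) : deriv (fun w => monomialDeformation d w lam) z = 0 ↔ ∃ i, z = x i := by
  rw [h.deriv_eq, mul_eq_zero, or_iff_right (natCast_add_one_ne_zero' d), Finset.prod_eq_zero_iff]
  simp [sub_eq_zero]

lemma IsCriticalVector.deriv_apply {d : ℕ} {lam x : Fin d → ℂ} (h : IsCriticalVector lam x)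
    (i : Fin d) : deriv (fun w => monomialDeformation d w lam) (x i) = 0 :=
  (h.deriv_eq_zero_iff _).2 ⟨i, rfl⟩

lemma prod_X_sub_C_coeff_fin {d : ℕ} (x : Fin d → ℂ) {k : ℕ} (h : k ≤ d) :
    (∏ i, (X - C (x i)) : ℂ[X]).coeff k =
      (-1) ^ (d - k) * MvPolynomial.eval x (MvPolynomial.esymm (Fin d) ℂ (d - k)) := by
  have := Multiset.prod_X_sub_C_coeff (Finset.univ.val.map x) (k := k) (by simpa using h)
  simp only [Multiset.map_map, Multiset.card_map, Finset.card_val, Finset.card_univ,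
    Fintype.card_fin] at this
  rw [← MvPolynomial.aeval_eq_eval, MvPolynomial.aeval_esymm_eq_multiset_esymm, ← this]
  rfl

/-- The elementary symmetric functions of the critical points are, up to constants, the
parameters of the monomial deformation. -/
lemma IsCriticalVector.esymm_eq {d : ℕ} {lam x : Fin d → ℂ} (h : IsCriticalVector lam x)
    (i : Fin d) : MvPolynomial.eval x (MvPolynomial.esymm (Fin d) ℂ (i + 1)) =
      (-1) ^ ((i : ℕ) + 1) * (((d - i : ℕ) : ℂ) * (defPoly lam).coeff (d - i)) / ((d : ℂ) + 1) := by
  have hi := i.2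
  have h1 := congrArg (fun q => q.coeff (d - (i + 1))) h
  simp only [coeff_C_mul, coeff_derivative] at h1
  rw [prod_X_sub_C_coeff_fin x (by omega), show d - (d - ((i : ℕ) + 1)) = i + 1 by omega,
    show d - ((i : ℕ) + 1) + 1 = d - i by omega,
    show ((d - ((i : ℕ) + 1) : ℕ) : ℂ) + 1 = ((d - i : ℕ) : ℂ) by
      rw [show d - (i : ℕ) = d - ((i : ℕ) + 1) + 1 by omega]; push_cast; ring] at h1
  have h2 : ((-1 : ℂ) ^ ((i : ℕ) + 1)) * (-1) ^ ((i : ℕ) + 1) = 1 := by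
    rw [← mul_pow]; norm_num
  rw [eq_div_iff (natCast_add_one_ne_zero' d), mul_comm (((d - i : ℕ) : ℂ)), h1]
  linear_combination (-(((d : ℂ) + 1) *
    MvPolynomial.eval x (MvPolynomial.esymm (Fin d) ℂ (i + 1)))) * h2

/-- The product `stokesForm` of the critical values is a polynomial function of the parameters, by
the fundamental theorem on symmetric polynomials. -/
theorem exists_stokesPoly (d : ℕ) : ∃ p : MvPolynomial (Fin d) ℂ, ∀ lam x : Fin d → ℂ,
    IsCriticalVector lam x →
      MvPolynomial.eval lam p = stokesForm (fun i => monomialDeformation d (x i) lam) := by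
  set R := MvPolynomial (Fin d) ℂ
  -- the critical values as polynomials in the critical points with coefficients in `ℂ[lam]`
  set v : Fin d → MvPolynomial (Fin d) R := fun i =>
    MvPolynomial.X i ^ (d + 1) + ∑ j : Fin d, MvPolynomial.C (MvPolynomial.X j : R) *
      MvPolynomial.X i ^ (j : ℕ) with hv
  have hsym : (stokesForm v).IsSymmetric := by
    intro e
    have h1 := map_stokesForm ((MvPolynomial.rename e : MvPolynomial (Fin d) R →ₐ[R]
      MvPolynomial (Fin d) R) : MvPolynomial (Fin d) R →+* MvPolynomial (Fin d) R) v
    rw [AlgHom.coe_toRingHom] at h1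
    rw [h1, ← stokesForm_equiv e v]
    congr 1
    funext i
    simp [hv, map_sum]
  obtain ⟨H, hH⟩ := MvPolynomial.esymmAlgHom_surjective (σ := Fin d) (n := d) R
    (by simp) ⟨stokesForm v, hsym⟩
  have hH' := congrArg Subtype.val hH
  rw [MvPolynomial.esymmAlgHom_apply] at hH'
  change _ = stokesForm v at hH'
  -- the values of the elementary symmetric functions in terms of the parameters; the first one is
  -- zero, since there is no term of degree `d`
  let E : Fin d → R := fun i => MvPolynomial.C ((-1) ^ ((i : ℕ) + 1) / ((d : ℂ) + 1) *
    ((d - i : ℕ) : ℂ)) * (if h : 0 < (i : ℕ) then MvPolynomial.X ⟨d - i, by omega⟩ else 0)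
  refine ⟨MvPolynomial.aeval E H, fun lam x hx => ?_⟩
  have h1 : (MvPolynomial.eval₂Hom (MvPolynomial.eval lam) x) (stokesForm v) =
      stokesForm (fun i => monomialDeformation d (x i) lam) := by
    rw [map_stokesForm]
    congr 1
    funext i
    simp [hv, monomialDeformation]
  rw [← h1, ← hH']
  have h2 : ∀ G : MvPolynomial (Fin d) R, MvPolynomial.eval lam (MvPolynomial.aeval E G) =
      MvPolynomial.eval₂Hom (MvPolynomial.eval lam) x (MvPolynomial.aeval
        (fun i : Fin d => MvPolynomial.esymm (Fin d) R (i + 1)) G) := by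
    intro G
    induction G using MvPolynomial.induction_on with
    | C a => simp
    | add f g hf hg => simp only [map_add, hf, hg]
    | mul_X f i hf =>
      simp only [map_mul, hf, MvPolynomial.aeval_X]
      congr 1
      have h3 : MvPolynomial.eval₂Hom (MvPolynomial.eval lam) x
          (MvPolynomial.esymm (Fin d) R (i + 1)) =
          MvPolynomial.eval x (MvPolynomial.esymm (Fin d) ℂ (i + 1)) := by
        simp [MvPolynomial.esymm, map_sum, map_prod]
      rw [h3, hx.esymm_eq i]
      simp only [E, map_mul, MvPolynomial.eval_C]
      split_ifs with h
      · rw [coeff_defPoly_of_lt lam (by omega : d - (i : ℕ) < d), MvPolynomial.eval_X]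
        ring
      · have : d - (i : ℕ) = d := by omega
        rw [this, coeff_defPoly_self]
        simp
  exact h2 H

end CriticalPoints

/-! ### Integral extensions and a dimension count -/

section Integrality

open MvPolynomial

variable {σ κ k : Type*} [Field k]

lemma homogeneousComponent_mul_of_isHomogeneous {f g : MvPolynomial σ k} {m : ℕ}
    (hg : g.IsHomogeneous m) (n : ℕ) : homogeneousComponent n (f * g) =
      if m ≤ n then homogeneousComponent (n - m) f * g else 0 := by
  conv_lhs => rw [← sum_homogeneousComponent f, Finset.sum_mul, map_sum]
  have h : ∀ i, homogeneousComponent n (homogeneousComponent i f * g) =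
      if i + m = n then homogeneousComponent i f * g else 0 := fun i => by
    rw [homogeneousComponent_of_mem ((homogeneousComponent_isHomogeneous i f).mul hg)]
    simp only [eq_comm]
  simp only [h]
  split_ifs with hmn
  · by_cases hd : n - m < f.totalDegree + 1
    · rw [Finset.sum_eq_single_of_mem (n - m) (Finset.mem_range.2 hd)]
      · rw [if_pos (by omega)]
      · intro b _ hb
        rw [if_neg (by omega)]
    · rw [homogeneousComponent_eq_zero _ _ (by omega), zero_mul]
      refine Finset.sum_eq_zero fun b hb => if_neg ?_
      have := Finset.mem_range.1 hb
      omega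
  · exact Finset.sum_eq_zero fun b _ => if_neg (by omega)

/-- If homogeneous polynomials of positive degree have no common zero but the origin, then the
whole polynomial ring is integral over the subalgebra they generate: by the Nullstellensatz and
the graded Nakayama lemma it is spanned over it by the monomials of bounded degree. -/
theorem isIntegral_adjoin_of_isHomogeneous [IsAlgClosed k] [Finite σ] [Finite κ]
    {g : κ → MvPolynomial σ k} {n : κ → ℕ} (hn : ∀ i, 0 < n i)
    (hg : ∀ i, (g i).IsHomogeneous (n i))
    (hV : ∀ x : σ → k, (∀ i, eval x (g i) = 0) → x = 0) (f : MvPolynomial σ k) :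
    IsIntegral (Algebra.adjoin k (Set.range g)) f := by
  classical
  have := Fintype.ofFinite σ
  have := Fintype.ofFinite κ
  set A := Algebra.adjoin k (Set.range g)
  set J : Ideal (MvPolynomial σ k) := Ideal.span (Set.range g)
  -- the Nullstellensatz
  have hX : ∀ i : σ, ∃ N : ℕ, (X i : MvPolynomial σ k) ^ N ∈ J := by
    intro i
    have h : (X i : MvPolynomial σ k) ∈ J.radical := by
      rw [← vanishingIdeal_zeroLocus_eq_radical (K := k), mem_vanishingIdeal_iff]
      intro x hx
      have hx0 : x = 0 := hV x fun j => by
        have := hx (g j) (Ideal.subset_span ⟨j, rfl⟩)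
        rwa [aeval_eq_eval] at this
      rw [hx0]
      simp
    exact h
  choose N hN using hX
  set B := ∑ i, N i + 1
  have hmon : ∀ m : σ →₀ ℕ, B ≤ m.degree → monomial m (1 : k) ∈ J := by
    intro m hm
    have : ∃ i, N i ≤ m i := by
      by_contra! hcon
      have h1 : m.degree ≤ ∑ i, N i := by
        rw [Finsupp.degree_eq_sum]
        exact Finset.sum_le_sum fun i _ => (hcon i).le
      omega
    obtain ⟨i, hi⟩ := this
    have h2 : monomial m (1 : k) = monomial (m - Finsupp.single i (N i)) 1 * X i ^ N i := by
      rw [X_pow_eq_monomial, monomial_mul, one_mul, tsub_add_cancel_of_le]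
      exact Finsupp.single_le_iff.2 hi
    rw [h2]
    exact J.mul_mem_left _ (hN i)
  set T : Set (MvPolynomial σ k) := (fun m => monomial m (1 : k)) '' {m : σ →₀ ℕ | m.degree ≤ B}
  have hT : T.Finite := (Finsupp.finite_of_degree_le B).image _
  set Mod : Submodule A (MvPolynomial σ k) := Submodule.span A T
  have hsc : ∀ (c : k) (q : MvPolynomial σ k), q ∈ Mod → C c * q ∈ Mod := by
    intro c q hq
    have := Mod.smul_mem (algebraMap k A c) hq
    rwa [Algebra.smul_def] at this
  have hhom : ∀ (l : ℕ) (q : MvPolynomial σ k), q.IsHomogeneous l → q ∈ Mod := by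
    intro l
    induction l using Nat.strong_induction_on with
    | _ l ih =>
      have hm : ∀ m : σ →₀ ℕ, m.degree = l → monomial m (1 : k) ∈ Mod := by
        intro m hml
        by_cases hlB : l ≤ B
        · exact Submodule.subset_span ⟨m, by simpa [hml] using hlB, rfl⟩
        · have hJ := hmon m (by omega)
          obtain ⟨a, ha⟩ := Ideal.mem_span_range_iff_exists_fun.1 hJ
          have h3 : monomial m (1 : k) =
              ∑ i, homogeneousComponent l (a i * g i) := by
            rw [← map_sum, ha, homogeneousComponent_of_mem (isHomogeneous_monomial (1 : k) hml),
              if_pos rfl]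
          rw [h3]
          refine Submodule.sum_mem _ fun i _ => ?_
          rw [homogeneousComponent_mul_of_isHomogeneous (hg i)]
          split_ifs with hil
          · have h4 := ih (l - n i) (by have := hn i; omega) _
              (homogeneousComponent_isHomogeneous (l - n i) (a i))
            have h5 := Mod.smul_mem (⟨g i, Algebra.subset_adjoin ⟨i, rfl⟩⟩ : A) h4
            rw [Algebra.smul_def] at h5
            rw [mul_comm]
            exact h5
          · exact Mod.zero_mem
      intro q hq
      rw [q.as_sum]
      refine Submodule.sum_mem _ fun m hmq => ?_
      have h6 : monomial m (coeff m q) = C (coeff m q) * monomial m 1 := by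
        rw [C_mul_monomial, mul_one]
      rw [h6]
      refine hsc _ _ (hm m ?_)
      rw [← hq (mem_support_iff.1 hmq), Finsupp.degree_eq_weight_one]
      rfl
  have htop : Mod = ⊤ := by
    rw [eq_top_iff]
    intro q _
    rw [← sum_homogeneousComponent q]
    exact Submodule.sum_mem _ fun i _ => hhom i _ (homogeneousComponent_isHomogeneous i q)
  have hfg : Mod.FG := Submodule.fg_span hT
  rw [htop] at hfg
  have : Module.Finite A (MvPolynomial σ k) := ⟨hfg⟩
  exact Algebra.IsIntegral.isIntegral (R := A) f

/-- A dimension count. If the polynomial ring in `n` variables is, modulo an ideal `I`, integral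
over a subalgebra with at most `n - 2` generators, then `I` contains a nonzero polynomial which
does not involve a given variable. -/
theorem exists_rename_mem_of_isIntegral [Fintype σ] (a : σ) {g : κ → MvPolynomial σ k}
    (hint : ∀ f : MvPolynomial σ k, IsIntegral (Algebra.adjoin k (Set.range g)) f)
    (I : Ideal (MvPolynomial σ k))
    (W : Finset (MvPolynomial σ k)) (hW : W.card + 1 < Fintype.card σ)
    (hgW : ∀ i, Ideal.Quotient.mkₐ k I (g i) ∈
      Algebra.adjoin k (Ideal.Quotient.mkₐ k I '' (W : Set (MvPolynomial σ k)))) :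
    ∃ h : MvPolynomial {i // i ≠ a} k, h ≠ 0 ∧ rename Subtype.val h ∈ I := by
  classical
  by_contra! hcon
  set φ : MvPolynomial {i // i ≠ a} k →ₐ[k] MvPolynomial σ k := rename Subtype.val
  have hbot : I.comap φ.toRingHom = ⊥ := by
    rw [eq_bot_iff]
    intro h hh
    by_contra h0
    exact hcon h h0 hh
  -- a prime over `I` which still contains no such polynomial makes the quotient a domain, in which
  -- transcendence degrees can be compared
  obtain ⟨Q, hQ, hIQ, hQφ⟩ := Ideal.exists_comap_eq_of_mem_minimalPrimes φ.toRingHom (I := I) ⊥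
    (by rw [hbot, Ideal.minimalPrimes_eq_subsingleton_self]; rfl)
  set ψ := Ideal.Quotient.mkₐ k Q with hψ
  have hψs : Function.Surjective ψ := Ideal.Quotient.mkₐ_surjective k Q
  set S := Algebra.adjoin k (ψ '' (W : Set (MvPolynomial σ k)))
  have hgS : ∀ i, ψ (g i) ∈ S := by
    intro i
    have h1 : ∀ f, Ideal.Quotient.factorₐ k hIQ (Ideal.Quotient.mkₐ k I f) = ψ f := fun f => rfl
    have h2 : Ideal.Quotient.factorₐ k hIQ (Ideal.Quotient.mkₐ k I (g i)) ∈
        (Algebra.adjoin k (Ideal.Quotient.mkₐ k I '' (W : Set (MvPolynomial σ k)))).map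
          (Ideal.Quotient.factorₐ k hIQ) := ⟨_, hgW i, rfl⟩
    rw [AlgHom.map_adjoin, Set.image_image] at h2
    exact h2
  have hAS : ∀ y : Algebra.adjoin k (Set.range g), ψ y ∈ S := by
    intro y
    have h3 : Algebra.adjoin k (Set.range g) ≤ S.comap ψ := by
      rw [Algebra.adjoin_le_iff]
      rintro _ ⟨i, rfl⟩
      exact hgS i
    exact h3 y.2
  have halg : Algebra.IsAlgebraic S (MvPolynomial σ k ⧸ Q) := by
    refine ⟨fun y => ?_⟩
    obtain ⟨f, rfl⟩ := hψs y
    have hfi : IsIntegral S (ψ f) := IsIntegral.map_of_comp_eq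
      ((ψ.comp (Algebra.adjoin k (Set.range g)).val).codRestrict S hAS).toRingHom
      ψ.toRingHom (by ext; rfl) (hint f)
    have : Nontrivial (MvPolynomial σ k ⧸ Q) := Ideal.Quotient.nontrivial_iff.2 hQ.ne_top
    exact hfi.isAlgebraic
  have hle : Algebra.trdeg k (MvPolynomial σ k ⧸ Q) ≤ W.card := by
    refine (Algebra.IsAlgebraic.trdeg_le_cardinalMk k
      (ψ '' (W : Set (MvPolynomial σ k)))).trans ?_
    refine Cardinal.mk_image_le.trans ?_
    simp
  have hind : AlgebraicIndependent k (fun i : {i // i ≠ a} => ψ (X (i : σ))) := by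
    rw [algebraicIndependent_iff_injective_aeval, injective_iff_map_eq_zero]
    intro h hh
    have h4 : aeval (fun i : {i // i ≠ a} => ψ (X (i : σ))) h = ψ (φ h) := by
      have : (aeval (fun i : {i // i ≠ a} => ψ (X (i : σ)))) = ψ.comp φ := by
        ext i
        simp [φ]
      rw [this]; rfl
    rw [h4] at hh
    have h5 : h ∈ Q.comap φ.toRingHom := by
      rw [Ideal.mem_comap]
      exact Ideal.Quotient.eq_zero_iff_mem.1 hh
    rwa [hQφ] at h5
  have hge := hind.lift_cardinalMk_le_trdeg
  have hcard : Fintype.card {i // i ≠ a} = Fintype.card σ - 1 := by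
    simp
  have h6 : Cardinal.lift (Cardinal.mk {i // i ≠ a}) ≤ Cardinal.lift (W.card : Cardinal) :=
    hge.trans (Cardinal.lift_le.2 hle)
  rw [Cardinal.mk_fintype, hcard, Cardinal.lift_natCast, Cardinal.lift_natCast,
    Nat.cast_le] at h6
  omega

end Integrality

/-! ### Polynomials in terms of their critical points -/

section CriticalValues

open Polynomial

/-- The polynomial without constant term whose derivative is `(d + 1) ∏ (X - x i)`. -/
noncomputable def primPoly {d : ℕ} (x : Fin d → ℂ) : ℂ[X] :=
  ∑ j ∈ Finset.range (d + 1),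
    C (((d : ℂ) + 1) / ((j : ℂ) + 1) * (∏ i, (X - C (x i)) : ℂ[X]).coeff j) * X ^ (j + 1)

lemma natDegree_prod_X_sub_C {d : ℕ} (x : Fin d → ℂ) :
    (∏ i, (X - C (x i)) : ℂ[X]).natDegree = d := by
  simp

lemma derivative_primPoly {d : ℕ} (x : Fin d → ℂ) :
    derivative (primPoly x) = C ((d : ℂ) + 1) * ∏ i, (X - C (x i)) := by
  conv_rhs => rw [(∏ i, (X - C (x i)) : ℂ[X]).as_sum_range_C_mul_X_pow' (n := d + 1)
    (by rw [natDegree_prod_X_sub_C]; omega)]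
  rw [primPoly, derivative_sum, Finset.mul_sum]
  refine Finset.sum_congr rfl fun j _ => ?_
  rw [derivative_C_mul_X_pow, Nat.add_sub_cancel, ← mul_assoc, ← C_mul]
  congr 2
  have : (j : ℂ) + 1 ≠ 0 := Nat.cast_add_one_ne_zero j
  push_cast
  field_simp

lemma IsCriticalVector.eval_eq {d : ℕ} {lam x : Fin d → ℂ} (h : IsCriticalVector lam x) (z : ℂ) :
    monomialDeformation d z lam = (primPoly x).eval z + (defPoly lam).coeff 0 := by
  have h1 : derivative (defPoly lam - primPoly x) = 0 := by
    rw [derivative_sub, h, derivative_primPoly, sub_self]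
  have h2 := derivative_eq_zero.1 h1
  have h3 := eq_C_of_natDegree_eq_zero h2
  have h4 : (primPoly x).coeff 0 = 0 := by simp [primPoly, coeff_zero_eq_eval_zero, eval_finsetSum]
  rw [coeff_sub, h4, sub_zero, sub_eq_iff_eq_add] at h3
  rw [← eval_defPoly, h3]
  simp [add_comm, h4]

/-- If all critical values of a complex polynomial of degree `d + 1` coincide, then so do all its
critical points: counted with multiplicities in a fibre, they have too many preimages. -/
lemma eq_of_eval_primPoly_eq {d : ℕ} {x : Fin d → ℂ} {c : ℂ}
    (h : ∀ i, (primPoly x).eval (x i) = c) (i j : Fin d) : x i = x j := by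
  set q := primPoly x - C c with hq
  have hder : derivative q = C ((d : ℂ) + 1) * ∏ i, (X - C (x i)) := by
    rw [hq, derivative_sub, derivative_C, sub_zero, derivative_primPoly]
  have hne : (C ((d : ℂ) + 1) * ∏ i, (X - C (x i)) : ℂ[X]) ≠ 0 :=
    mul_ne_zero (C_ne_zero.2 (natCast_add_one_ne_zero' d))
      (Finset.prod_ne_zero_iff.2 fun i _ => X_sub_C_ne_zero _)
  have hroots : (derivative q).roots = Finset.univ.val.map x := by
    have h0 := roots_multiset_prod_X_sub_C (Finset.univ.val.map x)
    rw [Multiset.map_map] at h0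
    rw [hder, roots_C_mul _ (natCast_add_one_ne_zero' d)]
    exact h0
  have hq0 : q ≠ 0 := by
    rintro h0
    rw [h0, derivative_zero] at hder
    exact hne hder.symm
  have hdeg : q.natDegree ≤ d + 1 := by
    rw [hq]
    refine (natDegree_sub_le _ _).trans (max_le ?_ (by simp))
    refine natDegree_sum_le_of_forall_le _ _ fun j hj => ?_
    refine (natDegree_C_mul_X_pow_le _ _).trans ?_
    have := Finset.mem_range.1 hj
    omega
  classical
  set s := Finset.univ.image x with hs
  have hcount : ∀ a ∈ s, q.roots.count a = (derivative q).roots.count a + 1 := by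
    intro a ha
    obtain ⟨i, -, rfl⟩ := Finset.mem_image.1 ha
    have hroot : q.IsRoot (x i) := by simp [hq, h i]
    rw [count_roots, count_roots, derivative_rootMultiplicity_of_root hroot]
    have := (rootMultiplicity_pos hq0).2 hroot
    omega
  have h1 : ∑ a ∈ s, q.roots.count a ≤ q.roots.card := by
    rw [← Multiset.sum_count_eq_card (s := s ∪ q.roots.toFinset) (m := q.roots)
      fun a ha => Finset.mem_union_right _ (Multiset.mem_toFinset.2 ha)]
    exact Finset.sum_le_sum_of_subset Finset.subset_union_left
  have h2 : ∑ a ∈ s, (derivative q).roots.count a = d := by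
    rw [Multiset.sum_count_eq_card, hroots]
    · simp
    · intro a ha
      rw [hroots] at ha
      simpa [hs] using ha
  rw [Finset.sum_congr rfl hcount, Finset.sum_add_distrib, h2] at h1
  have h3 := h1.trans ((card_roots' q).trans hdeg)
  have h4 : s.card ≤ 1 := by simpa using h3
  exact Finset.card_le_one.1 h4 _ (Finset.mem_image_of_mem x (Finset.mem_univ i)) _
    (Finset.mem_image_of_mem x (Finset.mem_univ j))

end CriticalValues

/-! ### Independence of relations between critical values -/

section Forms

open MvPolynomial

/-- The `i`-th critical value of `primPoly x`, as a polynomial in the critical points `x`. -/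
noncomputable def critVal {d : ℕ} (i : Fin d) : MvPolynomial (Fin d) ℂ :=
  ∑ j ∈ Finset.range (d + 1), C (((d : ℂ) + 1) / ((j : ℂ) + 1) * (-1) ^ (d - j)) *
    esymm (Fin d) ℂ (d - j) * X i ^ (j + 1)

lemma eval_critVal {d : ℕ} (x : Fin d → ℂ) (i : Fin d) :
    eval x (critVal i) = (primPoly x).eval (x i) := by
  simp only [critVal, primPoly, map_sum, Polynomial.eval_finsetSum]
  refine Finset.sum_congr rfl fun j hj => ?_
  rw [prod_X_sub_C_coeff_fin x (by have := Finset.mem_range.1 hj; omega)]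
  simp only [map_mul, eval_C, map_pow, eval_X, Polynomial.eval_mul, Polynomial.eval_C,
    Polynomial.eval_pow, Polynomial.eval_X]
  ring

lemma isHomogeneous_esymm {σ R : Type*} [Fintype σ] [CommSemiring R] (n : ℕ) :
    (esymm σ R n).IsHomogeneous n := by
  refine IsHomogeneous.sum _ _ _ fun t ht => ?_
  have h := IsHomogeneous.prod t (fun i => (X i : MvPolynomial σ R)) (fun _ => 1)
    fun i _ => isHomogeneous_X R i
  simpa [(Finset.mem_powersetCard.1 ht).2] using h

lemma isHomogeneous_critVal {d : ℕ} (i : Fin d) : (critVal i).IsHomogeneous (d + 1) := by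
  refine IsHomogeneous.sum _ _ _ fun j hj => ?_
  have hj' := Finset.mem_range.1 hj
  have h := ((isHomogeneous_C (Fin d) (((d : ℂ) + 1) / ((j : ℂ) + 1) * (-1) ^ (d - j))).mul
    (isHomogeneous_esymm (σ := Fin d) (R := ℂ) (d - j))).mul ((isHomogeneous_X ℂ i).pow (j + 1))
  convert h using 1
  omega

/-- The linear combination of the critical values with coefficients `w`. -/
noncomputable def valueForm {d : ℕ} (w : Fin d → ℂ) : MvPolynomial (Fin d) ℂ :=
  ∑ i, C (w i) * critVal i

lemma eval_valueForm {d : ℕ} (w x : Fin d → ℂ) :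
    eval x (valueForm w) = ∑ i, w i * (primPoly x).eval (x i) := by
  simp [valueForm, eval_critVal]

lemma isHomogeneous_valueForm {d : ℕ} (w : Fin d → ℂ) : (valueForm w).IsHomogeneous (d + 1) := by
  refine IsHomogeneous.sum _ _ _ fun i _ => ?_
  simpa using (isHomogeneous_C (Fin d) (w i)).mul (isHomogeneous_critVal i)

/-- Homogeneous generators of a subalgebra over which all polynomials in the critical points are
integral: the differences of critical values, and the sum of the critical points. -/
noncomputable def valueGen {d : ℕ} (e i : Fin d) : MvPolynomial (Fin d) ℂ :=
  if i = e then ∑ j, X j else critVal i - critVal e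

lemma isIntegral_adjoin_valueGen {d : ℕ} (e : Fin d) (f : MvPolynomial (Fin d) ℂ) :
    IsIntegral (Algebra.adjoin ℂ (Set.range (valueGen e))) f := by
  refine isIntegral_adjoin_of_isHomogeneous (n := fun i => if i = e then 1 else d + 1)
    (fun i => by split_ifs <;> omega) (fun i => ?_) (fun x hx => ?_) f
  · simp only [valueGen]
    split_ifs
    · exact IsHomogeneous.sum _ _ _ fun j _ => isHomogeneous_X ℂ j
    · exact (isHomogeneous_critVal i).sub (isHomogeneous_critVal e)
  · have h1 : ∀ i, (primPoly x).eval (x i) = (primPoly x).eval (x e) := by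
      intro i
      by_cases hi : i = e
      · rw [hi]
      · have := hx i
        rw [valueGen, if_neg hi, map_sub, eval_critVal, eval_critVal] at this
        exact sub_eq_zero.1 this
    have h2 := fun i => eq_of_eval_primPoly_eq h1 i e
    have h3 : ∑ j, x j = 0 := by
      have := hx e
      simpa [valueGen] using this
    funext i
    rw [Pi.zero_apply, h2 i]
    rw [Finset.sum_congr rfl fun j _ => h2 j, Finset.sum_const, Finset.card_univ,
      Fintype.card_fin, nsmul_eq_mul] at h3
    refine (mul_eq_zero.1 h3).resolve_left ?_
    have := e.pos
    exact_mod_cast this.ne'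

lemma valueForm_eq_sum_valueGen {d : ℕ} (e : Fin d) {w : Fin d → ℂ} (hw : ∑ i, w i = 0) :
    valueForm w = ∑ i ∈ Finset.univ.erase e, C (w i) * valueGen e i := by
  have h1 : valueForm w = ∑ i, C (w i) * (critVal i - critVal e) := by
    simp only [mul_sub, Finset.sum_sub_distrib]
    rw [← Finset.sum_mul, ← map_sum, hw]
    simp [valueForm]
  rw [h1, ← Finset.add_sum_erase _ _ (Finset.mem_univ e), sub_self, mul_zero, zero_add]
  refine Finset.sum_congr rfl fun i hi => ?_
  rw [valueGen, if_neg (Finset.ne_of_mem_erase hi)]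

/-- Two independent linear relations between differences of critical values are independent as
conditions on the critical points: they imply a nontrivial condition on all critical points but
one. -/
theorem exists_rename_mem_span_valueForm {d : ℕ} {w w' : Fin d → ℂ} (hw : ∑ i, w i = 0)
    (hw' : ∑ i, w' i = 0) {a : Fin d} (ha : w a ≠ 0) (hind : ∀ t : ℂ, w' ≠ t • w) :
    ∃ h : MvPolynomial {i // i ≠ a} ℂ, h ≠ 0 ∧
      rename Subtype.val h ∈ Ideal.span {valueForm w, valueForm w'} := by
  -- eliminate the index `a` from the second relation; `e` and `b` are two indices occurring in the
  -- result
  set v : Fin d → ℂ := w' - (w' a / w a) • w with hv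
  have hva : v a = 0 := by simp [hv, ha]
  have hvs : ∑ i, v i = 0 := by
    simp [hv, Finset.sum_sub_distrib, ← Finset.mul_sum, hw, hw']
  have hv0 : v ≠ 0 := fun h => hind _ (sub_eq_zero.1 h)
  obtain ⟨e, he⟩ := Function.ne_iff.1 hv0
  have hea : e ≠ a := by rintro rfl; exact he hva
  obtain ⟨b, hbe, hb⟩ : ∃ b, b ≠ e ∧ v b ≠ 0 := by
    by_contra! hcon
    rw [← Finset.add_sum_erase _ _ (Finset.mem_univ e), Finset.sum_eq_zero, add_zero] at hvs
    · exact he hvs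
    · intro i hi
      exact hcon i (Finset.ne_of_mem_erase hi)
  have hba : b ≠ a := by rintro rfl; exact hb hva
  set I : Ideal (MvPolynomial (Fin d) ℂ) := Ideal.span {valueForm w, valueForm w'} with hI
  set π := Ideal.Quotient.mkₐ ℂ I
  have hπ : ∀ f ∈ I, π f = 0 := fun f hf => Ideal.Quotient.eq_zero_iff_mem.2 hf
  have hwI : π (valueForm w) = 0 := hπ _ (Ideal.subset_span (by simp))
  have hvI : π (valueForm v) = 0 := by
    have : valueForm v = valueForm w' - C (w' a / w a) * valueForm w := by
      simp [valueForm, hv, Finset.mul_sum, sub_mul, Finset.sum_sub_distrib, mul_assoc]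
    rw [this, map_sub, map_mul, hwI, mul_zero, sub_zero]
    exact hπ _ (Ideal.subset_span (by simp))
  have hC : ∀ (c : ℂ) f, π (C c * f) = c • π f := by
    intro c f
    rw [← smul_eq_C_mul, map_smul]
  have hsum : ∀ u : Fin d → ℂ, ∑ i, u i = 0 → π (valueForm u) = 0 → ∀ j, j ≠ e →
      u j • π (valueGen e j) = - ∑ i ∈ (Finset.univ.erase e).erase j, u i • π (valueGen e i) := by
    intro u hu hu0 j hj
    rw [valueForm_eq_sum_valueGen e hu, map_sum,
      ← Finset.add_sum_erase _ _ (Finset.mem_erase.2 ⟨hj, Finset.mem_univ j⟩), hC] at hu0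
    rw [eq_neg_of_add_eq_zero_left hu0]
    simp only [hC]
  set W : Finset (MvPolynomial (Fin d) ℂ) :=
    ((Finset.univ.erase a).erase b).image (valueGen e) with hWdef
  set S := Algebra.adjoin ℂ (π '' (W : Set (MvPolynomial (Fin d) ℂ)))
  have hS : ∀ i, i ≠ a → i ≠ b → π (valueGen e i) ∈ S := by
    intro i hia hib
    refine Algebra.subset_adjoin ⟨_, ?_, rfl⟩
    simp only [hWdef, Finset.coe_image]
    exact ⟨i, by simp [hia, hib], rfl⟩
  have hdiv : ∀ (c : ℂ) y, c ≠ 0 → c • y ∈ S → y ∈ S := by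
    intro c y hc hy
    have := S.smul_mem hy c⁻¹
    rwa [smul_smul, inv_mul_cancel₀ hc, one_smul] at this
  -- modulo the relations, the generators with indices `b` and `a` are combinations of the others
  have hSb : π (valueGen e b) ∈ S := by
    refine hdiv _ _ hb ?_
    rw [hsum v hvs hvI b hbe]
    refine S.neg_mem (S.sum_mem fun i hi => ?_)
    simp only [Finset.mem_erase] at hi
    by_cases hia : i = a
    · rw [hia, hva, zero_smul]
      exact S.zero_mem
    · exact S.smul_mem (hS i hia hi.1) _
  have hSa : π (valueGen e a) ∈ S := by
    refine hdiv _ _ ha ?_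
    rw [hsum w hw hwI a hea.symm]
    refine S.neg_mem (S.sum_mem fun i hi => ?_)
    simp only [Finset.mem_erase] at hi
    by_cases hib : i = b
    · rw [hib]
      exact S.smul_mem hSb _
    · exact S.smul_mem (hS i hi.1 hib) _
  have hWcard : W.card + 1 < Fintype.card (Fin d) := by
    have h1 : W.card ≤ ((Finset.univ.erase a).erase b).card := Finset.card_image_le
    rw [Finset.card_erase_of_mem (Finset.mem_erase.2 ⟨hba, Finset.mem_univ b⟩),
      Finset.card_erase_of_mem (Finset.mem_univ a), Finset.card_univ] at h1
    have h2 : 2 ≤ Fintype.card (Fin d) := by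
      have := Finset.card_le_card (Finset.subset_univ ({a, b} : Finset (Fin d)))
      rwa [Finset.card_pair hba.symm, Finset.card_univ] at this
    omega
  refine exists_rename_mem_of_isIntegral a (isIntegral_adjoin_valueGen e) I W hWcard fun i => ?_
  by_cases hia : i = a
  · rw [hia]; exact hSa
  by_cases hib : i = b
  · rw [hib]; exact hSb
  exact hS i hia hib

end Forms

/-! ### Critical points with a single relation between their values -/

section Density

open MvPolynomial

/-- A holomorphic function that is smaller at the centre of a disc than on its boundary has a zero
in the disc: otherwise its inverse would violate the maximum principle. -/
lemma exists_zero_of_norm_lt {f : ℂ → ℂ} {c : ℂ} {R : ℝ} (hR : 0 < R)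
    (hf : DiffContOnCl ℂ f (Metric.ball c R)) (h : ∀ z ∈ Metric.sphere c R, ‖f c‖ < ‖f z‖) :
    ∃ z ∈ Metric.ball c R, f z = 0 := by
  by_contra! hcon
  have hcl : closure (Metric.ball c R) = Metric.closedBall c R := closure_ball c hR.ne'
  have hne : ∀ z ∈ closure (Metric.ball c R), f z ≠ 0 := by
    intro z hz
    rw [hcl, Metric.mem_closedBall] at hz
    rcases hz.lt_or_eq with hz | hz
    · exact hcon z hz
    · exact norm_pos_iff.1 ((norm_nonneg _).trans_lt (h z hz))
  obtain ⟨z, hz, hmax⟩ := Complex.exists_mem_frontier_isMaxOn_norm Metric.isBounded_ball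
    (Metric.nonempty_ball.2 hR) (hf.inv hne)
  rw [frontier_ball c hR.ne'] at hz
  have h1 := hmax (subset_closure (Metric.mem_ball_self hR))
  simp only [Set.mem_ofPred_eq, Function.comp_apply, Pi.inv_apply, norm_inv] at h1
  have hc : 0 < ‖f c‖ := norm_pos_iff.2 (hcon c (Metric.mem_ball_self hR))
  exact absurd (inv_strictAnti₀ hc (h z hz)) (not_lt.2 h1)

lemma frequently_eval_ne_zero {σ : Type*} [Fintype σ] {p : MvPolynomial σ ℂ} (hp : p ≠ 0)
    (x : σ → ℂ) : ∃ᶠ y in 𝓝 x, eval y p ≠ 0 := by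
  intro h
  simp only [ne_eq, not_not] at h
  obtain ⟨ε, hε, hball⟩ := Metric.eventually_nhds_iff_ball.1 h
  refine hp (funext_set (fun i => Metric.ball (x i) ε) (fun i => ?_) fun y hy => ?_)
  · exact infinite_of_mem_nhds (x i) (Metric.ball_mem_nhds _ hε)
  · rw [map_zero]
    refine hball y ?_
    rw [ball_pi x hε]
    exact hy

/-- On the zero set of a polynomial `L`, a nonzero polynomial which does not involve the variable
`a` is nonzero at points arbitrarily close to `x`, provided that `L` does not vanish on the
line through `x` in the direction `a`. -/
theorem exists_zero_near {σ : Type*} [Fintype σ] [DecidableEq σ] {L : MvPolynomial σ ℂ} {a : σ}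
    {x : σ → ℂ} (hL : eval x L = 0) (hne : ∃ t, eval (Function.update x a t) L ≠ 0)
    {h : MvPolynomial {i // i ≠ a} ℂ} (h0 : h ≠ 0) {U : Set (σ → ℂ)} (hU : U ∈ 𝓝 x) :
    ∃ y ∈ U, eval y L = 0 ∧ eval y (rename Subtype.val h) ≠ 0 := by
  set G : (σ → ℂ) → ℂ → ℂ := fun y t => eval (Function.update y a t) L with hG
  have hGdiff : ∀ y, Differentiable ℂ (G y) := by
    intro y t
    have h1 : AnalyticAt ℂ (fun z : σ → ℂ => eval z L) (Function.update y a t) :=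
      AnalyticOnNhd.eval_mvPolynomial L _ (Set.mem_univ _)
    exact h1.differentiableAt.comp (f := Function.update y a) t
      (hasDerivAt_update y a t).differentiableAt
  have hGcont : Continuous fun p : (σ → ℂ) × ℂ => G p.1 p.2 :=
    (MvPolynomial.continuous_eval L).comp (continuous_fst.update a continuous_snd)
  have hx0 : G x (x a) = 0 := by simp [hG, hL]
  have hpunct : ∀ᶠ t in 𝓝[≠] (x a), G x t ≠ 0 := by
    rcases ((hGdiff x).analyticAt (x a)).eventually_eq_zero_or_eventually_ne_zero with h1 | h1
    · obtain ⟨t, ht⟩ := hne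
      have h3 : AnalyticOnNhd ℂ (G x) Set.univ := fun t _ => (hGdiff x).analyticAt t
      have h2 := h3.eqOn_zero_of_preconnected_of_eventuallyEq_zero isPreconnected_univ
        (Set.mem_univ _) h1
      exact absurd (h2 (Set.mem_univ t)) ht
    · exact h1
  obtain ⟨ε, hε, hεU⟩ := Metric.mem_nhds_iff.1 hU
  obtain ⟨δ, hδ, hδG⟩ := Metric.mem_nhdsWithin_iff.1 hpunct
  set R := min ε δ / 2
  have hR : 0 < R := by positivity
  have hRε : R < ε := (half_lt_self (lt_min hε hδ)).trans_le (min_le_left _ _)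
  have hRδ : R < δ := (half_lt_self (lt_min hε hδ)).trans_le (min_le_right _ _)
  have hsph : ∀ t ∈ Metric.sphere (x a) R, G x t ≠ 0 := by
    intro t ht
    refine hδG ⟨?_, ?_⟩
    · exact (Metric.mem_sphere.1 ht).trans_lt hRδ
    · rintro rfl
      rw [Metric.mem_sphere, dist_self] at ht
      exact hR.ne ht
  have htube : ∀ᶠ y in 𝓝 x, ∀ t ∈ Metric.sphere (x a) R, ‖G y (x a)‖ < ‖G y t‖ := by
    refine (isCompact_sphere (x a) R).eventually_forall_of_forall_eventually fun t ht => ?_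
    have h1 : Continuous fun p : (σ → ℂ) × ℂ => ‖G p.1 (x a)‖ :=
      (hGcont.comp (continuous_fst.prodMk continuous_const)).norm
    refine h1.continuousAt.eventually_lt hGcont.norm.continuousAt ?_
    simpa [hx0] using hsph t ht
  have hh : rename Subtype.val h ≠ 0 :=
    (map_ne_zero_iff _ (rename_injective _ Subtype.val_injective)).2 h0
  obtain ⟨y, hy, hyt, hyε⟩ := ((frequently_eval_ne_zero hh x).and_eventually
    (htube.and (Metric.ball_mem_nhds x hε))).exists
  obtain ⟨t, ht, hGt⟩ := exists_zero_of_norm_lt hR (hGdiff y).diffContOnCl hyt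
  refine ⟨Function.update y a t, hεU ?_, hGt, ?_⟩
  · rw [Metric.mem_ball, dist_pi_lt_iff hε]
    intro i
    by_cases hi : i = a
    · subst hi
      rw [Function.update_self]
      exact (Metric.mem_ball.1 ht).trans hRε
    · rw [Function.update_of_ne hi]
      exact (dist_le_pi_dist y x i).trans_lt hyε
  · rw [eval_rename] at hy ⊢
    have h1 : Function.update y a t ∘ Subtype.val = (y ∘ Subtype.val : {i // i ≠ a} → ℂ) := by
      ext i
      simp [Function.update_of_ne i.2]
    rwa [h1]

lemma eval_smul_of_isHomogeneous {σ : Type*} {p : MvPolynomial σ ℂ} {n : ℕ}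
    (hp : p.IsHomogeneous n) (s : ℂ) (x : σ → ℂ) : eval (s • x) p = s ^ n * eval x p := by
  rw [eval_eq, eval_eq, Finset.mul_sum]
  refine Finset.sum_congr rfl fun m hm => ?_
  have h1 : ∑ i ∈ m.support, m i = n := by
    rw [← hp (mem_support_iff.1 hm), Finsupp.weight_apply]
    simp [Finsupp.sum]
  simp only [Pi.smul_apply, smul_eq_mul, mul_pow, Finset.prod_mul_distrib,
    Finset.prod_pow_eq_pow_sum, h1]
  ring

lemma exists_eval_update_valueForm_ne_zero {d : ℕ} {w : Fin d → ℂ} {a b : Fin d} (hab : a ≠ b)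
    (ha : w a ≠ 0) (x : Fin d → ℂ) : ∃ t, eval (Function.update x a t) (valueForm w) ≠ 0 := by
  by_contra! hcon
  have h1 : ∀ s : ℂ, s ≠ 0 → eval (Function.update (s • x) a 1) (valueForm w) = 0 := by
    intro s hs
    have h2 : Function.update (s • x) a 1 = s • Function.update x a s⁻¹ := by
      funext i
      by_cases hi : i = a
      · subst hi; simp [hs]
      · simp [hi]
    rw [h2, eval_smul_of_isHomogeneous (isHomogeneous_valueForm w), hcon, mul_zero]
  have h3 : eval (Pi.single a 1) (valueForm w) = 0 := by
    have hc : Continuous fun s : ℂ => eval (Function.update (s • x) a 1) (valueForm w) :=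
      (MvPolynomial.continuous_eval _).comp
        ((continuous_id.smul continuous_const).update a continuous_const)
    have h4 : Tendsto (fun s : ℂ => eval (Function.update (s • x) a 1) (valueForm w)) (𝓝[≠] 0)
        (𝓝 (eval (Function.update ((0 : ℂ) • x) a 1) (valueForm w))) :=
      hc.continuousAt.tendsto.mono_left nhdsWithin_le_nhds
    have h5 := tendsto_nhds_unique h4 (tendsto_const_nhds.congr'
      (eventually_nhdsWithin_of_forall fun s hs => (h1 s hs).symm))
    rw [zero_smul] at h5
    exact h5
  have h0 : (primPoly (Pi.single a (1 : ℂ))).eval 0 = 0 := by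
    simp [primPoly, Polynomial.eval_finsetSum]
  rw [eval_valueForm, Finset.sum_eq_single a] at h3
  · have h6 := (mul_eq_zero.1 h3).resolve_left ha
    have h7 : ∀ i, (primPoly (Pi.single a (1 : ℂ))).eval ((Pi.single a (1 : ℂ) : Fin d → ℂ) i) =
        0 := by
      intro i
      by_cases hi : i = a
      · subst hi; exact h6
      · rw [Pi.single_eq_of_ne hi, h0]
    have h8 := eq_of_eval_primPoly_eq h7 a b
    rw [Pi.single_eq_same, Pi.single_eq_of_ne hab.symm] at h8
    exact one_ne_zero h8
  · intro i _ hi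
    rw [Pi.single_eq_of_ne hi, h0, mul_zero]
  · simp

/-- Near a system of critical points whose values satisfy one linear relation there is another one
whose values satisfy this relation and no other relation from a given finite list. -/
theorem exists_generic_near {d : ℕ} {w : Fin d → ℂ} (hw : ∑ i, w i = 0) {a b : Fin d}
    (hab : a ≠ b) (ha : w a ≠ 0) {x : Fin d → ℂ}
    (hx : ∑ i, w i * (primPoly x).eval (x i) = 0) (F : Finset (Fin d → ℂ))
    (hF : ∀ v ∈ F, ∑ i, v i = 0 ∧ ∀ t : ℂ, v ≠ t • w) {U : Set (Fin d → ℂ)} (hU : U ∈ 𝓝 x) :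
    ∃ y ∈ U, ∑ i, w i * (primPoly y).eval (y i) = 0 ∧
      ∀ v ∈ F, ∑ i, v i * (primPoly y).eval (y i) ≠ 0 := by
  have key : ∀ v : F, ∃ h : MvPolynomial {i // i ≠ a} ℂ, h ≠ 0 ∧
      rename Subtype.val h ∈ Ideal.span {valueForm w, valueForm v.1} := fun v =>
    exists_rename_mem_span_valueForm hw (hF v v.2).1 ha (hF v v.2).2
  choose h h0 hmem using key
  rw [← eval_valueForm] at hx
  obtain ⟨y, hyU, hy, hyh⟩ := exists_zero_near hx (exists_eval_update_valueForm_ne_zero hab ha x)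
    (Finset.prod_ne_zero_iff.2 fun v (_ : v ∈ Finset.univ) => h0 v) hU
  rw [map_prod, map_prod, Finset.prod_ne_zero_iff] at hyh
  refine ⟨y, hyU, by rw [← eval_valueForm, hy], fun v hv hv0 => ?_⟩
  rw [← eval_valueForm] at hv0
  obtain ⟨p, q, hpq⟩ := Ideal.mem_span_pair.1 (hmem ⟨v, hv⟩)
  refine hyh ⟨v, hv⟩ (Finset.mem_univ _) ?_
  rw [← hpq]
  simp [hy, hv0]

end Density

/-! ### Critical values as local coordinates -/

section LocalCoordinates

open Polynomial

lemma hasStrictFDerivAt_monomialDeformation {d : ℕ} (z : ℂ) (lam : Fin d → ℂ) :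
    HasStrictFDerivAt (fun p : (Fin d → ℂ) × ℂ => monomialDeformation d p.2 p.1)
      ((∑ j : Fin d, (z ^ (j : ℕ)) • ContinuousLinearMap.proj (R := ℂ) (φ := fun _ => ℂ) j).comp
          (ContinuousLinearMap.fst ℂ (Fin d → ℂ) ℂ) +
        (derivative (defPoly lam)).eval z • ContinuousLinearMap.snd ℂ (Fin d → ℂ) ℂ)
      (lam, z) := by
  have hz : HasStrictFDerivAt (fun p : (Fin d → ℂ) × ℂ => p.2)
    (ContinuousLinearMap.snd ℂ (Fin d → ℂ) ℂ) (lam, z) := hasStrictFDerivAt_snd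
  have hl : ∀ j : Fin d, HasStrictFDerivAt (fun p : (Fin d → ℂ) × ℂ => p.1 j)
      ((ContinuousLinearMap.proj (R := ℂ) (φ := fun _ => ℂ) j).comp
        (ContinuousLinearMap.fst ℂ (Fin d → ℂ) ℂ)) (lam, z) := fun j =>
    ((ContinuousLinearMap.proj (R := ℂ) (φ := fun _ => ℂ) j).comp
        (ContinuousLinearMap.fst ℂ (Fin d → ℂ) ℂ)).hasStrictFDerivAt
  have h := (hz.pow (d + 1)).add
    (HasStrictFDerivAt.fun_sum (u := Finset.univ) fun j _ => (hl j).mul (hz.pow (j : ℕ)))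
  refine h.congr_fderiv ?_
  ext p
  · simp
  · simp [defPoly, eval_finsetSum, derivative_X_pow]

lemma IsCriticalVector.of_injective {d : ℕ} {lam y : Fin d → ℂ} (hy : Function.Injective y)
    (h : ∀ i, (derivative (defPoly lam)).eval (y i) = 0) : IsCriticalVector lam y := by
  obtain ⟨x, hx⟩ := exists_isCriticalVector lam
  have h1 : ∀ i, ∃ j, y i = x j := fun i => by
    rw [← hx.deriv_eq_zero_iff, deriv_monomialDeformation]
    exact h i
  choose σ hσ using h1
  have hσi : Function.Injective σ := fun i j hij => hy (by rw [hσ, hσ, hij])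
  have hσb := Finite.injective_iff_bijective.1 hσi
  rw [IsCriticalVector, hx, ← (Equiv.ofBijective σ hσb).prod_comp]
  simp only [Equiv.ofBijective_apply, hσ]

/-- Near a parameter with simple critical points, the critical values are differentiable functions
of the parameter; the differential of the critical value at `x i` is evaluation at `x i`. -/
theorem exists_local_critical_values {d : ℕ} {lam₀ x : Fin d → ℂ} (hx : IsCriticalVector lam₀ x)
    (hinj : Function.Injective x) :
    ∃ A : Fin d → (Fin d → ℂ) → ℂ, (∀ i, A i lam₀ = monomialDeformation d (x i) lam₀) ∧
      (∀ i, HasFDerivAt (A i)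
        (∑ j : Fin d, (x i ^ (j : ℕ)) • ContinuousLinearMap.proj (R := ℂ) (φ := fun _ => ℂ) j)
        lam₀) ∧
      ∀ᶠ lam in 𝓝 lam₀, ∀ p : MvPolynomial (Fin d) ℂ, (∀ lam x : Fin d → ℂ,
        IsCriticalVector lam x →
        MvPolynomial.eval lam p = stokesForm (fun i => monomialDeformation d (x i) lam)) →
        MvPolynomial.eval lam p = stokesForm (fun i => A i lam) := by
  set Ψ : (Fin d → ℂ) × ℂ → ℂ := fun p => (derivative (defPoly p.1)).eval p.2 with hΨ
  have hΨe : Ψ = fun p => ((d : ℂ) + 1) * p.2 ^ d +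
      ∑ j : Fin d, p.1 j * ((j : ℂ) * p.2 ^ ((j : ℕ) - 1)) := by
    funext p
    simp [hΨ, defPoly, eval_finsetSum, derivative_X_pow]
  have hsmooth : ContDiff ℂ 1 Ψ := by
    rw [hΨe]
    fun_prop
  have hxe : ∀ i, Ψ (lam₀, x i) = 0 := fun i => by
    have := hx.deriv_apply i
    rwa [deriv_monomialDeformation] at this
  have hcd : ∀ i, ContDiffAt ℂ 1 Ψ (lam₀, x i) := fun i => hsmooth.contDiffAt
  have hinv : ∀ i, (fderiv ℂ Ψ (lam₀, x i) ∘L .inr ℂ (Fin d → ℂ) ℂ).IsInvertible := by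
    intro i
    have h1 : HasFDerivAt (fun z => Ψ (lam₀, z))
        (fderiv ℂ Ψ (lam₀, x i) ∘L .inr ℂ (Fin d → ℂ) ℂ) (x i) :=
      (((hcd i).differentiableAt one_ne_zero).hasFDerivAt).comp (x i)
        (hasFDerivAt_prodMk_right lam₀ (x i))
    have h2 : HasDerivAt (fun z => Ψ (lam₀, z))
        (((d : ℂ) + 1) * ∏ k ∈ Finset.univ.erase i, (x i - x k)) (x i) := by
      have h3 : (fun z => Ψ (lam₀, z)) =
          fun z => (C ((d : ℂ) + 1) * ∏ k, (X - C (x k)) : ℂ[X]).eval z := by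
        funext z
        rw [← hx]
      rw [h3]
      have h4 := Polynomial.hasDerivAt (C ((d : ℂ) + 1) * ∏ k, (X - C (x k)) : ℂ[X]) (x i)
      refine h4.congr_deriv ?_
      rw [← Finset.mul_prod_erase _ _ (Finset.mem_univ i)]
      simp [derivative_mul, eval_prod]
    have h5 := h1.unique h2.hasFDerivAt
    have hne : ((d : ℂ) + 1) * ∏ k ∈ Finset.univ.erase i, (x i - x k) ≠ 0 := by
      refine mul_ne_zero (natCast_add_one_ne_zero' d) (Finset.prod_ne_zero_iff.2 fun k hk => ?_)
      exact sub_ne_zero.2 fun h => Finset.ne_of_mem_erase hk (hinj h).symm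
    rw [h5]
    refine ⟨ContinuousLinearEquiv.unitsEquivAut ℂ (Units.mk0 _ hne), ?_⟩
    ext
    simp
  -- the critical points, by the implicit function theorem
  set ξ : Fin d → (Fin d → ℂ) → ℂ := fun i => (hcd i).implicitFunction one_ne_zero (hinv i)
  have hξ0 : ∀ i, ξ i lam₀ = x i := fun i =>
    (hcd i).implicitFunction_apply_self one_ne_zero (hinv i)
  have hξd : ∀ i, DifferentiableAt ℂ (ξ i) lam₀ := fun i =>
    ((hcd i).hasStrictFDerivAt_implicitFunction one_ne_zero (hinv i)).hasFDerivAt.differentiableAt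
  have hξz : ∀ᶠ lam in 𝓝 lam₀, ∀ i, Ψ (lam, ξ i lam) = 0 := by
    rw [eventually_all]
    intro i
    filter_upwards [(hcd i).eventually_apply_implicitFunction one_ne_zero (hinv i)] with lam hlam
    rw [hlam, hxe]
  have hξi : ∀ᶠ lam in 𝓝 lam₀, Function.Injective fun i => ξ i lam := by
    have : ∀ᶠ lam in 𝓝 lam₀, ∀ i j, i ≠ j → ξ i lam ≠ ξ j lam := by
      rw [eventually_all]
      intro i
      rw [eventually_all]
      intro j
      by_cases hij : i = j
      · simp [hij]
      · have hne : ξ i lam₀ ≠ ξ j lam₀ := by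
          rw [hξ0, hξ0]
          exact hinj.ne hij
        exact (((hξd i).continuousAt.sub (hξd j).continuousAt).eventually_ne
          (sub_ne_zero.2 hne)).mono fun _ h _ => sub_ne_zero.1 h
    filter_upwards [this] with lam hlam i j hij
    by_contra hne
    exact hlam i j hne hij
  refine ⟨fun i lam => monomialDeformation d (ξ i lam) lam, fun i => by simp only [hξ0],
    fun i => ?_, ?_⟩
  · have h1 := (hasStrictFDerivAt_monomialDeformation (ξ i lam₀) lam₀).hasFDerivAt.comp lam₀
      ((hasFDerivAt_id lam₀).prodMk (hξd i).hasFDerivAt)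
    refine h1.congr_fderiv ?_
    have h2 : (derivative (defPoly lam₀)).eval (ξ i lam₀) = 0 := by
      rw [hξ0]; exact hxe i
    ext v
    rw [h2, hξ0]
    simp
  · filter_upwards [hξz, hξi] with lam h1 h2 p hp
    exact hp lam _ (IsCriticalVector.of_injective h2 h1)

end LocalCoordinates

/-! ### Parameters in terms of critical points -/

section FromCriticalPoints

open Polynomial

lemma coeff_primPoly_zero {d : ℕ} (x : Fin d → ℂ) : (primPoly x).coeff 0 = 0 := by
  simp [primPoly, coeff_zero_eq_eval_zero, eval_finsetSum]

lemma coeff_primPoly_succ {d : ℕ} (x : Fin d → ℂ) (k : ℕ) :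
    (primPoly x).coeff (k + 1) =
      ((d : ℂ) + 1) / ((k : ℂ) + 1) * (∏ i, (X - C (x i)) : ℂ[X]).coeff k := by
  have h1 := congrArg (fun q => q.coeff k) (derivative_primPoly x)
  simp only [coeff_derivative, coeff_C_mul] at h1
  have : (k : ℂ) + 1 ≠ 0 := Nat.cast_add_one_ne_zero k
  rw [eq_comm, div_mul_eq_mul_div, div_eq_iff this, h1]

/-- The parameter whose critical points are `x` (with `∑ i, x i = 0`) and whose constant term
is `c`. -/
noncomputable def paramOf {d : ℕ} (c : ℂ) (x : Fin d → ℂ) : Fin d → ℂ :=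
  fun j => if (j : ℕ) = 0 then c else (primPoly x).coeff j

lemma continuous_paramOf {d : ℕ} (c : ℂ) : Continuous (paramOf c : (Fin d → ℂ) → Fin d → ℂ) := by
  refine continuous_pi fun j => ?_
  unfold paramOf
  split_ifs with h
  · exact continuous_const
  · obtain ⟨k, hk⟩ := Nat.exists_eq_succ_of_ne_zero h
    have h1 : (fun x : Fin d → ℂ => (primPoly x).coeff j) = fun x =>
        ((d : ℂ) + 1) / ((k : ℂ) + 1) * ((-1) ^ (d - k) *
          MvPolynomial.eval x (MvPolynomial.esymm (Fin d) ℂ (d - k))) := by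
      funext x
      rw [hk, Nat.succ_eq_add_one, coeff_primPoly_succ,
        prod_X_sub_C_coeff_fin x (by have := j.2; omega)]
    rw [h1]
    exact continuous_const.mul (continuous_const.mul (MvPolynomial.continuous_eval _))

lemma IsCriticalVector.sum_eq_zero {d : ℕ} {lam x : Fin d → ℂ} (h : IsCriticalVector lam x) :
    ∑ i, x i = 0 := by
  rcases Nat.eq_zero_or_pos d with rfl | hd
  · simp
  have h1 := congrArg (fun q => q.coeff (d - 1)) h
  simp only [coeff_derivative, coeff_C_mul] at h1
  rw [Nat.sub_add_cancel hd, coeff_defPoly_self, zero_mul, eq_comm] at h1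
  have h2 := (mul_eq_zero.1 h1).resolve_left (natCast_add_one_ne_zero' d)
  have h3 := prod_X_sub_C_coeff_card_pred (Finset.univ : Finset (Fin d)) x (by simpa using hd)
  rw [Finset.card_univ, Fintype.card_fin, h2] at h3
  exact (neg_eq_zero.1 h3.symm)

lemma defPoly_paramOf {d : ℕ} (hd : 0 < d) (c : ℂ) {x : Fin d → ℂ} (hx : ∑ i, x i = 0) :
    defPoly (paramOf c x) = primPoly x + C c := by
  ext k
  rcases lt_trichotomy k d with hk | rfl | hk
  · rw [coeff_defPoly_of_lt _ hk, coeff_add, coeff_C]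
    simp only [paramOf]
    split_ifs with h
    · rw [h, coeff_primPoly_zero, zero_add]
    · rw [add_zero]
  · rw [coeff_defPoly_self, coeff_add, coeff_C_of_ne_zero hd.ne', add_zero]
    obtain ⟨l, rfl⟩ : ∃ l, k = l + 1 := ⟨k - 1, by omega⟩
    have h3 := prod_X_sub_C_coeff_card_pred (Finset.univ : Finset (Fin (l + 1))) x (by simp)
    rw [Finset.card_univ, Fintype.card_fin, hx, neg_zero] at h3
    rw [coeff_primPoly_succ]
    simp only [Nat.add_sub_cancel] at h3
    rw [h3, mul_zero]
  · obtain ⟨l, rfl⟩ : ∃ l, k = l + 1 := ⟨k - 1, by omega⟩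
    rw [coeff_add, coeff_C_of_ne_zero (by omega), add_zero, coeff_primPoly_succ]
    rcases (Nat.lt_succ_iff.1 hk).lt_or_eq with hl | rfl
    · rw [coeff_eq_zero_of_natDegree_lt (by rw [natDegree_defPoly]; omega),
        coeff_eq_zero_of_natDegree_lt (by rw [natDegree_prod_X_sub_C]; omega), mul_zero]
    · rw [coeff_defPoly_succ]
      have h4 : (∏ i, (X - C (x i)) : ℂ[X]).coeff d = 1 := by
        have := (monic_prod_of_monic Finset.univ (fun i => X - C (x i))
          fun i _ => monic_X_sub_C (x i)).coeff_natDegree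
        rwa [natDegree_prod_X_sub_C] at this
      rw [h4, mul_one, div_self (natCast_add_one_ne_zero' d)]

lemma isCriticalVector_paramOf {d : ℕ} (hd : 0 < d) (c : ℂ) {x : Fin d → ℂ} (hx : ∑ i, x i = 0) :
    IsCriticalVector (paramOf c x) x := by
  rw [IsCriticalVector, defPoly_paramOf hd c hx, derivative_add, derivative_C, add_zero,
    derivative_primPoly]

lemma IsCriticalVector.paramOf_eq {d : ℕ} {lam x : Fin d → ℂ} (h : IsCriticalVector lam x) :
    paramOf ((defPoly lam).coeff 0) x = lam := by
  funext j
  simp only [paramOf]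
  split_ifs with h0
  · rw [h0.symm, coeff_defPoly_of_lt lam j.2]
  · obtain ⟨k, hk⟩ := Nat.exists_eq_succ_of_ne_zero h0
    have h1 := congrArg (fun q => q.coeff k) (h.trans (derivative_primPoly x).symm)
    simp only [coeff_derivative] at h1
    have h2 := mul_right_cancel₀ (Nat.cast_add_one_ne_zero (R := ℂ) k) h1
    rw [hk, Nat.succ_eq_add_one, ← h2]
    have h3 : k + 1 < d := by have := j.2; omega
    rw [coeff_defPoly_of_lt lam h3]
    congr 1
    exact Fin.ext hk.symm

lemma eval_primPoly_sub_const {d : ℕ} (x : Fin d → ℂ) (s : ℂ) :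
    ∃ c : ℂ, ∀ i, (primPoly fun k => x k - s).eval (x i - s) = (primPoly x).eval (x i) + c := by
  have h1 : derivative ((primPoly fun k => x k - s).comp (X - C s) - primPoly x) = 0 := by
    rw [derivative_sub, derivative_comp, derivative_primPoly, derivative_primPoly]
    simp [prod_comp]
  have h2 := eq_C_of_natDegree_eq_zero (derivative_eq_zero.1 h1)
  set c := ((primPoly fun k => x k - s).comp (X - C s) - primPoly x).coeff 0
  refine ⟨c, fun i => ?_⟩
  have h3 := congrArg (eval (x i)) h2
  simp only [eval_sub, eval_comp, eval_X, eval_C] at h3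
  linear_combination h3

end FromCriticalPoints

/-! ### Zeros of the symmetric product are limits of Stokes parameters -/

section Generic

/-- The coefficients of the linear form `v a + v b - v c - v e`. -/
noncomputable def relVec {d : ℕ} (a b c e : Fin d) : Fin d → ℂ :=
  Pi.single a 1 + Pi.single b 1 - Pi.single c 1 - Pi.single e 1

lemma sum_relVec_mul {d : ℕ} (a b c e : Fin d) (v : Fin d → ℂ) :
    ∑ i, relVec a b c e i * v i = v a + v b - v c - v e := by
  simp [relVec, sub_mul, add_mul, Finset.sum_sub_distrib, Finset.sum_add_distrib, Pi.single_apply]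

lemma sum_relVec {d : ℕ} (a b c e : Fin d) : ∑ i, relVec a b c e i = 0 := by
  have := sum_relVec_mul a b c e (fun _ => 1)
  simpa using this

lemma relVec_apply_ne_zero {d : ℕ} {a b c e : Fin d} (hab : a ≠ b) (hac : a ≠ c) (hae : a ≠ e)
    (hbc : b ≠ c) (hbe : b ≠ e) (hce : c ≠ e) {k : Fin d} :
    relVec a b c e k ≠ 0 ↔ k ∈ ({a, b, c, e} : Finset (Fin d)) := by
  simp only [relVec, Pi.sub_apply, Pi.add_apply, Pi.single_apply, Finset.mem_insert,
    Finset.mem_singleton]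
  by_cases h1 : k = a
  · subst h1; simp [hab, hac, hae]
  by_cases h2 : k = b
  · subst h2; simp [h1, hbc, hbe]
  by_cases h3 : k = c
  · subst h3; simp [h1, h2, hce]
  by_cases h4 : k = e
  · subst h4; simp [h1, h2, h3]
  · simp [h1, h2, h3, h4]

/-- A vector whose support is different from that of `w`, and does not contain it, is not
proportional to `w`. -/
lemma ne_smul_of_apply {d : ℕ} {v w : Fin d → ℂ} (hv : v ≠ 0) {k : Fin d} (hk : w k ≠ 0)
    (hvk : v k = 0) (t : ℂ) : v ≠ t • w := by
  rintro rfl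
  rw [Pi.smul_apply, smul_eq_mul] at hvk
  rw [(mul_eq_zero.1 hvk).resolve_right hk, zero_smul] at hv
  exact hv rfl

/-- The parameters for which there are four different critical values with
`α + α' = β + β'`. -/
def stokesLocus (d : ℕ) : Set (Fin d → ℂ) :=
  {lam | ∃ z : Fin 4 → ℂ, (∀ i, deriv (fun w => monomialDeformation d w lam) (z i) = 0) ∧
    Function.Injective (fun i => monomialDeformation d (z i) lam) ∧
    monomialDeformation d (z 0) lam + monomialDeformation d (z 1) lam =
      monomialDeformation d (z 2) lam + monomialDeformation d (z 3) lam}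

/-- `p` expresses the product `stokesForm` of the critical values through the parameters. -/
def IsStokesPoly {d : ℕ} (p : MvPolynomial (Fin d) ℂ) : Prop :=
  ∀ lam x : Fin d → ℂ, IsCriticalVector lam x →
    MvPolynomial.eval lam p = stokesForm (fun i => monomialDeformation d (x i) lam)

lemma IsStokesPoly.eval_eq_zero {d : ℕ} {p : MvPolynomial (Fin d) ℂ} (hp : IsStokesPoly p)
    {lam : Fin d → ℂ} (h : lam ∈ stokesLocus d) : MvPolynomial.eval lam p = 0 := by
  obtain ⟨z, hz, hinj, hrel⟩ := h
  obtain ⟨x, hx⟩ := exists_isCriticalVector lam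
  choose σ hσ using fun i => (hx.deriv_eq_zero_iff (z i)).1 (hz i)
  have hσi : Function.Injective σ := fun i j hij => hinj (by simp only [hσ, hij])
  rw [hp lam x hx]
  refine stokesForm_eq_zero_of_relation (a := σ 0) (b := σ 1) (c := σ 2) (e := σ 3)
    (hσi.ne (by decide)) (hσi.ne (by decide)) (hσi.ne (by decide)) (hσi.ne (by decide))
    (hσi.ne (by decide)) (hσi.ne (by decide)) ?_
  simpa only [hσ] using hrel

lemma stokesForm_eq_mul_erase {ι R : Type*} [Fintype ι] [CommRing R] [DecidableEq (Finset ι)]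
    (α : ι → R) {S : Finset ι} (hS : S.card = 4) : stokesForm α = quartetForm S α *
      ∏ T ∈ ((Finset.univ : Finset ι).powersetCard 4).erase S, quartetForm T α := by
  exact (Finset.mul_prod_erase _ (fun T => quartetForm T α)
    (Finset.mem_powersetCard.2 ⟨Finset.subset_univ _, hS⟩)).symm

lemma card_quartet {ι : Type*} [DecidableEq ι] {a b c e : ι} (hab : a ≠ b) (hac : a ≠ c)
    (hae : a ≠ e) (hbc : b ≠ c) (hbe : b ≠ e) (hce : c ≠ e) :
    ({a, b, c, e} : Finset ι).card = 4 := by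
  rw [Finset.card_insert_of_notMem (by simp [hab, hac, hae]), Finset.card_eq_three.2
    ⟨b, c, e, hbc, hbe, hce, rfl⟩]

lemma differentiableAt_quartetForm {E ι : Type*} [NormedAddCommGroup E] [NormedSpace ℂ E]
    {S : Finset ι} {A : ι → E → ℂ} {x : E} (hA : ∀ i, DifferentiableAt ℂ (A i) x) :
    DifferentiableAt ℂ (fun y => quartetForm S (fun i => A i y)) x := by
  unfold quartetForm
  fun_prop

lemma exists_pow_sum_eq_single {d : ℕ} {x : Fin d → ℂ} (hx : Function.Injective x) (a : Fin d) :
    ∃ ν : Fin d → ℂ, ∀ i, ∑ j : Fin d, x i ^ (j : ℕ) * ν j = (Pi.single a 1 : Fin d → ℂ) i := by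
  have hdet : IsUnit (Matrix.vandermonde x).det :=
    isUnit_iff_ne_zero.2 (Matrix.det_vandermonde_ne_zero_iff.2 hx)
  refine ⟨(Matrix.vandermonde x)⁻¹.mulVec (Pi.single a 1), fun i => ?_⟩
  have h1 : (Matrix.vandermonde x).mulVec ((Matrix.vandermonde x)⁻¹.mulVec (Pi.single a 1)) =
      Pi.single a 1 := by
    rw [Matrix.mulVec_mulVec, Matrix.mul_nonsing_inv _ hdet, Matrix.one_mulVec]
  exact congrFun h1 i

/-- Where exactly one of the factors of `stokesForm` vanishes and the critical points are simple,
the differential of the polynomial does not vanish: the critical values are local coordinates. -/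
lemma IsStokesPoly.fderiv_ne_zero {d : ℕ} {p : MvPolynomial (Fin d) ℂ} (hp : IsStokesPoly p)
    {lam x : Fin d → ℂ} (hx : IsCriticalVector lam x) (hinj : Function.Injective x)
    {a b c e : Fin d} (hab : a ≠ b) (hac : a ≠ c) (hae : a ≠ e) (hbc : b ≠ c) (hbe : b ≠ e)
    (hce : c ≠ e) {α : Fin d → ℂ} (hα : ∀ i, α i = monomialDeformation d (x i) lam)
    (h1 : α a + α b - α c - α e = 0) (h2 : α a + α c - α b - α e ≠ 0)
    (h3 : α a + α e - α b - α c ≠ 0)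
    (h4 : ∀ S : Finset (Fin d), S.card = 4 → S ≠ {a, b, c, e} → quartetForm S α ≠ 0) :
    fderiv ℂ (fun y => MvPolynomial.eval y p) lam ≠ 0 := by
  classical
  intro h0
  obtain ⟨A, hA0, hAd, hAp⟩ := exists_local_critical_values hx hinj
  have hA0' : ∀ i, A i lam = α i := fun i => by rw [hA0, hα]
  obtain ⟨ν, hν⟩ := exists_pow_sum_eq_single hinj a
  have hdA : ∀ i, DifferentiableAt ℂ (A i) lam := fun i => (hAd i).differentiableAt
  set L : (Fin d → ℂ) → ℂ := fun y => A a y + A b y - A c y - A e y with hL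
  set R : (Fin d → ℂ) → ℂ := fun y =>
    3 * ((A a y + A c y - A b y - A e y) * (A a y + A e y - A b y - A c y)) *
    ∏ T ∈ ((Finset.univ : Finset (Fin d)).powersetCard 4).erase {a, b, c, e},
      quartetForm T (fun i => A i y) with hR
  have hprod : (fun y => MvPolynomial.eval y p) =ᶠ[𝓝 lam] fun y => L y * R y := by
    filter_upwards [hAp] with y hy
    rw [hy p hp, stokesForm_eq_mul_erase _ (card_quartet hab hac hae hbc hbe hce),
      quartetForm_insert _ hab hac hae hbc hbe hce, hL, hR]
    ring
  have hLd := (((hAd a).add (hAd b)).sub (hAd c)).sub (hAd e)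
  have hRd : DifferentiableAt ℂ R lam := by
    have h5 : ∀ T ∈ ((Finset.univ : Finset (Fin d)).powersetCard 4).erase {a, b, c, e},
        DifferentiableAt ℂ (fun y => quartetForm T (fun i => A i y)) lam := fun T _ =>
      differentiableAt_quartetForm hdA
    have h6 := (HasFDerivAt.finsetProd fun T hT => (h5 T hT).hasFDerivAt).differentiableAt
    have h7 : DifferentiableAt ℂ (fun y => 3 * ((A a y + A c y - A b y - A e y) *
      (A a y + A e y - A b y - A c y))) lam := by fun_prop
    exact h7.mul h6
  have hmul := (HasFDerivAt.mul hLd hRd.hasFDerivAt).congr_of_eventuallyEq hprod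
  have h8 := hmul.fderiv
  rw [h0] at h8
  have h9 := congrArg (fun f => f ν) h8
  have hL0 : A a lam + A b lam - A c lam - A e lam = 0 := by simp only [hA0', h1]
  have hR0 : R lam = 0 := by
    symm
    simpa [hν, hL0, Pi.single_apply, hab.symm, hac.symm, hae.symm] using h9
  rw [hR] at hR0
  simp only [hA0'] at hR0
  refine mul_ne_zero (mul_ne_zero three_ne_zero (mul_ne_zero h2 h3))
    (Finset.prod_ne_zero_iff.2 fun T hT => ?_) hR0
  rw [Finset.mem_erase, Finset.mem_powersetCard] at hT
  exact h4 T hT.2.2 hT.1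

/-- Every zero of the polynomial is a limit of parameters with four different critical values
satisfying the relation, at which the polynomial has nonzero differential. -/
theorem IsStokesPoly.mem_closure {d : ℕ} {p : MvPolynomial (Fin d) ℂ} (hp : IsStokesPoly p)
    {lam : Fin d → ℂ} (h : MvPolynomial.eval lam p = 0) :
    lam ∈ closure {y | y ∈ stokesLocus d ∧ fderiv ℂ (fun y => MvPolynomial.eval y p) y ≠ 0} := by
  classical
  obtain ⟨x, hx⟩ := exists_isCriticalVector lam
  rw [hp lam x hx] at h
  obtain ⟨a, b, c, e, hab, hac, hae, hbc, hbe, hce, hrel⟩ :=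
    exists_relation_of_stokesForm_eq_zero h
  have hd : 0 < d := a.pos
  rw [mem_closure_iff_nhds]
  intro V hV
  -- `Θ` leads from arbitrary points to the parameter having these points, translated to have mean
  -- zero, as critical points
  set mean : (Fin d → ℂ) → ℂ := fun y => (∑ i, y i) / d
  set Θ : (Fin d → ℂ) → Fin d → ℂ := fun y =>
    paramOf ((defPoly lam).coeff 0) fun k => y k - mean y with hΘ
  have hmean : Continuous mean := by fun_prop
  have hΘc : Continuous Θ := (continuous_paramOf _).comp (by fun_prop)
  have hΘx : Θ x = lam := by
    have : mean x = 0 := by simp [mean, hx.sum_eq_zero]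
    simp only [hΘ, this, sub_zero]
    exact hx.paramOf_eq
  have hU : Θ ⁻¹' V ∈ 𝓝 x := hΘc.continuousAt (by rwa [hΘx])
  set w := relVec a b c e with hw
  have hwk : ∀ {k}, w k ≠ 0 ↔ k ∈ ({a, b, c, e} : Finset (Fin d)) :=
    relVec_apply_ne_zero hab hac hae hbc hbe hce
  have hcardS : ({a, b, c, e} : Finset (Fin d)).card = 4 := card_quartet hab hac hae hbc hbe hce
  have hx0 : ∑ i, w i * (primPoly x).eval (x i) = 0 := by
    rw [sum_relVec_mul]
    simp only [hx.eval_eq] at hrel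
    linear_combination hrel
  -- the relations to be avoided: coincidences of two critical values, and all other relations
  set F : Finset (Fin d → ℂ) :=
    ((Finset.univ.image fun q : Fin d × Fin d =>
        (Pi.single q.1 1 - Pi.single q.2 1 : Fin d → ℂ)) ∪
      (Finset.univ.image fun q : Fin d × Fin d × Fin d × Fin d =>
        relVec q.1 q.2.1 q.2.2.1 q.2.2.2)).filter
      fun v => ∑ i, v i = 0 ∧ ∀ t : ℂ, v ≠ t • w with hF
  obtain ⟨y, hyV, hy, hyF⟩ := exists_generic_near (sum_relVec a b c e) hab
    (hwk.2 (by simp)) hx0 F (fun v hv => (Finset.mem_filter.1 hv).2) hU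
  set y' : Fin d → ℂ := fun k => y k - mean y with hy'
  have hy's : ∑ i, y' i = 0 := by
    have : (d : ℂ) ≠ 0 := by exact_mod_cast hd.ne'
    simp only [hy', mean, Finset.sum_sub_distrib, Finset.sum_const, Finset.card_univ,
      Fintype.card_fin, nsmul_eq_mul]
    field_simp
    ring
  have hcrit : IsCriticalVector (Θ y) y' := isCriticalVector_paramOf hd _ hy's
  obtain ⟨c₁, hc₁⟩ := eval_primPoly_sub_const y (mean y)
  set α : Fin d → ℂ := fun i => monomialDeformation d (y' i) (Θ y) with hα
  have hαc : ∀ i, α i = (primPoly y).eval (y i) + (c₁ + (defPoly (Θ y)).coeff 0) := by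
    intro i
    rw [hα]
    simp only [hcrit.eval_eq]
    rw [← add_assoc, ← hc₁ i]
  -- translations do not affect linear combinations with coefficient sum zero
  have hsum : ∀ v : Fin d → ℂ, ∑ i, v i = 0 →
      ∑ i, v i * α i = ∑ i, v i * (primPoly y).eval (y i) := by
    intro v hv
    simp only [hαc, mul_add, Finset.sum_add_distrib, ← Finset.sum_mul, hv]
    ring
  have hpair : ∀ i j, i ≠ j → α i ≠ α j := by
    intro i j hij hαij
    have hs : ∑ k, (Pi.single i 1 - Pi.single j 1 : Fin d → ℂ) k = 0 := by
      simp [Finset.sum_sub_distrib]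
    have hne : (Pi.single i 1 - Pi.single j 1 : Fin d → ℂ) ≠ 0 := by
      intro h0
      have := congrFun h0 i
      simp [hij] at this
    obtain ⟨k, hkS, hk⟩ : ∃ k ∈ ({a, b, c, e} : Finset (Fin d)), k ∉ ({i, j} : Finset (Fin d)) := by
      by_contra! hcon
      have h5 := Finset.card_le_card (fun k hk => hcon k hk :
        ({a, b, c, e} : Finset (Fin d)) ⊆ {i, j})
      have h6 := Finset.card_le_two (a := i) (b := j)
      omega
    simp only [Finset.mem_insert, Finset.mem_singleton, not_or] at hk
    refine hyF (Pi.single i 1 - Pi.single j 1) ?_ ?_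
    · rw [hF, Finset.mem_filter, Finset.mem_union]
      refine ⟨Or.inl (Finset.mem_image.2 ⟨(i, j), Finset.mem_univ _, rfl⟩), hs,
        ne_smul_of_apply hne (hwk.2 hkS) ?_⟩
      simp [hk.1, hk.2]
    · rw [← hsum _ hs]
      simp [sub_mul, Finset.sum_sub_distrib, Pi.single_apply, hαij]
  have hquad : ∀ i j k l : Fin d, (∀ t : ℂ, relVec i j k l ≠ t • w) →
      α i + α j - α k - α l ≠ 0 := by
    intro i j k l ht
    rw [← sum_relVec_mul i j k l α, hsum _ (sum_relVec i j k l)]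
    refine hyF _ ?_
    rw [hF, Finset.mem_filter, Finset.mem_union]
    exact ⟨Or.inr (Finset.mem_image.2 ⟨(i, j, k, l), Finset.mem_univ _, rfl⟩),
      sum_relVec i j k l, ht⟩
  have hαrel : α a + α b - α c - α e = 0 := by
    rw [← sum_relVec_mul a b c e α, hsum _ (sum_relVec a b c e), hy]
  have hinj' : Function.Injective y' := by
    intro i j hij
    by_contra hne
    exact hpair i j hne (by simp only [hα, hij])
  refine ⟨Θ y, hyV, ⟨![y' a, y' b, y' c, y' e], ?_, ?_, ?_⟩, ?_⟩
  · intro i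
    fin_cases i <;> exact hcrit.deriv_apply _
  · have h5 : (fun i => monomialDeformation d ((![y' a, y' b, y' c, y' e] : Fin 4 → ℂ) i) (Θ y)) =
        ![α a, α b, α c, α e] := by
      funext i
      fin_cases i <;> rfl
    rw [h5]
    intro i j hij
    fin_cases i <;> fin_cases j <;> first
      | rfl
      | exact (hpair _ _ ‹_› hij).elim
      | exact (hpair _ _ (Ne.symm ‹_›) hij).elim
  · change α a + α b = α c + α e
    linear_combination hαrel
  · refine hp.fderiv_ne_zero hcrit hinj' hab hac hae hbc hbe hce (α := α) (fun i => rfl) hαrel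
      (hquad _ _ _ _ fun t ht => ?_) (hquad _ _ _ _ fun t ht => ?_) fun S hS hne => ?_
    · have h5 := congrFun ht a
      have h6 := congrFun ht b
      simp [hw, relVec, hab, hac, hae, hbc, hbe, hab.symm] at h5 h6
      rw [← h5] at h6
      norm_num at h6
    · have h5 := congrFun ht a
      have h6 := congrFun ht b
      simp [hw, relVec, hab, hac, hae, hbc, hbe, hab.symm] at h5 h6
      rw [← h5] at h6
      norm_num at h6
    · intro hS0
      obtain ⟨i, j, k, l, h1, h2, h3, h4, h5, h6, rfl, hr⟩ :=
        exists_relation_of_quartetForm_eq_zero hS hS0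
      obtain ⟨q, hqS, hq⟩ : ∃ q ∈ ({a, b, c, e} : Finset (Fin d)),
          q ∉ ({i, j, k, l} : Finset (Fin d)) := by
        by_contra! hcon
        exact hne (Finset.eq_of_subset_of_card_le hcon (by rw [hcardS, hS])).symm
      have hvk : ∀ {q}, relVec i j k l q ≠ 0 ↔ q ∈ ({i, j, k, l} : Finset (Fin d)) :=
        relVec_apply_ne_zero h1 h2 h3 h4 h5 h6
      refine hquad i j k l (ne_smul_of_apply (k := q) ?_ (hwk.2 hqS) ?_) (by
        linear_combination hr)
      · intro h0
        exact (hvk (q := i)).2 (by simp) (congrFun h0 i)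
      · by_contra h0
        exact hq (hvk.1 h0)

end Generic

/-! ### Orders along lines and leading homogeneous components -/

section Orders

/-- The order of an analytic function is read off from a limit of its quotient by a power. -/
lemma analyticOrderAt_of_tendsto_div_pow {g : ℂ → ℂ} (hg : AnalyticAt ℂ g 0) {m : ℕ} {l : ℂ}
    (h : Tendsto (fun t => g t / t ^ m) (𝓝[≠] 0) (𝓝 l)) :
    (m : ℕ∞) ≤ analyticOrderAt g 0 ∧ (l ≠ 0 → analyticOrderAt g 0 = m) ∧
      (l = 0 → (m : ℕ∞) < analyticOrderAt g 0) := by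
  by_cases htop : analyticOrderAt g 0 = ⊤
  · have h0 : l = 0 := by
      refine tendsto_nhds_unique h (tendsto_const_nhds.congr' ?_)
      filter_upwards [nhdsWithin_le_nhds (analyticOrderAt_eq_top.1 htop)] with t ht
      rw [ht, zero_div]
    rw [htop]
    exact ⟨le_top, fun h1 => absurd h0 h1, fun _ => ENat.natCast_lt_top m⟩
  · obtain ⟨k, hk⟩ := ENat.ne_top_iff_exists.1 htop
    obtain ⟨r, hr, hr0, hgr⟩ := (hg.analyticOrderAt_eq_natCast).1 hk.symm
    have hrt : Tendsto r (𝓝[≠] 0) (𝓝 (r 0)) := hr.continuousAt.tendsto.mono_left nhdsWithin_le_nhds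
    have hpow : ∀ j : ℕ, Tendsto (fun t : ℂ => t ^ j) (𝓝[≠] 0) (𝓝 (0 ^ j)) := fun j =>
      ((continuous_pow j).tendsto 0).mono_left nhdsWithin_le_nhds
    have hgr' : ∀ᶠ t in 𝓝[≠] (0 : ℂ), t ≠ 0 ∧ g t = t ^ k * r t := by
      filter_upwards [nhdsWithin_le_nhds hgr, self_mem_nhdsWithin] with t ht ht0
      exact ⟨ht0, by simpa using ht⟩
    rw [← hk]
    rcases lt_trichotomy k m with hkm | rfl | hkm
    · exfalso
      refine hr0 (tendsto_nhds_unique hrt ?_)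
      have h1 := h.mul (hpow (m - k))
      rw [zero_pow (by omega), mul_zero] at h1
      refine h1.congr' ?_
      filter_upwards [hgr'] with t ⟨ht0, ht⟩
      rw [ht]
      have : t ^ m = t ^ k * t ^ (m - k) := by rw [← pow_add]; congr 1; omega
      rw [this]
      field_simp
    · have hl : l = r 0 := by
        refine tendsto_nhds_unique h (hrt.congr' ?_)
        filter_upwards [hgr'] with t ⟨ht0, ht⟩
        rw [ht]
        field_simp
      exact ⟨le_rfl, fun _ => rfl, fun h1 => absurd (hl ▸ h1) hr0⟩
    · have hl : l = 0 := by
        have h1 := (hpow (k - m)).mul hrt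
        rw [zero_pow (by omega), zero_mul] at h1
        refine tendsto_nhds_unique h (h1.congr' ?_)
        filter_upwards [hgr'] with t ⟨ht0, ht⟩
        rw [ht]
        have : t ^ k = t ^ m * t ^ (k - m) := by rw [← pow_add]; congr 1; omega
        rw [this]
        field_simp
      exact ⟨by exact_mod_cast hkm.le, fun h1 => absurd hl h1, fun _ => by exact_mod_cast hkm⟩

open Polynomial in
lemma coeff_of_tendsto_div_pow {m : ℕ} {q : ℂ[X]} {l : ℂ}
    (h : Tendsto (fun t => q.eval t / t ^ m) (𝓝[≠] 0) (𝓝 l)) :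
    (∀ k < m, q.coeff k = 0) ∧ q.coeff m = l := by
  induction m generalizing q with
  | zero =>
    refine ⟨by simp, ?_⟩
    have h1 : Tendsto (fun t => q.eval t) (𝓝[≠] 0) (𝓝 (q.eval 0)) :=
      (q.continuous.tendsto 0).mono_left nhdsWithin_le_nhds
    rw [coeff_zero_eq_eval_zero]
    exact tendsto_nhds_unique h1 (by simpa using h)
  | succ m ih =>
    have h0 : q.coeff 0 = 0 := by
      have h1 : Tendsto (fun t => q.eval t) (𝓝[≠] 0) (𝓝 (q.eval 0)) :=
        (q.continuous.tendsto 0).mono_left nhdsWithin_le_nhds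
      have h2 : Tendsto (fun t : ℂ => t ^ (m + 1)) (𝓝[≠] 0) (𝓝 (0 ^ (m + 1))) :=
        ((continuous_pow (m + 1)).tendsto 0).mono_left nhdsWithin_le_nhds
      have h3 := h.mul h2
      rw [zero_pow (by omega), mul_zero] at h3
      rw [coeff_zero_eq_eval_zero]
      refine tendsto_nhds_unique h1 (h3.congr' ?_)
      filter_upwards [self_mem_nhdsWithin] with t ht
      have : t ≠ 0 := ht
      field_simp
    have hq : q = X * q.divX := by
      conv_lhs => rw [← X_mul_divX_add q, h0, C_0, add_zero]
    obtain ⟨h4, h5⟩ := ih (q := q.divX) (h.congr' (by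
      filter_upwards [self_mem_nhdsWithin] with t ht
      have : t ≠ 0 := ht
      conv_lhs => rw [hq]
      rw [eval_mul, eval_X, pow_succ]
      field_simp))
    refine ⟨fun k hk => ?_, ?_⟩
    · rcases k with _ | k
      · exact h0
      · rw [← coeff_divX]
        exact h4 k (by omega)
    · rw [← coeff_divX, h5]

open MvPolynomial

/-- If the restrictions of a polynomial to all lines through the origin vanish to order at
least `m`, its leading behaviour at the origin is given by the homogeneous component of
degree `m`, also along curves. -/
theorem tendsto_eval_smul_div_pow {σ : Type*} [Fintype σ] {p : MvPolynomial σ ℂ} {m : ℕ}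
    (h : ∀ v : σ → ℂ, ∃ l, Tendsto (fun t : ℂ => eval (t • v) p / t ^ m) (𝓝[≠] 0) (𝓝 l))
    {u : ℂ → σ → ℂ} {v : σ → ℂ} (hu : Tendsto u (𝓝[≠] 0) (𝓝 v)) :
    Tendsto (fun t : ℂ => eval (t • u t) p / t ^ m) (𝓝[≠] 0)
      (𝓝 (eval v (homogeneousComponent m p))) := by
  have hexp : ∀ (t : ℂ) (w : σ → ℂ), eval (t • w) p =
      ∑ k ∈ Finset.range (p.totalDegree + m + 1), t ^ k * eval w (homogeneousComponent k p) := by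
    intro t w
    have h1 : p = ∑ k ∈ Finset.range (p.totalDegree + m + 1), homogeneousComponent k p := by
      conv_lhs => rw [← sum_homogeneousComponent p]
      refine Finset.sum_subset (Finset.range_mono (by omega)) fun k _ hk => ?_
      have := Finset.mem_range.not.1 hk
      exact homogeneousComponent_eq_zero _ _ (by omega)
    conv_lhs => rw [h1]
    rw [map_sum]
    exact Finset.sum_congr rfl fun k _ =>
      eval_smul_of_isHomogeneous (homogeneousComponent_isHomogeneous k p) t w
  have hlow : ∀ (w : σ → ℂ), ∀ k < m, eval w (homogeneousComponent k p) = 0 := by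
    intro w k hk
    obtain ⟨l, hl⟩ := h w
    set q : Polynomial ℂ := ∑ k ∈ Finset.range (p.totalDegree + m + 1),
      Polynomial.C (eval w (homogeneousComponent k p)) * Polynomial.X ^ k with hq
    have h2 := (coeff_of_tendsto_div_pow (q := q) (hl.congr fun t => by
      rw [hexp, hq, Polynomial.eval_finsetSum]
      congr 1
      refine Finset.sum_congr rfl fun k _ => ?_
      rw [Polynomial.eval_mul, Polynomial.eval_C, Polynomial.eval_pow, Polynomial.eval_X,
        mul_comm])).1 k hk
    rw [hq, Polynomial.finsetSum_coeff] at h2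
    simp only [Polynomial.coeff_C_mul_X_pow] at h2
    rwa [Finset.sum_ite_eq, if_pos (Finset.mem_range.2 (by omega))] at h2
  have hlim : Tendsto (fun t : ℂ => ∑ k ∈ Finset.range (p.totalDegree + 1),
      t ^ k * eval (u t) (homogeneousComponent (m + k) p)) (𝓝[≠] 0)
      (𝓝 (∑ k ∈ Finset.range (p.totalDegree + 1),
        (0 : ℂ) ^ k * eval v (homogeneousComponent (m + k) p))) := by
    refine tendsto_finsetSum _ fun k _ => Tendsto.mul ?_ ?_
    · exact ((continuous_pow k).tendsto 0).mono_left nhdsWithin_le_nhds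
    · exact ((MvPolynomial.continuous_eval _).tendsto v).comp hu
  have hval : ∑ k ∈ Finset.range (p.totalDegree + 1),
      (0 : ℂ) ^ k * eval v (homogeneousComponent (m + k) p) =
      eval v (homogeneousComponent m p) := by
    rw [Finset.sum_eq_single_of_mem 0 (Finset.mem_range.2 (Nat.succ_pos _)), pow_zero, one_mul,
      add_zero]
    · intro k _ hk
      rw [zero_pow hk, zero_mul]
  rw [hval] at hlim
  refine hlim.congr' ?_
  filter_upwards [self_mem_nhdsWithin] with t ht
  have ht0 : t ≠ 0 := ht
  rw [hexp, show p.totalDegree + m + 1 = m + (p.totalDegree + 1) by omega,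
    Finset.sum_range_add (fun k => t ^ k * eval (u t) (homogeneousComponent k p)) m,
    Finset.sum_eq_zero (s := Finset.range m), zero_add, Finset.sum_div]
  · refine Finset.sum_congr rfl fun k _ => ?_
    rw [pow_add]
    field_simp
  · intro k hk
    rw [hlow _ k (Finset.mem_range.1 hk), mul_zero]

end Orders

/-! ### The numerical value of the multiplicity -/

section Multiplicity

/-- The multiplicity as a natural number, together with the count of orders it comes from: the
product `stokesForm` has weighted degree `(d + 1) * 3 * (d choose 4)`, and for `n = d / 2` there are
`n choose 2` factors in which the leading term cancels. -/
lemma exists_multiplicity {n : ℕ} (hn : 0 < n) : ∃ m : ℕ,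
    (m : ℚ) = (((n + n : ℕ) : ℚ) - 2) *
      ((((n + n : ℕ) : ℚ) + 1) * (((n + n : ℕ) : ℚ) - 1) * (((n + n : ℕ) : ℚ) - 3) + 1) / 8 ∧
    (n + n) * m = (n + n + 1) * (3 * (n + n).choose 4) + n.choose 2 := by
  obtain ⟨k, rfl⟩ : ∃ k, n = k + 1 := ⟨n - 1, by omega⟩
  rcases Nat.eq_zero_or_pos k with rfl | hk
  · exact ⟨0, by norm_num, by simp [Nat.choose]⟩
  obtain ⟨j, rfl⟩ : ∃ j, k = j + 1 := ⟨k - 1, by omega⟩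
  have h2 : (((j + 1 + 1).choose 2 : ℕ) : ℚ) = (j + 2) * (j + 1) / 2 := by
    rw [Nat.cast_choose_two]
    push_cast
    ring
  have h4 : (((j + 1 + 1 + (j + 1 + 1)).choose 4 : ℕ) : ℚ) =
      (2 * j + 4) * (2 * j + 3) * (2 * j + 2) * (2 * j + 1) / 24 := by
    have h := Nat.descFactorial_eq_factorial_mul_choose (j + 1 + 1 + (j + 1 + 1)) 4
    have h5 : (j + 1 + 1 + (j + 1 + 1)).descFactorial 4 =
        (2 * j + 4) * (2 * j + 3) * (2 * j + 2) * (2 * j + 1) := by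
      rw [show j + 1 + 1 + (j + 1 + 1) = 2 * j + 4 by ring]
      simp only [Nat.descFactorial]
      rw [show 2 * j + 4 - 3 = 2 * j + 1 by omega, show 2 * j + 4 - 2 = 2 * j + 2 by omega,
        show 2 * j + 4 - 1 = 2 * j + 3 by omega]
      simp only [Nat.sub_zero]
      ring
    rw [h5] at h
    have h6 : ((2 * j + 4) * (2 * j + 3) * (2 * j + 2) * (2 * j + 1) : ℚ) =
        24 * ((j + 1 + 1 + (j + 1 + 1)).choose 4 : ℕ) := by
      exact_mod_cast h
    rw [h6]
    ring
  have hle : (j + 1 + 1).choose 2 ≤ 2 * (j + 1) ^ 4 + 3 * (j + 1) ^ 3 := by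
    have : ((j + 1 + 1).choose 2 : ℚ) ≤ ((2 * (j + 1) ^ 4 + 3 * (j + 1) ^ 3 : ℕ) : ℚ) := by
      rw [h2]
      push_cast
      have : (0 : ℚ) ≤ j := Nat.cast_nonneg j
      nlinarith [pow_nonneg this 2, pow_nonneg this 3, pow_nonneg this 4]
    exact_mod_cast this
  refine ⟨2 * (j + 1) ^ 4 + 3 * (j + 1) ^ 3 - (j + 1 + 1).choose 2, ?_, ?_⟩
  · rw [Nat.cast_sub hle, h2]
    push_cast
    ring
  · have : ((((j + 1 + 1 + (j + 1 + 1)) *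
        (2 * (j + 1) ^ 4 + 3 * (j + 1) ^ 3 - (j + 1 + 1).choose 2) : ℕ)) : ℚ) =
        (((j + 1 + 1 + (j + 1 + 1) + 1) * (3 * (j + 1 + 1 + (j + 1 + 1)).choose 4) +
          (j + 1 + 1).choose 2 : ℕ) : ℚ) := by
      simp only [Nat.cast_mul, Nat.cast_add, Nat.cast_sub hle, h2, h4]
      push_cast
      ring
    exact_mod_cast this

end Multiplicity

/-! ### Bounds for critical points and critical values -/

section Bounds

open Polynomial

lemma eval_derivative_defPoly {d : ℕ} (lam : Fin d → ℂ) (z : ℂ) :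
    (derivative (defPoly lam)).eval z =
      ((d : ℂ) + 1) * z ^ d + ∑ j : Fin d, lam j * ((j : ℂ) * z ^ ((j : ℕ) - 1)) := by
  simp [defPoly, eval_finsetSum, derivative_X_pow]

lemma norm_pow_le_of_deriv_eq_zero {d : ℕ} {lam : Fin d → ℂ} {z : ℂ}
    (hz : deriv (fun w => monomialDeformation d w lam) z = 0) :
    ‖z‖ ^ d ≤ ∑ j : Fin d, ‖lam j‖ * ((j : ℝ) * ‖z‖ ^ ((j : ℕ) - 1)) := by
  rw [deriv_monomialDeformation, eval_derivative_defPoly] at hz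
  have h1 : ‖((d : ℂ) + 1) * z ^ d‖ =
      ‖∑ j : Fin d, lam j * ((j : ℂ) * z ^ ((j : ℕ) - 1))‖ := by
    rw [eq_neg_of_add_eq_zero_left hz, norm_neg]
  have h2 : ‖((d : ℂ) + 1) * z ^ d‖ = ((d : ℝ) + 1) * ‖z‖ ^ d := by
    rw [norm_mul, norm_pow]
    congr 1
    exact_mod_cast Complex.norm_natCast (d + 1)
  have h3 : ‖∑ j : Fin d, lam j * ((j : ℂ) * z ^ ((j : ℕ) - 1))‖ ≤
      ∑ j : Fin d, ‖lam j‖ * ((j : ℝ) * ‖z‖ ^ ((j : ℕ) - 1)) := by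
    refine (norm_sum_le _ _).trans (le_of_eq (Finset.sum_congr rfl fun j _ => ?_))
    simp
  rw [← h1, h2] at h3
  have h4 : 0 ≤ (d : ℝ) * ‖z‖ ^ d := by positivity
  linarith

lemma norm_lt_of_deriv_eq_zero {d : ℕ} {r : ℝ} (hr : 0 < r) (hr1 : r ≤ 1) {lam : Fin d → ℂ}
    (hlam : ∑ j : Fin d, ‖lam j‖ * (j : ℝ) < r ^ d) {z : ℂ}
    (hz : deriv (fun w => monomialDeformation d w lam) z = 0) : ‖z‖ < r := by
  by_contra! hcon
  have hpos : 0 < ‖z‖ ^ d := pow_pos (hr.trans_le hcon) d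
  have h1 := mul_le_mul_of_nonneg_right (norm_pow_le_of_deriv_eq_zero hz) (pow_pos hr d).le
  have h2 : (∑ j : Fin d, ‖lam j‖ * ((j : ℝ) * ‖z‖ ^ ((j : ℕ) - 1))) * r ^ d ≤
      ‖z‖ ^ d * ∑ j : Fin d, ‖lam j‖ * (j : ℝ) := by
    rw [Finset.sum_mul, Finset.mul_sum]
    refine Finset.sum_le_sum fun j _ => ?_
    have h3 : ‖z‖ ^ ((j : ℕ) - 1) * r ^ d ≤ ‖z‖ ^ d := by
      have h4 : ‖z‖ ^ d = ‖z‖ ^ ((j : ℕ) - 1) * ‖z‖ ^ (d - ((j : ℕ) - 1)) := by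
        rw [← pow_add]; congr 1; have := j.2; omega
      rw [h4]
      refine mul_le_mul_of_nonneg_left ?_ (by positivity)
      exact (pow_le_pow_of_le_one hr.le hr1 (Nat.sub_le _ _)).trans
        (pow_le_pow_left₀ hr.le hcon _)
    have h5 : 0 ≤ ‖lam j‖ * (j : ℝ) := by positivity
    nlinarith
  have h6 := mul_lt_mul_of_pos_left hlam hpos
  linarith

/-- The critical points of the monomial deformation tend to `0` with the parameter. -/
lemma eventually_norm_lt_of_deriv_eq_zero (d : ℕ) {r : ℝ} (hr : 0 < r) :
    ∀ᶠ lam in 𝓝 (0 : Fin d → ℂ), ∀ z,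
      deriv (fun w => monomialDeformation d w lam) z = 0 → ‖z‖ < r := by
  have hmin : 0 < min r 1 := lt_min hr one_pos
  have hc : Continuous fun lam : Fin d → ℂ => ∑ j : Fin d, ‖lam j‖ * (j : ℝ) := by fun_prop
  have h1 : ∀ᶠ lam in 𝓝 (0 : Fin d → ℂ), ∑ j : Fin d, ‖lam j‖ * (j : ℝ) < min r 1 ^ d :=
    hc.continuousAt.eventually_lt continuousAt_const (by simpa using pow_pos hmin d)
  filter_upwards [h1] with lam hlam z hz
  exact (norm_lt_of_deriv_eq_zero hmin (min_le_right _ _) hlam hz).trans_le (min_le_left _ _)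

lemma norm_monomialDeformation_le {d : ℕ} {lam : Fin d → ℂ} {z : ℂ} (hz1 : ‖z‖ ≤ 1)
    (hz : deriv (fun w => monomialDeformation d w lam) z = 0) :
    ‖monomialDeformation d z lam‖ ≤ ∑ j : Fin d, ‖lam j‖ * ((j : ℝ) + 1) := by
  have h1 : ‖z ^ (d + 1)‖ ≤ ∑ j : Fin d, ‖lam j‖ * (j : ℝ) := by
    rw [norm_pow, pow_succ]
    refine (mul_le_of_le_one_right (by positivity) hz1).trans
      ((norm_pow_le_of_deriv_eq_zero hz).trans (Finset.sum_le_sum fun j _ => ?_))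
    refine mul_le_mul_of_nonneg_left ?_ (norm_nonneg _)
    exact mul_le_of_le_one_right (by positivity) (pow_le_one₀ (norm_nonneg _) hz1)
  have h2 : ‖∑ j : Fin d, lam j * z ^ (j : ℕ)‖ ≤ ∑ j : Fin d, ‖lam j‖ := by
    refine (norm_sum_le _ _).trans (Finset.sum_le_sum fun j _ => ?_)
    rw [norm_mul, norm_pow]
    exact mul_le_of_le_one_right (norm_nonneg _) (pow_le_one₀ (norm_nonneg _) hz1)
  simp only [mul_add, mul_one, Finset.sum_add_distrib]
  exact (norm_add_le _ _).trans (add_le_add h1 h2)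

end Bounds

/-! ### Quasi-homogeneity -/

section Lines

open Polynomial

/-- Substituting `t ^ d • v` for the parameter and rescaling the critical points by `t` leads to
the parameter `reducedParam v t`, which has a limit as `t → 0`. -/
noncomputable def reducedParam {d : ℕ} (v : Fin d → ℂ) (t : ℂ) : Fin d → ℂ :=
  fun j => if (j : ℕ) = 0 then 0 else t ^ ((j : ℕ) - 1) * v j

lemma monomialDeformation_smul_pow {d : ℕ} (v : Fin d → ℂ) (t z : ℂ) :
    monomialDeformation d (t * z) (t ^ d • v) =
      t ^ (d + 1) * monomialDeformation d z (reducedParam v t) +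
        t ^ d * (defPoly v).coeff 0 * if d = 0 then 0 else 1 := by
  rcases Nat.eq_zero_or_pos d with rfl | hd
  · simp [monomialDeformation]
  simp only [monomialDeformation, reducedParam, mul_add, Finset.mul_sum, if_neg hd.ne', mul_one]
  rw [mul_pow, add_assoc, coeff_defPoly_of_lt v hd]
  congr 1
  have h1 : t ^ d * v ⟨0, hd⟩ =
      ∑ j : Fin d, if (j : ℕ) = 0 then t ^ d * v j else 0 := by
    rw [Finset.sum_eq_single ⟨0, hd⟩]
    · simp
    · intro j _ hj
      rw [if_neg]
      exact fun h => hj (Fin.ext h)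
    · simp
  rw [h1, ← Finset.sum_add_distrib]
  refine Finset.sum_congr rfl fun j _ => ?_
  rw [Pi.smul_apply, smul_eq_mul]
  split_ifs with h
  · rw [h]; ring
  · obtain ⟨k, hk⟩ := Nat.exists_eq_succ_of_ne_zero h
    rw [hk]
    simp only [Nat.succ_sub_one, Nat.succ_eq_add_one]
    ring

lemma IsCriticalVector.smul_of_reducedParam {d : ℕ} {v x : Fin d → ℂ} {t : ℂ} (ht : t ≠ 0)
    (hx : IsCriticalVector (reducedParam v t) x) :
    IsCriticalVector (t ^ d • v) (fun i => t * x i) := by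
  set c := t ^ d * (defPoly v).coeff 0 * if d = 0 then 0 else 1
  have h1 : (defPoly (t ^ d • v)).comp (C t * X) =
      C (t ^ (d + 1)) * defPoly (reducedParam v t) + C c := by
    refine Polynomial.funext fun z => ?_
    simp only [eval_comp, eval_mul, eval_C, eval_X, eval_add, eval_defPoly]
    exact monomialDeformation_smul_pow v t z
  have h2 := congrArg derivative h1
  rw [derivative_comp, derivative_add, derivative_C, add_zero, derivative_C_mul, derivative_C_mul,
    show derivative (defPoly (reducedParam v t)) = _ from hx] at h2
  refine Polynomial.funext fun w => ?_
  have h3 := congrArg (eval (t⁻¹ * w)) h2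
  simp only [eval_mul, eval_comp, eval_C, eval_X, eval_prod, eval_sub, derivative_X,
    mul_one] at h3 ⊢
  rw [mul_inv_cancel_left₀ ht] at h3
  have h4 : ∏ i, (w - t * x i) = t ^ d * ∏ i, (t⁻¹ * w - x i) := by
    rw [← Fin.prod_const d t, ← Finset.prod_mul_distrib]
    refine Finset.prod_congr rfl fun i _ => ?_
    field_simp
  rw [h4]
  refine mul_left_cancel₀ ht ?_
  rw [h3]
  ring

lemma IsStokesPoly.eval_smul_pow {d : ℕ} {p : MvPolynomial (Fin d) ℂ} (hp : IsStokesPoly p)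
    (v : Fin d → ℂ) {t : ℂ} (ht : t ≠ 0) : MvPolynomial.eval (t ^ d • v) p =
      t ^ ((d + 1) * (3 * d.choose 4)) * MvPolynomial.eval (reducedParam v t) p := by
  obtain ⟨x, hx⟩ := exists_isCriticalVector (reducedParam v t)
  rw [hp _ _ hx, hp _ _ (hx.smul_of_reducedParam ht)]
  simp only [monomialDeformation_smul_pow]
  rw [stokesForm_mul_add, Fintype.card_fin, ← pow_mul]

/-- If the linear coefficient vanishes, all critical values are of higher order. -/
lemma IsStokesPoly.tendsto_of_coeff_one_eq_zero {d : ℕ} {p : MvPolynomial (Fin d) ℂ}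
    (hp : IsStokesPoly p) {v : Fin d → ℂ} (hv : (defPoly v).coeff 1 = 0) {N : ℕ}
    (hN : N < 3 * d.choose 4) :
    Tendsto (fun t => MvPolynomial.eval (reducedParam v t) p / t ^ N) (𝓝[≠] 0) (𝓝 0) := by
  choose x hx using fun t => exists_isCriticalVector (reducedParam v t)
  set V : ℝ := ∑ j : Fin d, ‖v j‖ * ((j : ℝ) + 1)
  have hjle : ∀ t : ℂ, ‖t‖ ≤ 1 → ∀ j, ‖reducedParam v t j‖ ≤ ‖t‖ * ‖v j‖ := by
    intro t ht j
    unfold reducedParam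
    split_ifs with h0
    · rw [norm_zero]; positivity
    · rw [norm_mul, norm_pow]
      by_cases h1 : (j : ℕ) = 1
      · have h2 : v j = 0 := by
          have h3 : 1 < d := h1 ▸ j.2
          rw [coeff_defPoly_of_lt v h3] at hv
          rw [← hv]
          congr 1
          exact Fin.ext h1
        simp [h2]
      · refine mul_le_mul_of_nonneg_right ?_ (norm_nonneg _)
        exact pow_le_of_le_one (norm_nonneg _) ht (by omega)
  have hred : Tendsto (reducedParam v) (𝓝 0) (𝓝 0) := by
    rw [tendsto_pi_nhds]
    intro j
    refine squeeze_zero_norm' (a := fun t => ‖t‖ * ‖v j‖) ?_ ?_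
    · filter_upwards [Metric.closedBall_mem_nhds (0 : ℂ) one_pos] with t ht
      exact hjle t (by simpa using ht) j
    · have : Continuous fun t : ℂ => ‖t‖ * ‖v j‖ := by fun_prop
      simpa using this.tendsto 0
  obtain ⟨K, hK⟩ := (isCompact_closedBall (0 : Fin d → ℂ) V).exists_bound_of_continuousOn
    (f := fun α : Fin d → ℂ => stokesForm α) (by
      refine Continuous.continuousOn ?_
      unfold stokesForm quartetForm
      fun_prop)
  have hbound : ∀ᶠ t in 𝓝[≠] (0 : ℂ), ‖MvPolynomial.eval (reducedParam v t) p / t ^ N‖ ≤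
      ‖t‖ * K := by
    have h1 := hred.eventually (eventually_norm_lt_of_deriv_eq_zero d one_pos)
    filter_upwards [nhdsWithin_le_nhds h1, self_mem_nhdsWithin,
      nhdsWithin_le_nhds (Metric.closedBall_mem_nhds (0 : ℂ) one_pos)] with t h1 ht0 ht1
    have ht : t ≠ 0 := ht0
    have htn : ‖t‖ ≤ 1 := by simpa using ht1
    have hα : ∀ i, ‖monomialDeformation d (x t i) (reducedParam v t)‖ ≤ ‖t‖ * V := by
      intro i
      refine (norm_monomialDeformation_le (h1 _ ((hx t).deriv_apply i)).le
        ((hx t).deriv_apply i)).trans ?_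
      rw [Finset.mul_sum]
      refine Finset.sum_le_sum fun j _ => ?_
      rw [← mul_assoc]
      exact mul_le_mul_of_nonneg_right (hjle t htn j) (by positivity)
    have h2 := stokesForm_mul_add t 0
      (fun i => t⁻¹ * monomialDeformation d (x t i) (reducedParam v t))
    simp only [mul_inv_cancel_left₀ ht, add_zero] at h2
    have h3 : ‖stokesForm (fun i => t⁻¹ * monomialDeformation d (x t i) (reducedParam v t))‖ ≤
        K := by
      refine hK _ ?_
      rw [mem_closedBall_zero_iff, pi_norm_le_iff_of_nonneg
        (Finset.sum_nonneg fun j _ => by positivity)]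
      intro i
      rw [norm_mul, norm_inv, inv_mul_le_iff₀ (norm_pos_iff.2 ht)]
      exact hα i
    rw [hp _ _ (hx t), h2, Fintype.card_fin, norm_div, norm_mul, norm_pow, norm_pow,
      div_le_iff₀ (pow_pos (norm_pos_iff.2 ht) N)]
    have h4 : ‖t‖ ^ (3 * d.choose 4) ≤ ‖t‖ ^ (N + 1) :=
      pow_le_pow_of_le_one (norm_nonneg _) htn hN
    have hK0 : 0 ≤ K := (norm_nonneg _).trans h3
    calc ‖t‖ ^ (3 * d.choose 4) * _ ≤ ‖t‖ ^ (N + 1) * K := by gcongr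
      _ = ‖t‖ * K * ‖t‖ ^ N := by ring
  refine squeeze_zero_norm' hbound ?_
  have : Continuous fun t : ℂ => ‖t‖ * K := by fun_prop
  simpa using (this.tendsto 0).mono_left (nhdsWithin_le_nhds (s := {0}ᶜ))

end Lines

/-! ### Relations between the vertices of a regular polygon -/

section DegenerateQuartets

/-- A parallelogram inscribed in a circle centred at the origin is a rectangle, its centre being
the origin. -/
lemma add_eq_zero_of_norm_eq {u v w z : ℂ} (huv : ‖v‖ = ‖u‖) (huw : ‖w‖ = ‖u‖) (huz : ‖z‖ = ‖u‖)
    (h : u + v = w + z) (h1 : u ≠ w) (h2 : u ≠ z) : u + v = 0 := by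
  by_contra h0
  have hn : ∀ y : ℂ, ‖y‖ = ‖u‖ → y * (starRingEnd ℂ) y = (‖u‖ : ℂ) ^ 2 := fun y hy => by
    rw [Complex.mul_conj, Complex.normSq_eq_norm_sq, hy]
    push_cast
    rfl
  have hu := hn u rfl
  have hv := hn v huv
  have hw := hn w huw
  have hz := hn z huz
  have hc : (starRingEnd ℂ) u + (starRingEnd ℂ) v = (starRingEnd ℂ) w + (starRingEnd ℂ) z := by
    rw [← map_add, h, map_add]
  have hc0 : (starRingEnd ℂ) u + (starRingEnd ℂ) v ≠ 0 := by
    rw [← map_add]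
    exact (map_ne_zero _).2 h0
  have h3 : ((starRingEnd ℂ) u + (starRingEnd ℂ) v) * (u * v - w * z) = 0 := by
    linear_combination v * hu + u * hv - z * hw - w * hz - w * z * hc + (‖u‖ : ℂ) ^ 2 * h
  have h4 := (mul_eq_zero.1 h3).resolve_left hc0
  have h5 : (u - w) * (u - z) = 0 := by linear_combination u * h - h4
  rcases mul_eq_zero.1 h5 with h6 | h6
  · exact h1 (sub_eq_zero.1 h6)
  · exact h2 (sub_eq_zero.1 h6)

/-- The leading behaviour of one factor when the critical values are `c * x i + s * x i ^ 2 * t` to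
first order, for points `x i` on a circle. -/
lemma exists_tendsto_quartetForm {ι : Type*} [DecidableEq ι] {x : ι → ℂ}
    (hinj : Function.Injective x) (hnorm : ∀ i j, ‖x i‖ = ‖x j‖) {c : ℂ} (hc : c ≠ 0)
    {S : Finset ι} (hS : S.card = 4) : ∃ K : ℂ, K ≠ 0 ∧ ∀ (s : ℂ) (α : ι → ℂ → ℂ),
      (∀ i, α i 0 = c * x i) → (∀ i, HasDerivAt (α i) (s * x i ^ 2) 0) →
      Tendsto (fun t => quartetForm S (fun i => α i t) / t ^ (if quartetForm S x = 0 then 1 else 0))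
        (𝓝[≠] 0) (𝓝 (s ^ (if quartetForm S x = 0 then 1 else 0) * K)) := by
  by_cases h0 : quartetForm S x = 0
  · obtain ⟨a, b, e, f, hab, hae, haf, hbe, hbf, hef, rfl, hrel⟩ :=
      exists_relation_of_quartetForm_eq_zero hS h0
    have h1 : x a + x b = 0 := add_eq_zero_of_norm_eq (hnorm _ _) (hnorm _ _) (hnorm _ _) hrel
      (hinj.ne hae) (hinj.ne haf)
    have h2 : x e + x f = 0 := by rw [← hrel, h1]
    have hxb : x b = -x a := eq_neg_of_add_eq_zero_right h1
    have hxf : x f = -x e := eq_neg_of_add_eq_zero_right h2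
    have h3 : x a - x e ≠ 0 := sub_ne_zero.2 (hinj.ne hae)
    have h4 : x a + x e ≠ 0 := fun h => hinj.ne haf (by rw [hxf]; linear_combination h)
    refine ⟨24 * c ^ 2 * (x a - x e) ^ 2 * (x a + x e) ^ 2,
      mul_ne_zero (mul_ne_zero (mul_ne_zero (by norm_num) (pow_ne_zero _ hc))
        (pow_ne_zero _ h3)) (pow_ne_zero _ h4), ?_⟩
    intro s α hα0 hα
    rw [if_pos h0]
    have hL := (((hα a).add (hα b)).sub (hα e)).sub (hα f)
    have hL0 : α a 0 + α b 0 - α e 0 - α f 0 = 0 := by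
      simp only [hα0]
      linear_combination c * hrel
    have hLt := hasDerivAt_iff_tendsto_slope.1 hL
    have hcont : ∀ i, Tendsto (α i) (𝓝[≠] 0) (𝓝 (c * x i)) := fun i => by
      rw [← hα0]
      exact (hα i).continuousAt.tendsto.mono_left nhdsWithin_le_nhds
    have hR := ((((hcont a).add (hcont e)).sub (hcont b)).sub (hcont f)).mul
      ((((hcont a).add (hcont f)).sub (hcont b)).sub (hcont e))
    have hmain := (hLt.mul hR).const_mul 3
    have hval : 3 * ((s * x a ^ 2 + s * x b ^ 2 - s * x e ^ 2 - s * x f ^ 2) *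
        ((c * x a + c * x e - c * x b - c * x f) * (c * x a + c * x f - c * x b - c * x e))) =
        s ^ 1 * (24 * c ^ 2 * (x a - x e) ^ 2 * (x a + x e) ^ 2) := by
      rw [hxb, hxf]
      ring
    rw [hval] at hmain
    refine hmain.congr' ?_
    filter_upwards [self_mem_nhdsWithin] with t ht
    have ht0 : t ≠ 0 := ht
    rw [quartetForm_insert _ hab hae haf hbe hbf hef, slope_def_field]
    simp only [Pi.add_apply, Pi.sub_apply, hL0, sub_zero, pow_one]
    ring
  · have hmul : quartetForm S (fun i => c * x i) = c ^ 3 * quartetForm S x := by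
      simp only [quartetForm, mul_pow, ← Finset.mul_sum]
      ring
    refine ⟨c ^ 3 * quartetForm S x, mul_ne_zero (pow_ne_zero _ hc) h0, ?_⟩
    intro s α hα0 hα
    simp only [if_neg h0, pow_zero, div_one, one_mul]
    rw [← hmul]
    have hcont : ∀ i, Tendsto (α i) (𝓝[≠] 0) (𝓝 (c * x i)) := fun i => by
      rw [← hα0]
      exact (hα i).continuousAt.tendsto.mono_left nhdsWithin_le_nhds
    have hq : Continuous fun y : ι → ℂ => quartetForm S y := by
      unfold quartetForm
      fun_prop
    exact (hq.tendsto _).comp (tendsto_pi_nhds.2 hcont)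

/-- Among `n` antipodal pairs of points on a circle, the degenerate quartets are the unions of two
pairs. -/
lemma card_degenerate_quartets {n : ℕ} {x : Fin (n + n) → ℂ} (hinj : Function.Injective x)
    (hnorm : ∀ i j, ‖x i‖ = ‖x j‖) (hneg : ∀ k, x (Fin.natAdd n k) = -x (Fin.castAdd n k)) :
    (((Finset.univ : Finset (Fin (n + n))).powersetCard 4).filter
      fun S => quartetForm S x = 0).card = n.choose 2 := by
  classical
  set g : Finset (Fin n) → Finset (Fin (n + n)) := fun A =>
    A.map (Fin.castAddEmb n) ∪ A.map (Fin.natAddEmb n) with hg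
  have hmem1 : ∀ A i, Fin.castAdd n i ∈ g A ↔ i ∈ A := by
    intro A i
    simp only [hg, Finset.mem_union, Finset.mem_map, Fin.castAddEmb_apply, Fin.natAddEmb_apply]
    constructor
    · rintro (⟨j, hj, h⟩ | ⟨j, hj, h⟩)
      · rwa [← Fin.castAdd_injective _ _ h]
      · exfalso
        have := congrArg Fin.val h
        simp at this
        omega
    · exact fun h => Or.inl ⟨i, h, rfl⟩
  have hmem2 : ∀ A i, Fin.natAdd n i ∈ g A ↔ i ∈ A := by
    intro A i
    simp only [hg, Finset.mem_union, Finset.mem_map, Fin.castAddEmb_apply, Fin.natAddEmb_apply]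
    constructor
    · rintro (⟨j, hj, h⟩ | ⟨j, hj, h⟩)
      · exfalso
        have := congrArg Fin.val h
        simp at this
        omega
      · rwa [← Fin.natAdd_injective _ _ h]
    · exact fun h => Or.inr ⟨i, h, rfl⟩
  have hginj : Function.Injective g := fun A B h => by
    ext i
    rw [← hmem1 A, h, hmem1]
  have hne : ∀ i j, Fin.castAdd n i ≠ Fin.natAdd n j := by
    intro i j h
    have := congrArg Fin.val h
    simp at this
    omega
  have hgpair : ∀ i j, g {i, j} =
      {Fin.castAdd n i, Fin.natAdd n i, Fin.castAdd n j, Fin.natAdd n j} := by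
    intro i j
    ext q
    simp [hg]
    tauto
  have hanti : ∀ a b, x a + x b = 0 → ∃ i, (a = Fin.castAdd n i ∧ b = Fin.natAdd n i) ∨
      (a = Fin.natAdd n i ∧ b = Fin.castAdd n i) := by
    intro a b h
    induction a using Fin.addCases with
    | left i =>
      refine ⟨i, Or.inl ⟨rfl, hinj ?_⟩⟩
      rw [hneg]
      linear_combination h
    | right i =>
      refine ⟨i, Or.inr ⟨rfl, hinj ?_⟩⟩
      rw [hneg] at h
      linear_combination h
  rw [← (by simp : ((Finset.univ : Finset (Fin n)).powersetCard 2).card = n.choose 2),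
    ← Finset.card_image_of_injective _ hginj]
  congr 1
  ext S
  rw [Finset.mem_filter, Finset.mem_powersetCard, Finset.mem_image]
  constructor
  · rintro ⟨⟨-, hS⟩, h0⟩
    obtain ⟨a, b, c, e, hab, hac, hae, hbc, hbe, hce, rfl, hrel⟩ :=
      exists_relation_of_quartetForm_eq_zero hS h0
    have h1 : x a + x b = 0 := add_eq_zero_of_norm_eq (hnorm _ _) (hnorm _ _) (hnorm _ _) hrel
      (hinj.ne hac) (hinj.ne hae)
    have h2 : x c + x e = 0 := by rw [← hrel, h1]
    obtain ⟨i, hi⟩ := hanti a b h1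
    obtain ⟨j, hj⟩ := hanti c e h2
    refine ⟨{i, j}, ?_, ?_⟩
    · rw [Finset.mem_powersetCard]
      refine ⟨Finset.subset_univ _, Finset.card_pair ?_⟩
      rintro rfl
      rcases hi with ⟨rfl, rfl⟩ | ⟨rfl, rfl⟩ <;> rcases hj with ⟨rfl, rfl⟩ | ⟨rfl, rfl⟩ <;>
        simp at *
    · rw [hgpair]
      rcases hi with ⟨rfl, rfl⟩ | ⟨rfl, rfl⟩ <;> rcases hj with ⟨rfl, rfl⟩ | ⟨rfl, rfl⟩ <;>
        (ext q; simp; try tauto)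
  · rintro ⟨A, hA, rfl⟩
    obtain ⟨i, j, hij, rfl⟩ := Finset.card_eq_two.1 (Finset.mem_powersetCard.1 hA).2
    have hij1 : Fin.castAdd n i ≠ Fin.castAdd n j := fun h => hij (Fin.castAdd_injective _ _ h)
    have hij2 : Fin.natAdd n i ≠ Fin.natAdd n j := fun h => hij (Fin.natAdd_injective _ _ h)
    rw [hgpair]
    refine ⟨⟨Finset.subset_univ _, card_quartet (hne _ _) hij1 (hne _ _) (hne _ _).symm hij2
      (hne _ _)⟩, quartetForm_eq_zero_of_relation (hne _ _) hij1 (hne _ _) (hne _ _).symm hij2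
      (hne _ _) ?_⟩
    rw [hneg, hneg]
    ring

/-- The leading behaviour of the product: each of the `n choose 2` degenerate quartets contributes
one factor of `s * t`. -/
lemma exists_tendsto_stokesForm {n : ℕ} {x : Fin (n + n) → ℂ} (hinj : Function.Injective x)
    (hnorm : ∀ i j, ‖x i‖ = ‖x j‖) (hneg : ∀ k, x (Fin.natAdd n k) = -x (Fin.castAdd n k))
    {c : ℂ} (hc : c ≠ 0) : ∃ K : ℂ, K ≠ 0 ∧ ∀ (s : ℂ) (α : Fin (n + n) → ℂ → ℂ),
      (∀ i, α i 0 = c * x i) → (∀ i, HasDerivAt (α i) (s * x i ^ 2) 0) →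
      Tendsto (fun t => stokesForm (fun i => α i t) / t ^ n.choose 2)
        (𝓝[≠] 0) (𝓝 (s ^ n.choose 2 * K)) := by
  classical
  have h1 : ∀ S : Finset (Fin (n + n)), ∃ K : ℂ, S.card = 4 →
      (K ≠ 0 ∧ ∀ (s : ℂ) (α : Fin (n + n) → ℂ → ℂ),
      (∀ i, α i 0 = c * x i) → (∀ i, HasDerivAt (α i) (s * x i ^ 2) 0) →
      Tendsto (fun t => quartetForm S (fun i => α i t) / t ^ (if quartetForm S x = 0 then 1 else 0))
        (𝓝[≠] 0) (𝓝 (s ^ (if quartetForm S x = 0 then 1 else 0) * K))) := by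
    intro S
    by_cases hS : S.card = 4
    · obtain ⟨K, hK⟩ := exists_tendsto_quartetForm hinj hnorm hc hS
      exact ⟨K, fun _ => hK⟩
    · exact ⟨0, fun h => absurd h hS⟩
  choose K hK using h1
  have hcard : ∀ S ∈ (Finset.univ : Finset (Fin (n + n))).powersetCard 4, S.card = 4 :=
    fun S hS => (Finset.mem_powersetCard.1 hS).2
  -- the powers of `t` add up to the number of degenerate quartets
  have hsum : ∑ S ∈ (Finset.univ : Finset (Fin (n + n))).powersetCard 4,
      (if quartetForm S x = 0 then 1 else 0) = n.choose 2 := by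
    rw [← card_degenerate_quartets hinj hnorm hneg, Finset.card_filter]
  refine ⟨∏ S ∈ (Finset.univ : Finset (Fin (n + n))).powersetCard 4, K S,
    Finset.prod_ne_zero_iff.2 fun S hS => (hK S (hcard S hS)).1, fun s α hα0 hα => ?_⟩
  have h2 := tendsto_finsetProd ((Finset.univ : Finset (Fin (n + n))).powersetCard 4)
    fun S hS => (hK S (hcard S hS)).2 s α hα0 hα
  rw [Finset.prod_mul_distrib, Finset.prod_pow_eq_pow_sum, hsum] at h2
  refine h2.congr fun t => ?_
  rw [Finset.prod_div_distrib, Finset.prod_pow_eq_pow_sum, hsum]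
  rfl

end DegenerateQuartets

/-! ### Leading behaviour along lines -/

section LineLimits

open Polynomial

lemma defPoly_reducedParam_zero {d : ℕ} (hd : 1 < d) (v : Fin d → ℂ) :
    defPoly (reducedParam v 0) = X ^ (d + 1) + C ((defPoly v).coeff 1) * X := by
  refine Polynomial.funext fun z => ?_
  rw [eval_defPoly, monomialDeformation, Finset.sum_eq_single ⟨1, hd⟩]
  · simp [reducedParam, coeff_defPoly_of_lt v hd]
  · intro j _ hj
    have hj1 : (j : ℕ) ≠ 1 := fun h => hj (Fin.ext h)
    unfold reducedParam
    split_ifs with h0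
    · simp
    · rw [zero_pow (by omega), zero_mul, zero_mul]
  · simp

lemma hasDerivAt_reducedParam {d : ℕ} (v : Fin d → ℂ) :
    HasDerivAt (reducedParam v) (fun j => if (j : ℕ) = 2 then v j else 0) 0 := by
  rw [hasDerivAt_pi]
  intro j
  unfold reducedParam
  by_cases h0 : (j : ℕ) = 0
  · simpa [h0] using hasDerivAt_const (0 : ℂ) (0 : ℂ)
  · simp only [if_neg h0]
    refine ((hasDerivAt_pow ((j : ℕ) - 1) (0 : ℂ)).mul_const (v j)).congr_deriv ?_
    split_ifs with h2
    · simp [h2]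
    · rcases Nat.eq_zero_or_pos ((j : ℕ) - 1) with h1 | h1
      · simp [h1]
      · rw [zero_pow (by omega)]
        simp

/-- The solutions of `(d + 1) z ^ d + a = 0` for `d = n + n`, ordered in antipodal pairs. -/
lemma exists_antipodal_roots {n : ℕ} (hn : 0 < n) {a : ℂ} (ha : a ≠ 0) :
    ∃ x : Fin (n + n) → ℂ, Function.Injective x ∧ (∀ i j, ‖x i‖ = ‖x j‖) ∧
      (∀ k, x (Fin.natAdd n k) = -x (Fin.castAdd n k)) ∧
      ∀ i, (((n + n : ℕ) : ℂ) + 1) * x i ^ (n + n) + a = 0 := by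
  have hd : 0 < n + n := by omega
  have h1 : (((n + n : ℕ) : ℂ) + 1) ≠ 0 := natCast_add_one_ne_zero' _
  obtain ⟨c, hc⟩ := IsAlgClosed.exists_pow_nat_eq (-a / (((n + n : ℕ) : ℂ) + 1)) hd
  have hc0 : c ≠ 0 := by
    rintro rfl
    rw [zero_pow hd.ne', eq_comm, div_eq_zero_iff] at hc
    rcases hc with hc | hc
    · exact ha (neg_eq_zero.1 hc)
    · exact h1 hc
  have hζ := Complex.isPrimitiveRoot_exp (n + n) hd.ne'
  set ζ := Complex.exp (2 * Real.pi * Complex.I / (n + n : ℕ))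
  have hζn : ζ ^ n = -1 := by
    have h2 : ζ ^ n * ζ ^ n = 1 := by rw [← pow_add, hζ.pow_eq_one]
    refine (mul_self_eq_one_iff.1 h2).resolve_left fun h3 => ?_
    exact hζ.pow_ne_one_of_pos_of_lt hn.ne' (by omega) h3
  have hζ1 : ‖ζ‖ = 1 := hζ.norm'_eq_one hd.ne'
  refine ⟨fun i => c * ζ ^ (i : ℕ), fun i j hij => ?_, fun i j => ?_, fun k => ?_, fun i => ?_⟩
  · exact Fin.ext (hζ.pow_inj i.2 j.2 (mul_left_cancel₀ hc0 hij))
  · simp [hζ1]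
  · simp only [Fin.val_natAdd, Fin.val_castAdd, pow_add, hζn]
    ring
  · rw [mul_pow, hc, ← pow_mul, mul_comm (i : ℕ), pow_mul, hζ.pow_eq_one, one_pow]
    field_simp
    ring

/-- The leading behaviour of the polynomial along a rescaled line. For `t = 0` the rescaled function
is `z ^ (d + 1) + a z` with `a` the linear coefficient of the perturbation. Its critical points are
the vertices of a regular polygon centred at the origin if `a` is not zero; the critical values are
proportional to them. The quadratic coefficient moves the critical values to first order in `t`. -/
theorem IsStokesPoly.exists_tendsto_reducedParam {n : ℕ} (hn : 0 < n)
    {p : MvPolynomial (Fin (n + n)) ℂ} (hp : IsStokesPoly p) (v : Fin (n + n) → ℂ) :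
    ∃ l : ℂ, Tendsto (fun t => MvPolynomial.eval (reducedParam v t) p / t ^ n.choose 2)
      (𝓝[≠] 0) (𝓝 l) ∧ (n = 1 → l ≠ 0) ∧
      (2 ≤ n → (l ≠ 0 ↔ (defPoly v).coeff 1 ≠ 0 ∧ (defPoly v).coeff 2 ≠ 0)) := by
  rcases (Nat.succ_le_of_lt hn).eq_or_lt with rfl | hn2
  · refine ⟨1, ?_, fun _ => one_ne_zero, fun h => by omega⟩
    refine tendsto_const_nhds.congr fun t => ?_
    obtain ⟨x, hx⟩ := exists_isCriticalVector (reducedParam v t)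
    rw [hp _ _ hx, stokesForm, Finset.powersetCard_eq_empty.2 (by simp)]
    simp
  have hn2' : 2 ≤ n := hn2
  have hd : 2 < n + n := by omega
  by_cases hv1 : (defPoly v).coeff 1 = 0
  · refine ⟨0, hp.tendsto_of_coeff_one_eq_zero hv1 ?_, fun h => by omega, fun _ => by simp [hv1]⟩
    have h1 : n.choose 2 ≤ (n + n).choose 4 := by
      have h2 : n.choose 2 ≤ (n + 2).choose 4 := by
        have h3 : (n + 2).choose 4 = (n + 1).choose 3 + (n + 1).choose 4 :=
          Nat.choose_succ_succ (n + 1) 3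
        have h4 : (n + 1).choose 3 = n.choose 2 + n.choose 3 := Nat.choose_succ_succ n 2
        omega
      exact h2.trans (Nat.choose_le_choose 4 (by omega))
    have h2 : 0 < (n + n).choose 4 := Nat.choose_pos (by omega)
    omega
  obtain ⟨x, hinj, hnorm, hneg, hroot⟩ := exists_antipodal_roots hn hv1
  have hx : IsCriticalVector (reducedParam v 0) x := by
    refine .of_injective hinj fun i => ?_
    rw [defPoly_reducedParam_zero (by omega)]
    have := hroot i
    simpa [derivative_X_pow] using this
  have hd1 : (((n + n : ℕ) : ℂ) + 1) ≠ 0 := natCast_add_one_ne_zero' _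
  set c : ℂ := (defPoly v).coeff 1 * (n + n : ℕ) / (((n + n : ℕ) : ℂ) + 1) with hc
  have hc0 : c ≠ 0 :=
    div_ne_zero (mul_ne_zero hv1 (Nat.cast_ne_zero.2 (by omega))) hd1
  obtain ⟨K, hK0, hK⟩ := exists_tendsto_stokesForm hinj hnorm hneg hc0
  obtain ⟨A, hA0, hAd, hAp⟩ := exists_local_critical_values hx hinj
  have hder := hasDerivAt_reducedParam v
  have hlim := hK ((defPoly v).coeff 2) (fun i t => A i (reducedParam v t)) (fun i => by
    rw [hA0, ← eval_defPoly, defPoly_reducedParam_zero (by omega)]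
    have h1 := hroot i
    simp only [eval_add, eval_pow, eval_X, eval_mul, eval_C]
    have h2 : x i ^ (n + n) = -(defPoly v).coeff 1 / (((n + n : ℕ) : ℂ) + 1) := by
      rw [eq_div_iff hd1]
      linear_combination h1
    rw [pow_succ, h2, hc]
    field_simp
    ring) (fun i => by
    refine ((hAd i).comp_hasDerivAt 0 hder).congr_deriv ?_
    rw [_root_.sum_apply, Finset.sum_eq_single ⟨2, hd⟩]
    · simp [coeff_defPoly_of_lt v hd]
      ring
    · intro j _ hj
      have : (j : ℕ) ≠ 2 := fun h => hj (Fin.ext h)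
      simp [this]
    · simp)
  refine ⟨_, hlim.congr' ?_, fun h => by omega, fun _ => ?_⟩
  · have h1 := hder.continuousAt.tendsto.eventually hAp
    filter_upwards [nhdsWithin_le_nhds h1] with t ht
    rw [ht p hp]
  · have h3 : n.choose 2 ≠ 0 := (Nat.choose_pos hn2').ne'
    simp [hK0, hv1, h3]

/-- Limits at `0` may be tested along the `d`-th power map, which is surjective. -/
lemma tendsto_of_tendsto_pow {d : ℕ} (hd : 0 < d) {h : ℂ → ℂ} {l : Filter ℂ}
    (hl : Tendsto (fun t => h (t ^ d)) (𝓝[≠] 0) l) : Tendsto h (𝓝[≠] 0) l := by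
  intro s hs
  have h1 := hl hs
  rw [mem_map, Metric.mem_nhdsWithin_iff] at h1
  obtain ⟨δ, hδ, h2⟩ := h1
  rw [mem_map, Metric.mem_nhdsWithin_iff]
  refine ⟨δ ^ d, pow_pos hδ d, ?_⟩
  rintro ε ⟨hε, hε0⟩
  obtain ⟨t, rfl⟩ := IsAlgClosed.exists_pow_nat_eq ε hd
  refine h2 (a := t) ⟨?_, ?_⟩
  · rw [mem_ball_zero_iff, norm_pow] at hε
    rw [mem_ball_zero_iff]
    exact lt_of_pow_lt_pow_left₀ d hδ.le hε
  · rintro rfl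
    exact hε0 (zero_pow hd.ne')

/-- The leading behaviour of the polynomial along the lines through the origin: the order is at
least `m`, and which lines realize it. -/
theorem IsStokesPoly.exists_tendsto_smul {n m : ℕ} (hn : 0 < n)
    (hm : (n + n) * m = (n + n + 1) * (3 * (n + n).choose 4) + n.choose 2)
    {p : MvPolynomial (Fin (n + n)) ℂ} (hp : IsStokesPoly p) (v : Fin (n + n) → ℂ) :
    ∃ l : ℂ, Tendsto (fun t : ℂ => MvPolynomial.eval (t • v) p / t ^ m) (𝓝[≠] 0) (𝓝 l) ∧
      (n = 1 → l ≠ 0) ∧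
      (2 ≤ n → (l ≠ 0 ↔ (defPoly v).coeff 1 ≠ 0 ∧ (defPoly v).coeff 2 ≠ 0)) := by
  obtain ⟨l, hl, h1, h2⟩ := hp.exists_tendsto_reducedParam hn v
  refine ⟨l, tendsto_of_tendsto_pow (d := n + n) (by omega) (hl.congr' ?_), h1, h2⟩
  filter_upwards [self_mem_nhdsWithin] with t ht
  have ht0 : t ≠ 0 := ht
  rw [hp.eval_smul_pow v ht0, ← pow_mul, hm, pow_add]
  field_simp

/-- Linear perturbations have `n` pairs of opposite critical values. -/
theorem IsStokesPoly.eval_smul_eq_zero {n : ℕ} (hn : 2 ≤ n) {p : MvPolynomial (Fin (n + n)) ℂ}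
    (hp : IsStokesPoly p) {v : Fin (n + n) → ℂ} (hv : ∀ j : Fin (n + n), 2 ≤ (j : ℕ) → v j = 0)
    (ε : ℂ) : MvPolynomial.eval (ε • v) p = 0 := by
  have hred : ∀ t, reducedParam v t = reducedParam v 0 := by
    intro t
    funext j
    unfold reducedParam
    rcases le_or_gt 2 (j : ℕ) with h | h
    · simp [hv j h]
    · split_ifs with h0
      · rfl
      · rw [show (j : ℕ) - 1 = 0 by omega, pow_zero, pow_zero]
  obtain ⟨l, hl, -, h2⟩ := hp.exists_tendsto_reducedParam (by omega : 0 < n) v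
  have hl0 : l = 0 := by
    by_contra h
    refine ((h2 hn).1 h).2 ?_
    rw [coeff_defPoly_of_lt v (by omega)]
    exact hv _ le_rfl
  have h3 : MvPolynomial.eval (reducedParam v 0) p = 0 := by
    have hpow : Tendsto (fun t : ℂ => t ^ n.choose 2) (𝓝[≠] 0) (𝓝 (0 ^ n.choose 2)) :=
      ((continuous_pow _).tendsto 0).mono_left nhdsWithin_le_nhds
    have h4 := hl.mul hpow
    rw [hl0, zero_mul] at h4
    refine tendsto_nhds_unique (tendsto_const_nhds.congr' ?_) h4
    filter_upwards [self_mem_nhdsWithin] with t ht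
    have ht0 : t ≠ 0 := ht
    rw [hred t]
    field_simp
  have h5 : ∀ t : ℂ, t ≠ 0 → MvPolynomial.eval (t • v) p = 0 := by
    intro t ht
    obtain ⟨s, rfl⟩ := IsAlgClosed.exists_pow_nat_eq t (by omega : 0 < n + n)
    have hs : s ≠ 0 := by
      rintro rfl
      exact ht (zero_pow (by omega))
    rw [hp.eval_smul_pow v hs, hred, h3, mul_zero]
  by_cases hε : ε = 0
  · have hcont : Continuous fun t : ℂ => MvPolynomial.eval (t • v) p :=
      (MvPolynomial.continuous_eval p).comp (by fun_prop)
    have h6 : Tendsto (fun t : ℂ => MvPolynomial.eval (t • v) p) (𝓝[≠] 0)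
        (𝓝 (MvPolynomial.eval ((0 : ℂ) • v) p)) :=
      (hcont.tendsto 0).mono_left nhdsWithin_le_nhds
    rw [hε]
    refine tendsto_nhds_unique h6 (tendsto_const_nhds.congr' ?_)
    filter_upwards [self_mem_nhdsWithin] with t ht
    rw [h5 t ht]
  · exact h5 ε hε

end LineLimits

/-! ### Banach spaces of holomorphic functions on a disc -/

section DiscFunctions

open Metric

variable {E F : Type*} [NormedAddCommGroup E] [NormedSpace ℂ E] [NormedAddCommGroup F]
  [NormedSpace ℂ F]

/-- The maps from the closed disc of radius `ρ` to `E` that are continuous, and holomorphic in the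
open disc, with the supremum norm. Holomorphy is expressed through some extension to `ℂ`. -/
def discFun (ρ : ℝ) (E : Type*) [NormedAddCommGroup E] [NormedSpace ℂ E] :
    Submodule ℂ C(closedBall (0 : ℂ) ρ, E) where
  carrier := {f | ∃ g : ℂ → E, DifferentiableOn ℂ g (ball 0 ρ) ∧ ∀ z, f z = g z}
  add_mem' := by
    rintro f₁ f₂ ⟨g₁, h₁, e₁⟩ ⟨g₂, h₂, e₂⟩
    exact ⟨g₁ + g₂, h₁.add h₂, fun z => by simp [e₁, e₂]⟩
  zero_mem' := ⟨0, differentiableOn_const _, fun z => rfl⟩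
  smul_mem' := by
    rintro c f ⟨g, h, e⟩
    exact ⟨c • g, h.const_smul c, fun z => by simp [e]⟩

/-- A map that is continuous on the closed disc and holomorphic inside, as a point of `discFun`. -/
def discFun.mk {ρ : ℝ} (g : ℂ → E) (hc : ContinuousOn g (closedBall 0 ρ))
    (hd : DifferentiableOn ℂ g (ball 0 ρ)) : discFun ρ E :=
  ⟨⟨(closedBall (0 : ℂ) ρ).domRestrict g,
    continuousOn_iff_continuous_domRestrict.1 hc⟩, g, hd,
    fun _ => rfl⟩

@[simp]
lemma discFun.mk_apply {ρ : ℝ} (g : ℂ → E) (hc : ContinuousOn g (closedBall 0 ρ))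
    (hd : DifferentiableOn ℂ g (ball 0 ρ)) (z : closedBall (0 : ℂ) ρ) :
    (discFun.mk g hc hd).1 z = g z := rfl

lemma discFun.exists_eq_mk {ρ : ℝ} (f : discFun ρ E) :
    ∃ g hc hd, f = discFun.mk g hc hd := by
  obtain ⟨g, hd, hg⟩ := f.2
  refine ⟨g, ?_, hd, ?_⟩
  · rw [continuousOn_iff_continuous_domRestrict]
    exact f.1.continuous.congr hg
  · exact Subtype.ext (ContinuousMap.ext hg)

lemma discFun.ext_apply {ρ : ℝ} {f g : discFun ρ E} (h : ∀ z, f.1 z = g.1 z) : f = g :=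
  Subtype.ext (ContinuousMap.ext h)

lemma discFun.norm_apply_le {ρ : ℝ} (f : discFun ρ E) (z : closedBall (0 : ℂ) ρ) :
    ‖f.1 z‖ ≤ ‖f‖ :=
  f.1.norm_coe_le_norm z

lemma discFun.norm_le {ρ : ℝ} (f : discFun ρ E) {C : ℝ} (hC : 0 ≤ C) (h : ∀ z, ‖f.1 z‖ ≤ C) :
    ‖f‖ ≤ C :=
  (ContinuousMap.norm_le f.1 hC).2 h

/-- Evaluation at a point of the disc. -/
noncomputable def discFun.evalCLM {ρ : ℝ} (z : closedBall (0 : ℂ) ρ) : discFun ρ E →L[ℂ] E :=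
  (ContinuousMap.evalCLM ℂ z).comp (discFun ρ E).subtypeL

@[simp]
lemma discFun.evalCLM_apply {ρ : ℝ} (z : closedBall (0 : ℂ) ρ) (f : discFun ρ E) :
    discFun.evalCLM z f = f.1 z := rfl

lemma isClosed_discFun [CompleteSpace E] (ρ : ℝ) :
    IsClosed (discFun ρ E : Set C(closedBall (0 : ℂ) ρ, E)) := by
  classical
  refine isClosed_of_closure_subset fun f hf => ?_
  obtain ⟨u, hu, hlim⟩ := mem_closure_iff_seq_limit.1 hf
  choose g hg hgu using hu
  set G : ℂ → E := fun z => if h : z ∈ closedBall (0 : ℂ) ρ then f ⟨z, h⟩ else 0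
  refine ⟨G, ?_, fun z => (show G z = f z from dif_pos z.2).symm⟩
  have hunif : TendstoUniformlyOn g G atTop (ball 0 ρ) := by
    rw [Metric.tendstoUniformlyOn_iff]
    intro ε hε
    filter_upwards [(Metric.tendsto_nhds.1 hlim) ε hε] with n hn z hz
    have hz' : z ∈ closedBall (0 : ℂ) ρ := ball_subset_closedBall hz
    have h1 : G z = f ⟨z, hz'⟩ := by simp only [G, dif_pos hz']
    rw [h1, ← hgu n ⟨z, hz'⟩, dist_comm]
    exact (ContinuousMap.dist_apply_le_dist _).trans_lt hn
  exact hunif.tendstoLocallyUniformlyOn.differentiableOn (.of_forall hg) isOpen_ball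

instance [CompleteSpace E] (ρ : ℝ) : CompleteSpace (discFun ρ E) :=
  (isClosed_discFun ρ).completeSpace_coe

/-- A continuous multilinear map, applied pointwise to functions on the disc. -/
noncomputable def discMultilinear (ρ : ℝ) {n : ℕ} (p : E [×n]→L[ℂ] F) :
    (discFun ρ E) [×n]→L[ℂ] (discFun ρ F) :=
  MultilinearMap.mkContinuous
    { toFun := fun m => ⟨⟨fun z => p fun i => (m i).1 z, p.cont.comp
          (continuous_pi fun i => (m i).1.continuous)⟩, by
        choose g hg hm using fun i => (m i).2
        refine ⟨fun z => p fun i => g i z, ?_, fun z => ?_⟩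
        · have h1 : DifferentiableOn ℂ (fun z i => g i z) (ball 0 ρ) :=
            differentiableOn_pi.2 hg
          intro z hz
          exact (p.hasFDerivAt _).differentiableAt.comp_differentiableWithinAt z (h1 z hz)
        · simp only [ContinuousMap.coe_mk, hm]⟩
      map_update_add' := by
        intro _ m i x y
        refine discFun.ext_apply fun z => ?_
        have h : ∀ w : discFun ρ E, (fun j => (Function.update m i w j).1 z) =
            Function.update (fun j => (m j).1 z) i (w.1 z) := by
          intro w
          funext j
          rcases eq_or_ne j i with rfl | hj
          · simp
          · simp [hj]
        change p _ = p _ + p _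
        rw [h, h, h, ← p.map_update_add]
        rfl
      map_update_smul' := by
        intro _ m i c x
        refine discFun.ext_apply fun z => ?_
        have h : ∀ w : discFun ρ E, (fun j => (Function.update m i w j).1 z) =
            Function.update (fun j => (m j).1 z) i (w.1 z) := by
          intro w
          funext j
          rcases eq_or_ne j i with rfl | hj
          · simp
          · simp [hj]
        change p _ = c • p _
        rw [h, h, ← p.map_update_smul]
        rfl } ‖p‖ (fun m => discFun.norm_le _ (by positivity) fun z =>
      (p.le_opNorm _).trans (mul_le_mul_of_nonneg_left
        (Finset.prod_le_prod (fun _ _ => norm_nonneg _) fun i _ => discFun.norm_apply_le (m i) z)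
        (norm_nonneg p)))

lemma norm_discMultilinear_le (ρ : ℝ) {n : ℕ} (p : E [×n]→L[ℂ] F) :
    ‖discMultilinear ρ p‖ ≤ ‖p‖ :=
  MultilinearMap.mkContinuous_norm_le _ (norm_nonneg _) _

/-- Composition with a holomorphic germ `f` is an analytic operation on functions on a disc. -/
theorem exists_discFun_comp [CompleteSpace F] {f : E → F} (hf : AnalyticAt ℂ f 0) :
    ∃ R : ℝ, 0 < R ∧ (∀ y : E, ‖y‖ < R → AnalyticAt ℂ f y) ∧
      ∀ ρ : ℝ, ∃ G : discFun ρ E → discFun ρ F, ∀ u, ‖u‖ < R →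
        AnalyticAt ℂ G u ∧ ∀ z, (G u).1 z = f (u.1 z) := by
  obtain ⟨p, r, hp⟩ := hf
  obtain ⟨R, hR0, hRr⟩ := ENNReal.lt_iff_exists_nnreal_btwn.1 hp.r_pos
  have hR0' : 0 < R := by exact_mod_cast hR0
  have hmem : ∀ (x : E), ‖x‖ < R → x ∈ Metric.eball (0 : E) r := fun x hx =>
    Metric.eball_subset_eball hRr.le (by rw [Metric.eball_coe, mem_ball_zero_iff]; exact hx)
  refine ⟨R, hR0', fun y hy => hp.analyticAt_of_mem (hmem y hy), fun ρ => ?_⟩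
  set P : FormalMultilinearSeries ℂ (discFun ρ E) (discFun ρ F) :=
    fun n => discMultilinear ρ (p n) with hP
  have hrad : (R : ENNReal) ≤ P.radius := by
    obtain ⟨C, -, hC⟩ := p.norm_mul_pow_le_of_lt_radius (hRr.trans_le hp.r_le)
    refine P.le_radius_of_bound C fun n => (hC n).trans' ?_
    exact mul_le_mul_of_nonneg_right (norm_discMultilinear_le ρ (p n)) (by positivity)
  have hG := (P.hasFPowerSeriesOnBall (hR0.trans_le hrad)).mono hR0 hrad
  refine ⟨P.sum, fun u hu => ?_⟩
  have humem : u ∈ Metric.eball (0 : discFun ρ E) R := by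
    rw [Metric.eball_coe, mem_ball_zero_iff]; exact hu
  refine ⟨hG.analyticAt_of_mem humem, fun z => ?_⟩
  have h1 := (discFun.evalCLM z).hasSum (hG.hasSum humem)
  have h2 := hp.hasSum (hmem (u.1 z) ((discFun.norm_apply_le u z).trans_lt hu))
  rw [zero_add] at h1 h2
  exact h1.unique h2

/-- The pair of a function on the disc and a constant. -/
noncomputable def discPair (ρ : ℝ) (E F : Type*) [NormedAddCommGroup E] [NormedSpace ℂ E]
    [NormedAddCommGroup F] [NormedSpace ℂ F] : discFun ρ E × F →L[ℂ] discFun ρ (E × F) :=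
  LinearMap.mkContinuous
    { toFun := fun q => ⟨⟨fun z => (q.1.1 z, q.2), by fun_prop⟩, by
        obtain ⟨g, hg, h⟩ := q.1.2
        exact ⟨fun z => (g z, q.2), hg.prodMk (differentiableOn_const _), fun z => by
          simp only [ContinuousMap.coe_mk, h]⟩⟩
      map_add' := fun _ _ => rfl
      map_smul' := fun _ _ => rfl } 1 (fun q => discFun.norm_le _ (by positivity) fun z => by
    rw [one_mul]
    exact max_le_max (discFun.norm_apply_le q.1 z) le_rfl)

lemma norm_discPair_le (ρ : ℝ) (q : discFun ρ E × F) : ‖discPair ρ E F q‖ ≤ ‖q‖ :=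
  discFun.norm_le _ (norm_nonneg _) fun z => max_le_max (discFun.norm_apply_le q.1 z) le_rfl

end DiscFunctions

/-! ### Division by a power of the coordinate -/

section Division

open Metric

/-- A polynomial of degree less than `d` that is `O(z ^ d)` at `0` vanishes. -/
lemma eq_zero_of_norm_sum_le {d : ℕ} {a : Fin d → ℂ} {C : ℝ}
    (h : ∀ᶠ z in 𝓝[≠] (0 : ℂ), ‖∑ j : Fin d, a j * z ^ (j : ℕ)‖ ≤ C * ‖z‖ ^ d) : a = 0 := by
  rcases Nat.eq_zero_or_pos d with rfl | hd
  · exact Subsingleton.elim _ _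
  obtain ⟨m, rfl⟩ : ∃ m, d = m + 1 := ⟨d - 1, by omega⟩
  set q : Polynomial ℂ := ∑ j : Fin (m + 1), Polynomial.C (a j) * Polynomial.X ^ (j : ℕ) with hq
  have heval : ∀ z, q.eval z = ∑ j : Fin (m + 1), a j * z ^ (j : ℕ) := fun z => by
    simp [hq, Polynomial.eval_finsetSum]
  have hlim : Tendsto (fun t => q.eval t / t ^ m) (𝓝[≠] 0) (𝓝 0) := by
    refine squeeze_zero_norm' (a := fun t => C * ‖t‖) ?_ ?_
    · filter_upwards [h, self_mem_nhdsWithin] with t ht ht0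
      have ht0' : t ≠ 0 := ht0
      rw [heval, norm_div, norm_pow, div_le_iff₀ (pow_pos (norm_pos_iff.2 ht0') m)]
      rwa [mul_assoc, ← pow_succ']
    · have : Continuous fun t : ℂ => C * ‖t‖ := by fun_prop
      simpa using (this.tendsto 0).mono_left (nhdsWithin_le_nhds (s := {0}ᶜ))
  obtain ⟨h1, h2⟩ := coeff_of_tendsto_div_pow hlim
  funext j
  have h3 : q.coeff j = a j := by
    rw [hq, Polynomial.finsetSum_coeff, Finset.sum_eq_single j]
    · simp
    · intro i _ hij
      rw [Polynomial.coeff_C_mul_X_pow, if_neg fun h => hij (Fin.ext h.symm)]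
    · simp
  rw [← h3, Pi.zero_apply]
  rcases (Nat.lt_succ_iff.1 j.2).lt_or_eq with h4 | h4
  · exact h1 _ h4
  · rw [h4]; exact h2

lemma discFun.exists_eq_add_mul {ρ : ℝ} (hρ : 0 < ρ) (u : discFun ρ ℂ) :
    ∃ (c : ℂ) (h : discFun ρ ℂ), ∀ z, u.1 z = c + z * h.1 z := by
  obtain ⟨g, hc, hd, rfl⟩ := discFun.exists_eq_mk u
  have hnhds : ball (0 : ℂ) ρ ∈ 𝓝 0 := ball_mem_nhds _ hρ
  have hd0 : DifferentiableAt ℂ g 0 := (hd 0 (mem_ball_self hρ)).differentiableAt hnhds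
  refine ⟨g 0, discFun.mk (dslope g 0)
    ((continuousOn_dslope (closedBall_mem_nhds _ hρ)).2 ⟨hc, hd0⟩)
    ((Complex.differentiableOn_dslope hnhds).2 hd), fun z => ?_⟩
  have h1 := sub_smul_dslope g 0 z
  simp only [smul_eq_mul, sub_zero] at h1
  simp only [discFun.mk_apply]
  rw [h1]
  ring

/-- Division by `z ^ d` with remainder. -/
lemma discFun.exists_eq_pow_mul_add {ρ : ℝ} (hρ : 0 < ρ) (d : ℕ) (u : discFun ρ ℂ) :
    ∃ (h : discFun ρ ℂ) (a : Fin d → ℂ), ∀ z : closedBall (0 : ℂ) ρ,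
      u.1 z = (z : ℂ) ^ d * h.1 z + ∑ j, a j * (z : ℂ) ^ (j : ℕ) := by
  induction d with
  | zero => exact ⟨u, 0, fun z => by simp⟩
  | succ d ih =>
    obtain ⟨h, a, hu⟩ := ih
    obtain ⟨c, h', hh⟩ := discFun.exists_eq_add_mul hρ h
    refine ⟨h', Fin.snoc a c, fun z => ?_⟩
    rw [hu, hh, Fin.sum_univ_castSucc]
    simp only [Fin.snoc_castSucc, Fin.snoc_last, Fin.val_castSucc, Fin.val_last]
    ring

lemma discFun.eq_zero_of_pow_mul_add {ρ : ℝ} (hρ : 0 < ρ) {d : ℕ} {h : discFun ρ ℂ}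
    {a : Fin d → ℂ} (hu : ∀ z : closedBall (0 : ℂ) ρ,
      (z : ℂ) ^ d * h.1 z + ∑ j, a j * (z : ℂ) ^ (j : ℕ) = 0) : h = 0 ∧ a = 0 := by
  have hball : ∀ᶠ z in 𝓝[≠] (0 : ℂ), z ∈ closedBall (0 : ℂ) ρ :=
    nhdsWithin_le_nhds (closedBall_mem_nhds _ hρ)
  have ha : a = 0 := by
    refine eq_zero_of_norm_sum_le (C := ‖h‖) ?_
    filter_upwards [hball] with z hz
    have h1 := hu ⟨z, hz⟩
    rw [eq_neg_of_add_eq_zero_right h1, norm_neg, norm_mul, norm_pow, mul_comm]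
    exact mul_le_mul_of_nonneg_right (discFun.norm_apply_le h _) (by positivity)
  refine ⟨?_, ha⟩
  have h0 : ∀ z : closedBall (0 : ℂ) ρ, (z : ℂ) ≠ 0 → h.1 z = 0 := by
    intro z hz
    have h1 := hu z
    simp only [ha, Pi.zero_apply, zero_mul, Finset.sum_const_zero, add_zero] at h1
    exact (mul_eq_zero.1 h1).resolve_left (pow_ne_zero _ hz)
  obtain ⟨g, hc, hd, rfl⟩ := discFun.exists_eq_mk h
  refine discFun.ext_apply fun z => ?_
  by_cases hz : (z : ℂ) = 0
  · have hcont : ContinuousAt g 0 := hc.continuousAt (closedBall_mem_nhds _ hρ)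
    rw [discFun.mk_apply, hz]
    refine tendsto_nhds_unique (hcont.tendsto.mono_left (nhdsWithin_le_nhds (s := {0}ᶜ)))
      (tendsto_const_nhds.congr' ?_)
    filter_upwards [hball, self_mem_nhdsWithin] with w hw hw0
    exact (h0 ⟨w, hw⟩ hw0).symm
  · exact h0 z hz

end Division

/-! ### Versality of the monomial deformation -/

section Versality

open Metric

/-- The identity, as a function on the disc. -/
noncomputable def discId (ρ : ℝ) : discFun ρ ℂ := discFun.mk id continuousOn_id differentiableOn_id

lemma norm_discId_le {ρ : ℝ} (hρ : 0 ≤ ρ) : ‖discId ρ‖ ≤ ρ :=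
  discFun.norm_le _ hρ fun z => mem_closedBall_zero_iff.1 z.2

lemma analyticAt_monomialDeformation (d : ℕ) (q : ℂ × (Fin d → ℂ)) :
    AnalyticAt ℂ (fun p : ℂ × (Fin d → ℂ) => monomialDeformation d p.1 p.2) q := by
  unfold monomialDeformation
  have h1 : AnalyticAt ℂ (fun p : ℂ × (Fin d → ℂ) => p.1) q := analyticAt_fst
  have h2 : ∀ j : Fin d, AnalyticAt ℂ (fun p : ℂ × (Fin d → ℂ) => p.2 j) q := fun j =>
    ((ContinuousLinearMap.proj (R := ℂ) (φ := fun _ : Fin d => ℂ) j).comp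
      (ContinuousLinearMap.snd ℂ ℂ (Fin d → ℂ))).analyticAt q
  exact (h1.pow _).add (Finset.analyticAt_fun_sum _ fun j _ => (h2 j).mul (h1.pow _))

lemma hasFDerivAt_monomialDeformation_zero {d : ℕ} (z : ℂ) :
    HasFDerivAt (fun p : ℂ × (Fin d → ℂ) => monomialDeformation d p.1 p.2)
      ((((d : ℂ) + 1) * z ^ d) • ContinuousLinearMap.fst ℂ ℂ (Fin d → ℂ) +
        (∑ j : Fin d, (z ^ (j : ℕ)) • ContinuousLinearMap.proj (R := ℂ) (φ := fun _ => ℂ) j).comp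
          (ContinuousLinearMap.snd ℂ ℂ (Fin d → ℂ))) (z, 0) := by
  have h1 := (hasStrictFDerivAt_monomialDeformation z (0 : Fin d → ℂ)).hasFDerivAt
  have h2 : HasFDerivAt (fun p : ℂ × (Fin d → ℂ) => (p.2, p.1))
      ((ContinuousLinearMap.snd ℂ ℂ (Fin d → ℂ)).prod (ContinuousLinearMap.fst ℂ ℂ (Fin d → ℂ)))
      (z, 0) := hasFDerivAt_snd.prodMk hasFDerivAt_fst
  refine (HasFDerivAt.comp (z, (0 : Fin d → ℂ)) (g := fun p : (Fin d → ℂ) × ℂ =>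
    monomialDeformation d p.2 p.1) h1 h2).congr_fderiv ?_
  rw [show (Polynomial.derivative (defPoly (0 : Fin d → ℂ))).eval z = ((d : ℂ) + 1) * z ^ d by
    rw [eval_derivative_defPoly]; simp]
  ext q
  · simp
  · simp

/-- The monomial deformation induces every deformation: every deformation `F` of `z ^ (d + 1)` is
of the form `F (z, μ) = M (γ μ z, θ μ)` on a fixed disc, with `γ μ` close to the identity. Moreover
the differential of `θ` at `0` is the class of the differential of `F` modulo `z ^ d`. -/
theorem exists_eq_monomialDeformation {d k : ℕ} {F : ℂ → (Fin k → ℂ) → ℂ}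
    (hF : IsDeformation (fun z => z ^ (d + 1)) F) :
    ∃ ρ : ℝ, 0 < ρ ∧ ∃ (γ : (Fin k → ℂ) → ℂ → ℂ) (θ : (Fin k → ℂ) → Fin d → ℂ),
      AnalyticAt ℂ θ 0 ∧ θ 0 = 0 ∧
      (∀ᶠ μ in 𝓝 0, DifferentiableOn ℂ (γ μ) (ball 0 ρ) ∧
        ∀ z ∈ ball (0 : ℂ) ρ, F z μ = monomialDeformation d (γ μ z) (θ μ)) ∧
      (∀ δ > 0, ∀ᶠ μ in 𝓝 0, ∀ z ∈ ball (0 : ℂ) ρ, ‖γ μ z - z‖ ≤ δ) ∧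
      (∀ z ∈ ball (0 : ℂ) ρ, AnalyticAt ℂ (fun p : ℂ × (Fin k → ℂ) => F p.1 p.2) (z, 0) ∧
        F z 0 = z ^ (d + 1)) ∧
      ∀ v, ∃ C, ∀ z ∈ ball (0 : ℂ) ρ,
        ‖fderiv ℂ (fun μ => F z μ) 0 v - ∑ j, fderiv ℂ θ 0 v j * z ^ (j : ℕ)‖ ≤ C * ‖z‖ ^ d := by
  classical
  obtain ⟨hFa, hF0⟩ := hF
  obtain ⟨R₁, hR₁, hFR, hGF⟩ := exists_discFun_comp hFa
  obtain ⟨R₂, hR₂, -, hGM⟩ := exists_discFun_comp (analyticAt_monomialDeformation d 0)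
  obtain ⟨R₃, hR₃, hF0'⟩ := Metric.eventually_nhds_iff_ball.1 hF0
  -- a disc on which all the power series involved converge
  obtain ⟨ρ, hρ, hρlt⟩ := exists_between (lt_min hR₁ (lt_min hR₂ hR₃))
  obtain ⟨hρ1, hρ23⟩ := lt_min_iff.1 hρlt
  obtain ⟨hρ2, hρ3⟩ := lt_min_iff.1 hρ23
  obtain ⟨GF, hGF⟩ := hGF ρ
  obtain ⟨GM, hGM⟩ := hGM ρ
  have hpairlt : ∀ {l : ℕ} {R : ℝ}, ρ < R →
      ‖discPair ρ ℂ (Fin l → ℂ) (discId ρ, 0)‖ < R := by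
    intro l R hR
    refine ((norm_discPair_le ρ _).trans ?_).trans_lt hR
    rw [Prod.norm_mk, norm_zero]
    exact max_le (norm_discId_le hρ.le) hρ.le
  -- the operator `Φ (g, lam) = M (g, lam)` and its differential at `(id, 0)`
  set Φ : discFun ρ ℂ × (Fin d → ℂ) → discFun ρ ℂ := fun q => GM (discPair ρ ℂ (Fin d → ℂ) q)
    with hΦ
  set q₀ : discFun ρ ℂ × (Fin d → ℂ) := (discId ρ, 0) with hq₀
  have hΦa : AnalyticAt ℂ Φ q₀ := by
    refine AnalyticAt.comp (g := GM) (f := discPair ρ ℂ (Fin d → ℂ)) ?_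
      (ContinuousLinearMap.analyticAt _ _)
    exact (hGM _ (hpairlt hρ2)).1
  have hΦe : ∀ᶠ q in 𝓝 q₀, ∀ z, (Φ q).1 z = monomialDeformation d (q.1.1 z) q.2 := by
    have h1 : ∀ᶠ q in 𝓝 q₀, ‖discPair ρ ℂ (Fin d → ℂ) q‖ < R₂ :=
      (discPair ρ ℂ (Fin d → ℂ)).continuous.norm.continuousAt.eventually_lt continuousAt_const
        (hpairlt hρ2)
    filter_upwards [h1] with q hq z
    rw [hΦ, (hGM _ hq).2 z]
    rfl
  set D := fderiv ℂ Φ q₀ with hD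
  have hΦd : HasFDerivAt Φ D q₀ := hΦa.differentiableAt.hasFDerivAt
  have hDe : ∀ q z, (D q).1 z = ((d : ℂ) + 1) * (z : ℂ) ^ d * q.1.1 z +
      ∑ j, q.2 j * (z : ℂ) ^ (j : ℕ) := by
    intro q z
    have h1 := (discFun.evalCLM (E := ℂ) z).hasFDerivAt.comp q₀ hΦd
    have h2 : HasFDerivAt (fun q : discFun ρ ℂ × (Fin d → ℂ) =>
        ((discFun.evalCLM z : discFun ρ ℂ →L[ℂ] ℂ) q.1, q.2)) _ q₀ :=
      (((discFun.evalCLM z : discFun ρ ℂ →L[ℂ] ℂ).comp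
        (ContinuousLinearMap.fst ℂ (discFun ρ ℂ) (Fin d → ℂ))).prod
        (ContinuousLinearMap.snd ℂ (discFun ρ ℂ) (Fin d → ℂ))).hasFDerivAt
    have h3 := HasFDerivAt.comp q₀ (hasFDerivAt_monomialDeformation_zero (d := d) (z : ℂ)) h2
    have h4 := h3.congr_of_eventuallyEq (hΦe.mono fun q hq => hq z)
    have h5 := congrArg (fun L => L q) (h1.unique h4)
    simp only [ContinuousLinearMap.comp_apply, discFun.evalCLM_apply] at h5
    rw [h5]
    simp [mul_comm]
  have hd1 : (d : ℂ) + 1 ≠ 0 := natCast_add_one_ne_zero' d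
  -- division with remainder by `z ^ d` says that the differential is invertible
  have hinj : D.ker = ⊥ := by
    rw [LinearMap.ker_eq_bot']
    intro q hq
    have h1 : ∀ z : closedBall (0 : ℂ) ρ,
        (z : ℂ) ^ d * ((((d : ℂ) + 1) • q.1 : discFun ρ ℂ)).1 z +
          ∑ j, q.2 j * (z : ℂ) ^ (j : ℕ) = 0 := by
      intro z
      have h2 := hDe q z
      rw [show D q = 0 from hq] at h2
      have h3 : ((((d : ℂ) + 1) • q.1 : discFun ρ ℂ)).1 z = ((d : ℂ) + 1) * q.1.1 z := rfl
      rw [h3]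
      have h4 : ((0 : discFun ρ ℂ)).1 z = 0 := rfl
      rw [h4] at h2
      linear_combination -h2
    obtain ⟨h2, h3⟩ := discFun.eq_zero_of_pow_mul_add hρ h1
    exact Prod.ext ((smul_eq_zero.1 h2).resolve_left hd1) h3
  have hsurj : D.range = ⊤ := by
    rw [LinearMap.range_eq_top]
    intro u
    obtain ⟨h, a, hu⟩ := discFun.exists_eq_pow_mul_add hρ d u
    refine ⟨(((d : ℂ) + 1)⁻¹ • h, a), discFun.ext_apply fun z => ?_⟩
    refine (hDe _ z).trans ?_
    have h3 : ((((d : ℂ) + 1)⁻¹ • h : discFun ρ ℂ)).1 z = ((d : ℂ) + 1)⁻¹ * h.1 z := rfl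
    rw [hu, h3]
    field_simp
  set D' := ContinuousLinearEquiv.ofBijective D hinj hsurj with hD'
  have hΦc : ContDiffAt ℂ ⊤ Φ q₀ := hΦa.contDiffAt
  have hΦd' : HasFDerivAt Φ (D' : discFun ρ ℂ × (Fin d → ℂ) →L[ℂ] discFun ρ ℂ) q₀ := by
    rw [hD', ContinuousLinearEquiv.coe_ofBijective]
    exact hΦd
  have htop : (⊤ : WithTop ℕ∞) ≠ 0 := by simp
  set Ψ := hΦc.localInverse hΦd' htop with hΨ
  have hΨa : AnalyticAt ℂ Ψ (Φ q₀) :=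
    (hΦc.to_localInverse hΦd' htop).analyticAt
  have hΨq : Ψ (Φ q₀) = q₀ := hΦc.localInverse_apply_image hΦd' htop
  have hΨr : ∀ᶠ u in 𝓝 (Φ q₀), Φ (Ψ u) = u :=
    (hΦc.hasStrictFDerivAt' hΦd' htop).eventually_right_inverse
  -- the family `F (·, μ)` of functions on the disc
  set N : (Fin k → ℂ) → discFun ρ ℂ := fun μ => GF (discPair ρ ℂ (Fin k → ℂ) (discId ρ, μ))
    with hN
  have hNa : AnalyticAt ℂ N 0 := by
    refine AnalyticAt.comp (g := GF) (f := fun μ => discPair ρ ℂ (Fin k → ℂ) (discId ρ, μ))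
      (hGF _ (hpairlt hρ1)).1 ?_
    exact ((discPair ρ ℂ (Fin k → ℂ)).analyticAt _).comp (analyticAt_const.prod analyticAt_id)
  have hNe : ∀ᶠ μ in 𝓝 0, ∀ z, (N μ).1 z = F z μ := by
    have hc : Continuous fun μ : Fin k → ℂ => ‖discPair ρ ℂ (Fin k → ℂ) (discId ρ, μ)‖ := by
      fun_prop
    have h1 : ∀ᶠ μ in 𝓝 0, ‖discPair ρ ℂ (Fin k → ℂ) (discId ρ, μ)‖ < R₁ :=
      hc.continuousAt.eventually_lt continuousAt_const (hpairlt hρ1)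
    filter_upwards [h1] with μ hμ z
    rw [hN, (hGF _ hμ).2 z]
    rfl
  have hN0 : N 0 = Φ q₀ := by
    refine discFun.ext_apply fun z => ?_
    rw [hNe.self_of_nhds z, hΦe.self_of_nhds z]
    have hz : (z : ℂ) ∈ ball (0 : ℂ) R₃ := closedBall_subset_ball hρ3 z.2
    rw [hF0' z hz]
    simp [hq₀, monomialDeformation, discId]
  have hΓa : AnalyticAt ℂ (fun μ => Ψ (N μ)) 0 :=
    AnalyticAt.comp (g := Ψ) (by rw [hN0]; exact hΨa) hNa
  have hΓ0 : Ψ (N 0) = q₀ := by rw [hN0, hΨq]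
  have hΓΦ : ∀ᶠ μ in 𝓝 (0 : Fin k → ℂ), Φ (Ψ (N μ)) = N μ :=
    hNa.continuousAt.eventually (by rw [hN0]; exact hΨr)
  have hΓt : Tendsto (fun μ => Ψ (N μ)) (𝓝 0) (𝓝 q₀) := by
    have := hΓa.continuousAt.tendsto
    rwa [hΓ0] at this
  set γ : (Fin k → ℂ) → ℂ → ℂ := fun μ z =>
    if h : z ∈ closedBall (0 : ℂ) ρ then (Ψ (N μ)).1.1 ⟨z, h⟩ else 0 with hγ
  have hγe : ∀ μ z (h : z ∈ closedBall (0 : ℂ) ρ), γ μ z = (Ψ (N μ)).1.1 ⟨z, h⟩ :=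
    fun μ z h => dif_pos h
  have hbc : ∀ {z : ℂ}, z ∈ ball (0 : ℂ) ρ → z ∈ closedBall (0 : ℂ) ρ :=
    fun h => ball_subset_closedBall h
  have hθa : AnalyticAt ℂ (fun μ => (Ψ (N μ)).2) 0 :=
    ((ContinuousLinearMap.snd ℂ (discFun ρ ℂ) (Fin d → ℂ)).analyticAt _).comp hΓa
  refine ⟨ρ, hρ, γ, fun μ => (Ψ (N μ)).2, hθa, by simp only [hΓ0, hq₀], ?_, ?_, ?_, ?_⟩
  · filter_upwards [hΓΦ, hNe, hΓt.eventually hΦe] with μ h1 h2 h3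
    refine ⟨?_, fun z hz => ?_⟩
    · obtain ⟨g, hgc, hgd, hg⟩ := discFun.exists_eq_mk (Ψ (N μ)).1
      refine hgd.congr fun z hz => ?_
      rw [hγe μ z (hbc hz), hg, discFun.mk_apply]
    · have h4 := h3 ⟨z, hbc hz⟩
      rw [h1, h2] at h4
      rw [hγe μ z (hbc hz)]
      exact h4
  · intro δ hδ
    have h1 : Tendsto (fun μ => ‖(Ψ (N μ)).1 - discId ρ‖) (𝓝 0) (𝓝 0) := by
      have h2 : Tendsto (fun μ => (Ψ (N μ)).1) (𝓝 0) (𝓝 (discId ρ)) :=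
        (continuous_fst.tendsto q₀).comp hΓt
      exact tendsto_iff_norm_sub_tendsto_zero.1 h2
    filter_upwards [h1.eventually (gt_mem_nhds hδ)] with μ hμ z hz
    refine le_trans ?_ hμ.le
    rw [hγe μ z (hbc hz)]
    exact discFun.norm_apply_le ((Ψ (N μ)).1 - discId ρ) ⟨z, hbc hz⟩
  · intro z hz
    refine ⟨hFR _ ?_, hF0' z (ball_subset_ball hρ3.le hz)⟩
    rw [Prod.norm_mk, norm_zero]
    exact max_lt ((mem_ball_zero_iff.1 hz).trans hρ1) hR₁
  · intro v
    set w := fderiv ℂ (fun μ => Ψ (N μ)) 0 v with hw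
    refine ⟨‖(d : ℂ) + 1‖ * ‖w.1‖, fun z hz => ?_⟩
    have hΓd : HasFDerivAt (fun μ => Ψ (N μ)) (fderiv ℂ (fun μ => Ψ (N μ)) 0) 0 :=
      hΓa.differentiableAt.hasFDerivAt
    have hθd : fderiv ℂ (fun μ => (Ψ (N μ)).2) 0 v = w.2 := by
      have h1 := ((ContinuousLinearMap.snd ℂ (discFun ρ ℂ) (Fin d → ℂ)).hasFDerivAt.comp 0
        hΓd).fderiv
      exact congrArg (fun L => L v) h1
    have hFd : fderiv ℂ (fun μ => F z μ) 0 v = (D w).1 ⟨z, hbc hz⟩ := by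
      have h1 : HasFDerivAt Φ D (Ψ (N 0)) := by rw [hΓ0]; exact hΦd
      have h2 := (discFun.evalCLM (E := ℂ) ⟨z, hbc hz⟩).hasFDerivAt.comp 0 (h1.comp 0 hΓd)
      have h3 : (fun μ => F z μ) =ᶠ[𝓝 0]
          (discFun.evalCLM (E := ℂ) ⟨z, hbc hz⟩) ∘ (Φ ∘ fun μ => Ψ (N μ)) := by
        filter_upwards [hΓΦ, hNe] with μ h4 h5
        simp only [Function.comp_apply, discFun.evalCLM_apply]
        rw [h4, h5]
      have h6 := (h2.congr_of_eventuallyEq h3).fderiv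
      exact congrArg (fun L => L v) h6
    rw [hFd, hθd, hDe, add_sub_cancel_right, norm_mul, norm_mul, norm_pow]
    have := mul_le_mul_of_nonneg_left (discFun.norm_apply_le w.1 ⟨z, hbc hz⟩)
      (by positivity : 0 ≤ ‖(d : ℂ) + 1‖ * ‖z‖ ^ d)
    refine this.trans (le_of_eq ?_)
    ring

end Versality

/-! ### Transfer to versal deformations -/

section Transfer

open Metric

lemma isDeformation_monomialDeformation (d : ℕ) :
    IsDeformation (fun z => z ^ (d + 1)) (monomialDeformation d) :=
  ⟨analyticAt_monomialDeformation d 0, .of_forall fun z => by simp [monomialDeformation]⟩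

/-- If `F` is versal, the monomial deformation is in turn induced from `F`, and the differential of
the parameter change is a right inverse of the differential of `θ`. -/
lemma surjective_fderiv_of_isVersalDeformation {d k : ℕ} {F : ℂ → (Fin k → ℂ) → ℂ}
    (hF : IsVersalDeformation (fun z => z ^ (d + 1)) F) {ρ : ℝ} (hρ : 0 < ρ)
    {θ : (Fin k → ℂ) → Fin d → ℂ}
    (hFa : ∀ z ∈ ball (0 : ℂ) ρ, AnalyticAt ℂ (fun p : ℂ × (Fin k → ℂ) => F p.1 p.2) (z, 0) ∧
      F z 0 = z ^ (d + 1))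
    (hθ : ∀ v, ∃ C, ∀ z ∈ ball (0 : ℂ) ρ,
      ‖fderiv ℂ (fun μ => F z μ) 0 v - ∑ j, fderiv ℂ θ 0 v j * z ^ (j : ℕ)‖ ≤ C * ‖z‖ ^ d) :
    Function.Surjective (fderiv ℂ θ 0) := by
  intro w
  obtain ⟨g, τ, hg, hg0, hτ, hτ0, hM⟩ := hF.2 d _ (isDeformation_monomialDeformation d)
  set v := fderiv ℂ τ 0 w with hv
  obtain ⟨C, hC⟩ := hθ v
  refine ⟨v, ?_⟩
  set gp : ℂ × (Fin d → ℂ) → ℂ := fun p => g p.1 p.2 with hgp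
  set K : ℝ := ‖fderiv ℂ gp 0 (0, w)‖ + 1
  have hline : Tendsto (fun z : ℂ => (z, (0 : Fin d → ℂ))) (𝓝 0) (𝓝 0) := by
    have : Continuous fun z : ℂ => (z, (0 : Fin d → ℂ)) := by fun_prop
    exact this.tendsto 0
  have hK : ∀ᶠ z in 𝓝 (0 : ℂ), ‖fderiv ℂ gp (z, 0) (0, w)‖ ≤ K := by
    have h1 : ContinuousAt (fun p => ‖fderiv ℂ gp p (0, w)‖) 0 :=
      (hg.fderiv.continuousAt.clm_apply continuousAt_const).norm
    have h2 : ∀ᶠ p in 𝓝 (0 : ℂ × (Fin d → ℂ)), ‖fderiv ℂ gp p (0, w)‖ < K :=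
      h1.eventually_lt continuousAt_const (lt_add_one _)
    exact (hline.eventually h2).mono fun z hz => hz.le
  have hzero : w - fderiv ℂ θ 0 v = 0 := by
    refine eq_zero_of_norm_sum_le (C := ‖(d : ℂ) + 1‖ * K + C) (nhdsWithin_le_nhds ?_)
    filter_upwards [hK, hline.eventually hg.eventually_analyticAt, hg0, ball_mem_nhds 0 hρ,
      hline.eventually hM.eventually_nhds] with z hKz hgz hgz0 hzρ hMz
    set L := fderiv ℂ (fun p : ℂ × (Fin k → ℂ) => F p.1 p.2) (z, 0) with hL
    have hLd : HasFDerivAt (fun p : ℂ × (Fin k → ℂ) => F p.1 p.2) L (z, 0) :=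
      (hFa z hzρ).1.differentiableAt.hasFDerivAt
    have hpair : ∀ l : ℕ, HasFDerivAt (fun lam : Fin l → ℂ => (z, lam))
        (ContinuousLinearMap.inr ℂ ℂ (Fin l → ℂ)) 0 := fun l => hasFDerivAt_prodMk_right z 0
    -- the differential of `F` in the direction of the parameters
    have h1 : fderiv ℂ (fun μ => F z μ) 0 v = L (0, v) := by
      have := (HasFDerivAt.comp (g := fun p : ℂ × (Fin k → ℂ) => F p.1 p.2) 0 hLd
        (hpair k)).fderiv
      exact congrArg (fun T => T v) this
    -- the differential of `F` in the direction of `z`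
    have h2 : L (1, 0) = ((d : ℂ) + 1) * z ^ d := by
      have h3 : HasDerivAt (fun y : ℂ => F y 0) (L (1, 0)) z :=
        HasFDerivAt.comp_hasDerivAt (f := fun y : ℂ => (y, (0 : Fin k → ℂ))) z hLd
          ((hasDerivAt_id z).prodMk (hasDerivAt_const z 0))
      have h4 : HasDerivAt (fun y : ℂ => F y 0) (((d + 1 : ℕ) : ℂ) * z ^ d) z := by
        refine (hasDerivAt_pow (d + 1) z).congr_of_eventuallyEq ?_
        filter_upwards [isOpen_ball.mem_nhds hzρ] with y hy
        exact (hFa y hy).2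
      rw [h3.unique h4]
      push_cast
      rfl
    -- both sides of the induced family, differentiated in the parameter
    have h5 : ∑ j, w j * z ^ (j : ℕ) = L (fderiv ℂ gp (z, 0) (0, w), v) := by
      have h6 : HasFDerivAt (fun lam => monomialDeformation d z lam) _ 0 :=
        HasFDerivAt.comp (g := fun p : ℂ × (Fin d → ℂ) => monomialDeformation d p.1 p.2) 0
          (hasFDerivAt_monomialDeformation_zero z) (hpair d)
      have h7 : HasFDerivAt (fun lam => g z lam) _ 0 :=
        HasFDerivAt.comp (g := gp) 0 hgz.differentiableAt.hasFDerivAt (hpair d)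
      have h8 := h7.prodMk hτ.differentiableAt.hasFDerivAt
      have hLd' : HasFDerivAt (fun p : ℂ × (Fin k → ℂ) => F p.1 p.2) L (g z 0, τ 0) := by
        rw [hgz0, hτ0]
        exact hLd
      have h9 := HasFDerivAt.comp (g := fun p : ℂ × (Fin k → ℂ) => F p.1 p.2) 0 hLd' h8
      have h10 : (fun lam => monomialDeformation d z lam) =ᶠ[𝓝 0]
          (fun p : ℂ × (Fin k → ℂ) => F p.1 p.2) ∘ fun lam => (g z lam, τ lam) :=
        (hpair d).continuousAt.eventually hMz
      have h11 := congrArg (fun T => T w) (h6.unique (h9.congr_of_eventuallyEq h10))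
      have h12 : ∑ j, w j * z ^ (j : ℕ) = ((((((d : ℂ) + 1) * z ^ d) •
          ContinuousLinearMap.fst ℂ ℂ (Fin d → ℂ) + (∑ j : Fin d, (z ^ (j : ℕ)) •
          ContinuousLinearMap.proj (R := ℂ) (φ := fun _ => ℂ) j).comp
          (ContinuousLinearMap.snd ℂ ℂ (Fin d → ℂ)))).comp
          (ContinuousLinearMap.inr ℂ ℂ (Fin d → ℂ))) w := by
        simp [mul_comm]
      rw [h12]
      exact h11
    have h13 : L (fderiv ℂ gp (z, 0) (0, w), v) =
        fderiv ℂ gp (z, 0) (0, w) * (((d : ℂ) + 1) * z ^ d) + fderiv ℂ (fun μ => F z μ) 0 v := by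
      rw [h1, ← h2, ← smul_eq_mul, ← map_smul, ← map_add]
      simp
    have h14 : ∑ j, (w - fderiv ℂ θ 0 v) j * z ^ (j : ℕ) =
        fderiv ℂ gp (z, 0) (0, w) * (((d : ℂ) + 1) * z ^ d) +
          (fderiv ℂ (fun μ => F z μ) 0 v - ∑ j, fderiv ℂ θ 0 v j * z ^ (j : ℕ)) := by
      simp only [Pi.sub_apply, sub_mul, Finset.sum_sub_distrib]
      rw [h5, h13]
      ring
    rw [h14]
    refine (norm_add_le _ _).trans ?_
    rw [add_mul (‖(d : ℂ) + 1‖ * K)]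
    refine add_le_add ?_ (hC z hzρ)
    rw [norm_mul, norm_mul, norm_pow]
    have := mul_le_mul_of_nonneg_right hKz (by positivity : 0 ≤ ‖(d : ℂ) + 1‖ * ‖z‖ ^ d)
    refine this.trans (le_of_eq ?_)
    ring
  exact (sub_eq_zero.1 hzero).symm

/-- The part of the definition of `pureStokesSet` inside the closure. -/
def stokesLocusOf {k : ℕ} (F : ℂ → (Fin k → ℂ) → ℂ) (r : ℝ) : Set (Fin k → ℂ) :=
  {lam | ∃ z : Fin 4 → ℂ,
    (∀ i, ‖z i‖ < r ∧ deriv (fun w => F w lam) (z i) = 0) ∧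
    Function.Injective (fun i => F (z i) lam) ∧
    F (z 0) lam + F (z 1) lam = F (z 2) lam + F (z 3) lam}

/-- A holomorphic function that is close to the identity has nonzero derivative. -/
lemma deriv_ne_zero_of_norm_sub_le {g : ℂ → ℂ} {ρ : ℝ} (hρ : 0 < ρ)
    (hg : DifferentiableOn ℂ g (ball 0 ρ)) (h : ∀ z ∈ ball (0 : ℂ) ρ, ‖g z - z‖ ≤ ρ / 8) {z : ℂ}
    (hz : ‖z‖ < ρ / 2) : deriv g z ≠ 0 := by
  have hsub : closedBall z (ρ / 4) ⊆ ball 0 ρ := by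
    intro y hy
    rw [mem_closedBall, dist_eq_norm] at hy
    rw [mem_ball_zero_iff]
    calc ‖y‖ = ‖(y - z) + z‖ := by rw [sub_add_cancel]
      _ ≤ ‖y - z‖ + ‖z‖ := norm_add_le _ _
      _ < ρ := by linarith
  have hz' : z ∈ ball (0 : ℂ) ρ := hsub (mem_closedBall_self (by positivity))
  have hd : DifferentiableOn ℂ (fun y => g y - y) (ball 0 ρ) := hg.sub differentiableOn_id
  have h1 : ‖deriv (fun y => g y - y) z‖ ≤ (ρ / 8) / (ρ / 4) := by
    refine Complex.norm_deriv_le_of_forall_mem_sphere_norm_le (by positivity) ?_ fun y hy =>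
      h y (hsub (sphere_subset_closedBall hy))
    exact (hd.mono (closure_ball_subset_closedBall.trans hsub)).diffContOnCl
  have hgz : DifferentiableAt ℂ g z := hg.differentiableAt (isOpen_ball.mem_nhds hz')
  have h2 : deriv (fun y => g y - y) z = deriv g z - 1 :=
    (hgz.hasDerivAt.sub (hasDerivAt_id z)).deriv
  intro h0
  rw [h2, h0, zero_sub, norm_neg, norm_one] at h1
  have h3 : ρ / 8 / (ρ / 4) = 1 / 2 := by field_simp; norm_num
  rw [h3] at h1
  norm_num at h1

/-- A holomorphic function that is close to the identity takes all values close to the origin. -/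
lemma exists_eq_of_norm_sub_le {g : ℂ → ℂ} {ρ r : ℝ} (hr : 0 < r) (hrρ : r < ρ)
    (hg : DifferentiableOn ℂ g (ball 0 ρ)) (h : ∀ z ∈ ball (0 : ℂ) ρ, ‖g z - z‖ ≤ r / 16) {w : ℂ}
    (hw : ‖w‖ < r / 8) : ∃ z, ‖z‖ < r ∧ g z = w := by
  have hsub : closedBall (0 : ℂ) (r / 2) ⊆ ball 0 ρ := closedBall_subset_ball (by linarith)
  have hd : DifferentiableOn ℂ (fun y => g y - w) (ball 0 ρ) := hg.sub (differentiableOn_const w)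
  obtain ⟨z, hz, hz0⟩ := exists_zero_of_norm_lt (f := fun y => g y - w) (c := 0) (R := r / 2)
    (by positivity) (hd.mono (closure_ball_subset_closedBall.trans hsub)).diffContOnCl (by
    intro z hz
    have h1 := h 0 (mem_ball_self (by linarith))
    have h2 := h z (hsub (sphere_subset_closedBall hz))
    have hz' : ‖z‖ = r / 2 := mem_sphere_zero_iff_norm.1 hz
    rw [sub_zero] at h1
    have h3 : ‖g 0 - w‖ ≤ ‖g 0‖ + ‖w‖ := norm_sub_le _ _
    have h4 : ‖z‖ ≤ ‖g z - w‖ + ‖g z - z‖ + ‖w‖ := by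
      calc ‖z‖ = ‖(g z - w) - (g z - z) + w‖ := by congr 1; ring
        _ ≤ ‖(g z - w) - (g z - z)‖ + ‖w‖ := norm_add_le _ _
        _ ≤ _ := by gcongr; exact norm_sub_le _ _
    linarith)
  exact ⟨z, by have := mem_ball_zero_iff.1 hz; linarith, sub_eq_zero.1 hz0⟩

/-- The critical points and values of `F (·, μ)` near the origin are those of the induced member of
the monomial deformation. -/
lemma eventually_mem_stokesLocusOf_iff {d k : ℕ} {F : ℂ → (Fin k → ℂ) → ℂ} {ρ r : ℝ}
    (hr : 0 < r) (hrρ : r < ρ / 2) {γ : (Fin k → ℂ) → ℂ → ℂ} {θ : (Fin k → ℂ) → Fin d → ℂ}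
    (hθ : ContinuousAt θ 0) (hθ0 : θ 0 = 0)
    (hγ : ∀ᶠ μ in 𝓝 0, DifferentiableOn ℂ (γ μ) (ball 0 ρ) ∧
      ∀ z ∈ ball (0 : ℂ) ρ, F z μ = monomialDeformation d (γ μ z) (θ μ))
    (hγ' : ∀ δ > 0, ∀ᶠ μ in 𝓝 0, ∀ z ∈ ball (0 : ℂ) ρ, ‖γ μ z - z‖ ≤ δ) :
    ∀ᶠ μ in 𝓝 0, μ ∈ stokesLocusOf F r ↔ θ μ ∈ stokesLocus d := by
  have hρ : 0 < ρ := by linarith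
  have hcrit : ∀ᶠ μ in 𝓝 0, ∀ z, deriv (fun w => monomialDeformation d w (θ μ)) z = 0 →
      ‖z‖ < r / 8 := by
    refine hθ.eventually (p := fun lam => ∀ z,
      deriv (fun w => monomialDeformation d w lam) z = 0 → ‖z‖ < r / 8) ?_
    rw [hθ0]
    exact eventually_norm_lt_of_deriv_eq_zero d (by positivity)
  filter_upwards [hγ, hγ' (r / 16) (by positivity), hcrit] with μ ⟨hd, hFM⟩ hδ hsmall
  have hiff : ∀ z, ‖z‖ < r → (deriv (fun w => F w μ) z = 0 ↔
      deriv (fun w => monomialDeformation d w (θ μ)) (γ μ z) = 0) := by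
    intro z hz
    have hzρ : z ∈ ball (0 : ℂ) ρ := by rw [mem_ball_zero_iff]; linarith
    have h1 : (fun w => F w μ) =ᶠ[𝓝 z]
        (fun w => monomialDeformation d w (θ μ)) ∘ γ μ := by
      filter_upwards [isOpen_ball.mem_nhds hzρ] with w hw
      exact hFM w hw
    have h2 : DifferentiableAt ℂ (fun w => monomialDeformation d w (θ μ)) (γ μ z) := by
      unfold monomialDeformation
      fun_prop
    have h3 : DifferentiableAt ℂ (γ μ) z := hd.differentiableAt (isOpen_ball.mem_nhds hzρ)
    rw [h1.deriv_eq, deriv_comp z h2 h3, mul_eq_zero, or_iff_left]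
    exact deriv_ne_zero_of_norm_sub_le hρ hd
      (fun w hw => (hδ w hw).trans (by linarith)) (by linarith)
  have hval : ∀ z, ‖z‖ < r → F z μ = monomialDeformation d (γ μ z) (θ μ) := fun z hz =>
    hFM z (by rw [mem_ball_zero_iff]; linarith)
  constructor
  · rintro ⟨z, hz, hinj, hrel⟩
    simp only [fun i => hval (z i) (hz i).1] at hinj hrel
    exact ⟨fun i => γ μ (z i), fun i => (hiff _ (hz i).1).1 (hz i).2, hinj, hrel⟩
  · rintro ⟨w, hw, hinj, hrel⟩
    choose z hz hzw using fun i => exists_eq_of_norm_sub_le hr (by linarith) hd hδ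
      (hsmall (w i) (hw i))
    refine ⟨z, fun i => ⟨hz i, (hiff _ (hz i)).2 (by rw [hzw]; exact hw i)⟩, ?_, ?_⟩
    · simpa only [fun i => hval (z i) (hz i), hzw] using hinj
    · simpa only [fun i => hval (z i) (hz i), hzw] using hrel

end Transfer

/-! ### Pulling back the reduced equation -/

section Pullback

lemma analyticAt_eval {d : ℕ} (p : MvPolynomial (Fin d) ℂ) (y : Fin d → ℂ) :
    AnalyticAt ℂ (fun y => MvPolynomial.eval y p) y :=
  AnalyticOnNhd.eval_mvPolynomial p y (Set.mem_univ y)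

lemma eventually_surjective_fderiv {k d : ℕ} {θ : (Fin k → ℂ) → Fin d → ℂ}
    (hθ : AnalyticAt ℂ θ 0) (hs : Function.Surjective (fderiv ℂ θ 0)) :
    ∀ᶠ μ in 𝓝 0, Function.Surjective (fderiv ℂ θ μ) := by
  obtain ⟨B, hB⟩ := LinearMap.exists_rightInverse_of_surjective
    (fderiv ℂ θ 0 : (Fin k → ℂ) →ₗ[ℂ] Fin d → ℂ) (LinearMap.range_eq_top.2 hs)
  set B' : (Fin d → ℂ) →L[ℂ] Fin k → ℂ := LinearMap.toContinuousLinearMap B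
  have h1 : (fderiv ℂ θ 0).comp B' = 1 := by
    refine ContinuousLinearMap.ext fun w => ?_
    exact congrArg (fun T : (Fin d → ℂ) →ₗ[ℂ] Fin d → ℂ => T w) hB
  have h2 : ContinuousAt (fun μ => (fderiv ℂ θ μ).comp B') 0 :=
    hθ.fderiv.continuousAt.clm_comp continuousAt_const
  have h3 : {T : (Fin d → ℂ) →L[ℂ] Fin d → ℂ | IsUnit T} ∈ 𝓝 ((fderiv ℂ θ 0).comp B') := by
    rw [h1]
    exact Units.isOpen.mem_nhds isUnit_one
  filter_upwards [h2 h3] with μ hμ w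
  obtain ⟨u, hu⟩ : IsUnit ((fderiv ℂ θ μ).comp B') := hμ
  refine ⟨B' ((↑u⁻¹ : (Fin d → ℂ) →L[ℂ] Fin d → ℂ) w), ?_⟩
  have h4 := congrArg (fun T : (Fin d → ℂ) →L[ℂ] Fin d → ℂ => T w) u.mul_inv
  rw [hu] at h4
  exact h4

/-- Pulling back by a submersion preserves reduced equations. -/
theorem IsStokesPoly.isReducedEquation {d k : ℕ} {p : MvPolynomial (Fin d) ℂ}
    (hp : IsStokesPoly p) {X : Set (Fin k → ℂ)} {θ : (Fin k → ℂ) → Fin d → ℂ}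
    (hθ : AnalyticAt ℂ θ 0) (hs : Function.Surjective (fderiv ℂ θ 0))
    (hX : ∀ᶠ μ in 𝓝 0, μ ∈ X ↔ θ μ ∈ stokesLocus d) :
    IsReducedEquation (closure X) (fun μ => MvPolynomial.eval (θ μ) p) := by
  set g : (Fin k → ℂ) → ℂ := fun μ => MvPolynomial.eval (θ μ) p with hg
  have hga : AnalyticAt ℂ g 0 := (analyticAt_eval p (θ 0)).comp hθ
  obtain ⟨U, hU, hUo, h0U⟩ := eventually_nhds_iff.1
    ((hθ.eventually_analyticAt.and (eventually_surjective_fderiv hθ hs)).and hX)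
  have hUn : ∀ᶠ μ in 𝓝 (0 : Fin k → ℂ), μ ∈ U := hUo.mem_nhds h0U
  have hgU : ∀ μ ∈ U, AnalyticAt ℂ g μ := fun μ hμ =>
    (analyticAt_eval p (θ μ)).comp (hU μ hμ).1.1
  have hclosed : ∀ μ ∈ U, μ ∈ closure X → g μ = 0 := by
    intro μ hμ hcl
    by_contra hne
    have h1 : ∀ᶠ ν in 𝓝 μ, g ν ≠ 0 ∧ ν ∈ U :=
      ((hgU μ hμ).continuousAt.eventually_ne hne).and (hUo.mem_nhds hμ)
    obtain ⟨ν, ⟨hν0, hνU⟩, hνX⟩ := mem_closure_iff_nhds.1 hcl _ h1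
    exact hν0 (hp.eval_eq_zero ((hU ν hνU).2.1 hνX))
  -- `θ` is an open map near the origin
  have hdense : ∀ μ ∈ U, g μ = 0 → μ ∈ closure {y | y ∈ X ∧ fderiv ℂ g y ≠ 0} := by
    intro μ hμ h0
    rw [mem_closure_iff_nhds]
    intro V hV
    have hstrict := (hU μ hμ).1.1.hasStrictFDerivAt
    have hmap := hstrict.map_nhds_eq_of_surj (LinearMap.range_eq_top.2 (hU μ hμ).1.2)
    have hVU : θ '' (V ∩ U) ∈ 𝓝 (θ μ) := by
      rw [← hmap]
      exact image_mem_map (inter_mem hV (hUo.mem_nhds hμ))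
    obtain ⟨y, ⟨ν, ⟨hνV, hνU⟩, rfl⟩, hyS, hyd⟩ :=
      mem_closure_iff_nhds.1 (hp.mem_closure h0) _ hVU
    refine ⟨ν, hνV, (hU ν hνU).2.2 hyS, fun hν0 => hyd ?_⟩
    have hcomp : fderiv ℂ g ν =
        (fderiv ℂ (fun y => MvPolynomial.eval y p) (θ ν)).comp (fderiv ℂ θ ν) :=
      fderiv_comp ν (analyticAt_eval p _).differentiableAt (hU ν hνU).1.1.differentiableAt
    refine ContinuousLinearMap.ext fun w => ?_
    obtain ⟨v, rfl⟩ := (hU ν hνU).1.2 w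
    rw [hν0] at hcomp
    exact (congrArg (fun T => T v) hcomp).symm
  have hsub : {y | y ∈ X ∧ fderiv ℂ g y ≠ 0} ⊆ {y | y ∈ closure X ∧ fderiv ℂ g y ≠ 0} :=
    fun y hy => ⟨subset_closure hy.1, hy.2⟩
  refine ⟨hga, ?_, ?_⟩
  · filter_upwards [hUn] with μ hμ
    exact ⟨hclosed μ hμ, fun h0 => closure_mono (fun y hy => hy.1) (hdense μ hμ h0)⟩
  · filter_upwards [hUn] with μ hμ hcl
    exact closure_mono hsub (hdense μ hμ (hclosed μ hμ hcl))

/-- The order along a line of the pulled back equation is governed by the component of degree `m`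
at the image of the direction. -/
theorem IsStokesPoly.lineOrder_comp {n m k : ℕ} (hn : 0 < n)
    (hm : (n + n) * m = (n + n + 1) * (3 * (n + n).choose 4) + n.choose 2)
    {p : MvPolynomial (Fin (n + n)) ℂ} (hp : IsStokesPoly p)
    {θ : (Fin k → ℂ) → Fin (n + n) → ℂ} (hθ : AnalyticAt ℂ θ 0) (hθ0 : θ 0 = 0)
    (v : Fin k → ℂ) :
    (m : ℕ∞) ≤ lineOrder (fun μ => MvPolynomial.eval (θ μ) p) v ∧
    (n = 1 → lineOrder (fun μ => MvPolynomial.eval (θ μ) p) v = m) ∧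
    (2 ≤ n → (defPoly (fderiv ℂ θ 0 v)).coeff 1 ≠ 0 → (defPoly (fderiv ℂ θ 0 v)).coeff 2 ≠ 0 →
      lineOrder (fun μ => MvPolynomial.eval (θ μ) p) v = m) ∧
    (2 ≤ n → (defPoly (fderiv ℂ θ 0 v)).coeff 2 = 0 →
      (m : ℕ∞) < lineOrder (fun μ => MvPolynomial.eval (θ μ) p) v) := by
  have hlim : ∀ w : Fin (n + n) → ℂ, ∃ l, Tendsto (fun t : ℂ => MvPolynomial.eval (t • w) p / t ^ m)
      (𝓝[≠] 0) (𝓝 l) := fun w => by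
    obtain ⟨l, hl, -⟩ := hp.exists_tendsto_smul hn hm w
    exact ⟨l, hl⟩
  set w := fderiv ℂ θ 0 v with hw
  obtain ⟨l, hl, hl1, hl2⟩ := hp.exists_tendsto_smul hn hm w
  have hl' : l = MvPolynomial.eval w (MvPolynomial.homogeneousComponent m p) :=
    tendsto_nhds_unique hl (tendsto_eval_smul_div_pow hlim tendsto_const_nhds)
  have hline : HasDerivAt (fun t : ℂ => t • v) v 0 := by
    simpa using (hasDerivAt_id (0 : ℂ)).smul_const v
  have hθv : HasDerivAt (fun t : ℂ => θ (t • v)) w 0 := by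
    have h1 : HasFDerivAt θ (fderiv ℂ θ 0) ((0 : ℂ) • v) := by
      rw [zero_smul]
      exact hθ.differentiableAt.hasFDerivAt
    exact h1.comp_hasDerivAt 0 hline
  have hu : Tendsto (fun t : ℂ => t⁻¹ • θ (t • v)) (𝓝[≠] 0) (𝓝 w) := by
    refine (hasDerivAt_iff_tendsto_slope.1 hθv).congr fun t => ?_
    simp [slope_def_module, hθ0]
  have hmain := tendsto_eval_smul_div_pow hlim hu
  rw [← hl'] at hmain
  have hmain' : Tendsto (fun t : ℂ => MvPolynomial.eval (θ (t • v)) p / t ^ m) (𝓝[≠] 0)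
      (𝓝 l) := by
    refine hmain.congr' ?_
    filter_upwards [self_mem_nhdsWithin] with t ht
    rw [smul_inv_smul₀ (show t ≠ 0 from ht)]
  have han : AnalyticAt ℂ (fun t : ℂ => MvPolynomial.eval (θ (t • v)) p) 0 := by
    refine AnalyticAt.comp (g := fun y => MvPolynomial.eval y p) (analyticAt_eval p _) ?_
    refine AnalyticAt.comp (g := θ) (f := fun t : ℂ => t • v) (by rwa [zero_smul]) ?_
    exact analyticAt_id.smul analyticAt_const
  obtain ⟨h1, h2, h3⟩ := analyticOrderAt_of_tendsto_div_pow han hmain'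
  refine ⟨h1, fun h => h2 (hl1 h), fun h h4 h5 => h2 ((hl2 h).2 ⟨h4, h5⟩), fun h h4 => h3 ?_⟩
  by_contra hne
  exact ((hl2 h).1 hne).2 h4

/-- The direction whose image has all coordinates equal to one realizes the minimal order. -/
theorem IsStokesPoly.vanishingOrder_comp {n m k : ℕ} (hn : 0 < n)
    (hm : (n + n) * m = (n + n + 1) * (3 * (n + n).choose 4) + n.choose 2)
    {p : MvPolynomial (Fin (n + n)) ℂ} (hp : IsStokesPoly p)
    {θ : (Fin k → ℂ) → Fin (n + n) → ℂ} (hθ : AnalyticAt ℂ θ 0) (hθ0 : θ 0 = 0)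
    (hs : Function.Surjective (fderiv ℂ θ 0)) :
    vanishingOrder (fun μ => MvPolynomial.eval (θ μ) p) = m := by
  refine le_antisymm ?_ (le_iInf fun v => (hp.lineOrder_comp hn hm hθ hθ0 v).1)
  obtain ⟨v, hv⟩ := hs 1
  refine (iInf_le _ v).trans (le_of_eq ?_)
  obtain ⟨-, h1, h2, -⟩ := hp.lineOrder_comp hn hm hθ hθ0 v
  rcases (Nat.succ_le_of_lt hn).eq_or_lt with h | h
  · exact h1 h.symm
  · have h' : 2 ≤ n := h
    refine h2 h ?_ ?_
    · rw [hv, coeff_defPoly_of_lt _ (by omega)]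
      exact one_ne_zero
    · rw [hv, coeff_defPoly_of_lt _ (by omega)]
      exact one_ne_zero

lemma eventually_mem_stokesLocusOf_monomialDeformation_iff (d : ℕ) {r : ℝ} (hr : 0 < r) :
    ∀ᶠ lam in 𝓝 0, lam ∈ stokesLocusOf (monomialDeformation d) r ↔ lam ∈ stokesLocus d := by
  filter_upwards [eventually_norm_lt_of_deriv_eq_zero d hr] with lam h
  constructor
  · rintro ⟨z, hz, hz'⟩
    exact ⟨z, fun i => (hz i).2, hz'⟩
  · rintro ⟨z, hz, hz'⟩
    exact ⟨z, fun i => ⟨h _ (hz i), hz i⟩, hz'⟩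

end Pullback

end PureStokes

open PureStokes in
theorem theorem4 (d : ℕ) (hd : Even d) (hd0 : 0 < d) :
    ∃ m : ℕ,
      (m : ℚ) = ((d : ℚ) - 2) * (((d : ℚ) + 1) * ((d : ℚ) - 1) * ((d : ℚ) - 3) + 1) / 8 ∧
      -- the local multiplicity for every versal deformation of `z^(d+1)`
      (∀ (k : ℕ) (F : ℂ → (Fin k → ℂ) → ℂ),
        IsVersalDeformation (fun z : ℂ => z ^ (d + 1)) F →
        ∀ᶠ r in 𝓝[>] (0 : ℝ), HasLocalMultiplicity (pureStokesSet F r) m) ∧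
      -- the lines `z^(d+1) - ε φ(z)` in the monomial deformation
      (∀ᶠ r in 𝓝[>] (0 : ℝ), ∃ g : (Fin d → ℂ) → ℂ,
        IsReducedEquation (pureStokesSet (monomialDeformation d) r) g ∧
        vanishingOrder g = m ∧
        (4 ≤ d →
          -- linear perturbations: the line lies in the pure Stokes' set
          (∀ φ : Polynomial ℂ, φ.degree ≤ 1 →
            ∀ᶠ ε in 𝓝 (0 : ℂ),
              ε • lineDirection d φ ∈ pureStokesSet (monomialDeformation d) r) ∧
          -- without a quadratic term the line is not generic
          (∀ φ : Polynomial ℂ, φ.degree < d → φ.coeff 2 = 0 →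
            (m : ℕ∞) < lineOrder g (lineDirection d φ)) ∧
          -- with nonzero linear and quadratic terms the line is generic
          (∀ φ : Polynomial ℂ, φ.degree < d → φ.coeff 1 ≠ 0 → φ.coeff 2 ≠ 0 →
            lineOrder g (lineDirection d φ) = m))) := by
  obtain ⟨n, rfl⟩ := hd
  have hn : 0 < n := by omega
  obtain ⟨m, hmq, hm⟩ := exists_multiplicity hn
  obtain ⟨p, hp'⟩ := exists_stokesPoly (n + n)
  have hp : IsStokesPoly p := hp'
  refine ⟨m, hmq, ?_, ?_⟩
  · intro k F hF
    obtain ⟨ρ, hρ, γ, θ, hθ, hθ0, hγ, hγ', hFa, hθd⟩ := exists_eq_monomialDeformation hF.1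
    have hs := surjective_fderiv_of_isVersalDeformation hF hρ hFa hθd
    filter_upwards [Ioo_mem_nhdsGT (show (0 : ℝ) < ρ / 2 by positivity)] with r hr
    have hX := eventually_mem_stokesLocusOf_iff hr.1 hr.2 hθ.continuousAt hθ0 hγ hγ'
    exact ⟨_, hp.isReducedEquation hθ hs hX, hp.vanishingOrder_comp hn hm hθ hθ0 hs⟩
  · filter_upwards [self_mem_nhdsWithin] with r hr
    have hX := eventually_mem_stokesLocusOf_monomialDeformation_iff (n + n) hr
    have hid : AnalyticAt ℂ (id : (Fin (n + n) → ℂ) → Fin (n + n) → ℂ) 0 := analyticAt_id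
    have hs : Function.Surjective
        (fderiv ℂ (id : (Fin (n + n) → ℂ) → Fin (n + n) → ℂ) 0) := by
      rw [fderiv_id]
      exact fun v => ⟨v, rfl⟩
    have hred := hp.isReducedEquation hid hs hX
    refine ⟨_, hred, hp.vanishingOrder_comp hn hm hid rfl hs, fun hd4 => ⟨?_, ?_, ?_⟩⟩
    · intro φ hφ
      have hline : Tendsto (fun ε : ℂ => ε • lineDirection (n + n) φ) (𝓝 0) (𝓝 0) := by
        have : Continuous fun ε : ℂ => ε • lineDirection (n + n) φ := by fun_prop
        simpa using this.tendsto 0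
      filter_upwards [hline.eventually hred.2.1] with ε hε
      refine hε.2 (hp.eval_smul_eq_zero (by omega) (fun j hj => ?_) ε)
      rw [lineDirection, neg_eq_zero]
      refine Polynomial.coeff_eq_zero_of_degree_lt (hφ.trans_lt ?_)
      exact_mod_cast hj
    · intro φ _ h2
      refine (hp.lineOrder_comp hn hm hid rfl _).2.2.2 (by omega) ?_
      rw [fderiv_id, ContinuousLinearMap.id_apply, coeff_defPoly_of_lt _ (by omega)]
      simp [lineDirection, h2]
    · intro φ _ h1 h2
      refine (hp.lineOrder_comp hn hm hid rfl _).2.2.1 (by omega) ?_ ?_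
      · rw [fderiv_id, ContinuousLinearMap.id_apply, coeff_defPoly_of_lt _ (by omega)]
        simpa [lineDirection] using h1
      · rw [fderiv_id, ContinuousLinearMap.id_apply, coeff_defPoly_of_lt _ (by omega)]
        simpa [lineDirection] using h2
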